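/- Let $\mathbb{N}=\{0,1,2,\dots\}$ and let $\mathbb{B}_1,\mathbb{B}_2$ be Banach spaces over the same field ($\mathbb{R}$ or $\mathbb{C}$). For a Banach space $\mathbb{B}$, $\ell^r_{\mathbb{B}}(\mathbb{N})$ denotes the space of $\mathbb{B}$-valued $r$-summable sequences. For $w:\mathbb{N}\to(0,\infty)$ and $1\le p<\infty$, $\ell^p_{\mathbb{B}}(\mathbb{N},w)$ denotes the space of sequences $f:\mathbb{N}\to\mathbb{B}$ with $\|f\|_{\ell^p_{\mathbb{B}}(\mathbb{N},w)}=\big(\sum_n\|f(n)\|^p w(n)\big)^{1/p}<\infty$, and $\ell^{1,\infty}_{\mathbb{B}}(\mathbb{N},w)$ the space of sequences with $\|f\|_{\ell^{1,\infty}_{\mathbb{B}}(\mathbb{N},w)}=\sup_{t>0}t\sum_{n:\,\|f(n)\|>t}w(n)<\infty$. We write $w\in A_p(\mathbb{N})$, $1<p<\infty$, if $$\sup_{0\le n\le m}\frac{1}{(m-n+1)^p}\Big(\sum_{k=n}^m w(k)\Big)\Big(\sum_{k=n}^m w(k)^{-1/(p-1)}\Big)^{p-1}<\infty ,$$ and $w\in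 A_1(\mathbb{N})$ if $$\sup_{0\le n\le m}\frac{1}{m-n+1}\Big(\sum_{k=n}^m w(k)\Big)\max_{n\le k\le m}\frac1{w(k)}<\infty .$$ **Theorem.** Let $1<r<\infty$ and let $T$ be a bounded linear operator from $\ell^r_{\mathbb{B}_1}(\mathbb{N})$ into $\ell^r_{\mathbb{B}_2}(\mathbb{N})$. Suppose that there are $C>0$ and a function $K:\{(n,m)\in\mathbb{N}^2:n\ne m\}\to\mathcal{L}(\mathbb{B}_1,\mathbb{B}_2)$ such that * (a) $\|K(n,m)\|\le \dfrac{C}{|n-m|}$ for all $n\neq m$; * (b) $\|K(n,m)-K(\ell,m)\|\le C\dfrac{|n-\ell|}{|n-m|^2}$ and $\|K(m,n)-K(m,\ell)\|\le C\dfrac{|n-\ell|}{|n-m|^2}$ for all $n,m,\ell\in\mathbb{N}$ with $|n-m|>2|n-\ell|$ and $\frac m2<n,\ell<\frac{3m}2$; * (c) for every finitely supported $f:\mathbb{N}\to\mathbb{B}_1$ and every $n$ with $f(n)=0$, $\;T(f)(n)=\sum_{m\ne n}K(n,m)f(m)$. Then: (i) for every $1<p<\infty$ and $w\in A_p(\mathbb{N})$,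 the restriction of $T$ to $\ell^r_{\mathbb{B}_1}(\mathbb{N})\cap\ell^p_{\mathbb{B}_1}(\mathbb{N},w)$ extends to a bounded linear operator from $\ell^p_{\mathbb{B}_1}(\mathbb{N},w)$ into $\ell^p_{\mathbb{B}_2}(\mathbb{N},w)$; (ii) for every $w\in A_1(\mathbb{N})$, the restriction of $T$ to $\ell^r_{\mathbb{B}_1}(\mathbb{N})\cap\ell^1_{\mathbb{B}_1}(\mathbb{N},w)$ extends to a bounded linear operator from $\ell^1_{\mathbb{B}_1}(\mathbb{N},w)$ into $\ell^{1,\infty}_{\mathbb{B}_2}(\mathbb{N},w)$. -/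

import Mathlib

open MeasureTheory
open scoped ENNReal NNReal

/-- The measure on `ℕ` giving mass `w n` to the point `n`. -/
noncomputable def weightMeasure (w : ℕ → ℝ) : Measure ℕ :=
  Measure.sum fun n => ENNReal.ofReal (w n) • Measure.dirac n

/-- The Muckenhoupt class `A_p(ℕ)`, for `1 < p < ∞`. -/
def IsMuckenhouptAp (p : ℝ) (w : ℕ → ℝ) : Prop :=
  (∀ n, 0 < w n) ∧
    ∃ A : ℝ, ∀ n m : ℕ, n ≤ m →
      1 / ((m : ℝ) - n + 1) ^ p * (∑ k ∈ Finset.Icc n m, w k) *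
        (∑ k ∈ Finset.Icc n m, w k ^ (-1 / (p - 1))) ^ (p - 1) ≤ A

/-- The Muckenhoupt class `A_1(ℕ)`. -/
def IsMuckenhouptA1 (w : ℕ → ℝ) : Prop :=
  (∀ n, 0 < w n) ∧
    ∃ A : ℝ, ∀ (n m : ℕ) (h : n ≤ m),
      1 / ((m : ℝ) - n + 1) * (∑ k ∈ Finset.Icc n m, w k) *
        (Finset.Icc n m).sup' (Finset.nonempty_Icc.2 h) (fun k => 1 / w k) ≤ A

/-- The weighted space `ℓ^p_E(ℕ, w)` of `E`-valued sequences; its norm is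
`eLpNorm f p (weightMeasure w)`, that is, `(∑ ‖f n‖ ^ p * w n) ^ (1 / p)`. For a strictly positive
weight every null set is empty, so there is no need to pass to classes. -/
def weightedLp (𝕜 E : Type*) [RCLike 𝕜] [NormedAddCommGroup E] [NormedSpace 𝕜 E]
    (p : ℝ≥0∞) (w : ℕ → ℝ) : Submodule 𝕜 (ℕ → E) where
  carrier := {f | MemLp f p (weightMeasure w)}
  zero_mem' := MemLp.zero
  add_mem' hf hg := hf.add hg
  smul_mem' c _ hf := hf.const_smul c

/-- The quasinorm of the weak space `ℓ^{1,∞}_E(ℕ, w)`: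
the supremum over `t > 0` of `t` times the `w`-mass of `{n | t < ‖f n‖}`. -/
noncomputable def weakL1Norm {E : Type*} [NormedAddCommGroup E] (w : ℕ → ℝ) (f : ℕ → E) : ℝ≥0∞ :=
  ⨆ t : ℝ≥0, (t : ℝ≥0∞) * weightMeasure w {n | t < ‖f n‖₊}

theorem weakL1Norm_add_le {E : Type*} [NormedAddCommGroup E] (w : ℕ → ℝ) (f g : ℕ → E) :
    weakL1Norm w (f + g) ≤ 2 * (weakL1Norm w f + weakL1Norm w g) := by
  refine iSup_le fun t => ?_
  have hsub : {n | t < ‖(f + g) n‖₊} ⊆ {n | t / 2 < ‖f n‖₊} ∪ {n | t / 2 < ‖g n‖₊} := by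
    intro n hn
    by_contra hc
    simp only [Set.mem_union, Set.mem_setOf_eq, not_or, not_lt] at hc
    have h1 : t < ‖f n‖₊ + ‖g n‖₊ := lt_of_lt_of_le hn (nnnorm_add_le _ _)
    have h2 := add_le_add hc.1 hc.2
    rw [add_halves] at h2
    exact absurd (lt_of_lt_of_le h1 h2) (lt_irrefl _)
  have ht : (t : ℝ≥0∞) = 2 * ((t / 2 : ℝ≥0) : ℝ≥0∞) := by
    have : t = 2 * (t / 2) := by field_simp
    exact_mod_cast congrArg ((↑) : ℝ≥0 → ℝ≥0∞) this
  calc (t : ℝ≥0∞) * weightMeasure w {n | t < ‖(f + g) n‖₊}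
      ≤ (t : ℝ≥0∞) * (weightMeasure w {n | t / 2 < ‖f n‖₊}
          + weightMeasure w {n | t / 2 < ‖g n‖₊}) := by
        gcongr
        exact (measure_mono hsub).trans (measure_union_le _ _)
    _ = 2 * (((t / 2 : ℝ≥0) : ℝ≥0∞) * weightMeasure w {n | t / 2 < ‖f n‖₊}
          + ((t / 2 : ℝ≥0) : ℝ≥0∞) * weightMeasure w {n | t / 2 < ‖g n‖₊}) := by
        rw [ht]; ring
    _ ≤ 2 * (weakL1Norm w f + weakL1Norm w g) := by
        gcongr
        · exact le_iSup (fun s : ℝ≥0 => (s : ℝ≥0∞) * weightMeasure w {n | s < ‖f n‖₊}) (t / 2)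
        · exact le_iSup (fun s : ℝ≥0 => (s : ℝ≥0∞) * weightMeasure w {n | s < ‖g n‖₊}) (t / 2)

theorem weakL1Norm_smul_le {𝕜 E : Type*} [RCLike 𝕜] [NormedAddCommGroup E] [NormedSpace 𝕜 E]
    (w : ℕ → ℝ) (c : 𝕜) (f : ℕ → E) :
    weakL1Norm w (c • f) ≤ (‖c‖₊ : ℝ≥0∞) * weakL1Norm w f := by
  refine iSup_le fun t => ?_
  rcases eq_or_ne c 0 with rfl | hc
  · simp
  have hc' : ‖c‖₊ ≠ 0 := nnnorm_ne_zero_iff.2 hc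
  have hset : {n | t < ‖(c • f) n‖₊} = {n | t / ‖c‖₊ < ‖f n‖₊} := by
    ext n
    simp only [Set.mem_setOf_eq, Pi.smul_apply, nnnorm_smul]
    rw [div_lt_iff₀ (pos_iff_ne_zero.2 hc'), mul_comm]
  have ht : (t : ℝ≥0∞) = ‖c‖₊ * ((t / ‖c‖₊ : ℝ≥0) : ℝ≥0∞) := by
    have : t = ‖c‖₊ * (t / ‖c‖₊) := by field_simp
    exact_mod_cast congrArg ((↑) : ℝ≥0 → ℝ≥0∞) this
  rw [hset]
  nth_rewrite 1 [ht]
  rw [mul_assoc]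
  gcongr
  exact le_iSup (fun s : ℝ≥0 => (s : ℝ≥0∞) * weightMeasure w {n | s < ‖f n‖₊}) (t / ‖c‖₊)

/-- The weighted weak space `ℓ^{1,∞}_E(ℕ, w)`. -/
def weightedWeakL1 (𝕜 E : Type*) [RCLike 𝕜] [NormedAddCommGroup E] [NormedSpace 𝕜 E]
    (w : ℕ → ℝ) : Submodule 𝕜 (ℕ → E) where
  carrier := {f | weakL1Norm w f < ∞}
  zero_mem' := by simp [weakL1Norm]
  add_mem' {f g} hf hg :=
    (weakL1Norm_add_le w f g).trans_lt
      (ENNReal.mul_lt_top (by simp) (ENNReal.add_lt_top.2 ⟨hf, hg⟩))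
  smul_mem' c f hf :=
    (weakL1Norm_smul_le w c f).trans_lt (ENNReal.mul_lt_top ENNReal.coe_lt_top hf)

/-- Local `L(E, F)`-standard kernels. The kernel is only meant off the diagonal: no condition
involves a value `K n n` (in the two regularity conditions `n ≠ m` and `l ≠ m` follow from
`|n - m| > 2 |n - l|`). -/
def IsLocalStandardKernel {𝕜 E F : Type*} [RCLike 𝕜] [NormedAddCommGroup E] [NormedSpace 𝕜 E]
    [NormedAddCommGroup F] [NormedSpace 𝕜 F] (K : ℕ → ℕ → E →L[𝕜] F) : Prop :=
  ∃ C : ℝ, 0 < C ∧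
    (∀ n m : ℕ, n ≠ m → ‖K n m‖ ≤ C / |(n : ℝ) - m|) ∧
    (∀ n m l : ℕ, |(n : ℝ) - m| > 2 * |(n : ℝ) - l| →
      (m : ℝ) / 2 < n → (n : ℝ) < 3 * m / 2 → (m : ℝ) / 2 < l → (l : ℝ) < 3 * m / 2 →
      ‖K n m - K l m‖ ≤ C * (|(n : ℝ) - l| / |(n : ℝ) - m| ^ 2)) ∧
    (∀ n m l : ℕ, |(n : ℝ) - m| > 2 * |(n : ℝ) - l| →
      (m : ℝ) / 2 < n → (n : ℝ) < 3 * m / 2 → (m : ℝ) / 2 < l → (l : ℝ) < 3 * m / 2 →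
      ‖K m n - K m l‖ ≤ C * (|(n : ℝ) - l| / |(n : ℝ) - m| ^ 2))

/-!
The regularity of the kernel is only available for `m / 2 < n, l < 3 * m / 2`. Elsewhere the size
bound replaces it, so that the oscillation of `K` over a dyadic interval of length `2 ^ k` is at
most a Poisson-type kernel `2 ^ k / |n - m| ^ 2` plus the Hardy-type kernels `1 / (n + 1)` for
`m ≤ n` and `1 / (m + 1)` for `n ≤ m`, and the latter are harmless for Muckenhoupt weights on `ℕ`.
With this substitute for the usual regularity, a Calderón–Zygmund decomposition gives weak type
`(1, 1)` with respect to an `A₁` weight as soon as some strong type bound holds for that weight. The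
unweighted case starts a stopping-time argument: off an exceptional set of small measure `T f` is
controlled on a dyadic interval by the mean of `‖f‖` over its triple, and recursion on the
exceptional set dominates `T f` by a sparse sum, which is bounded on `ℓ^p(w)` for every `A_p`
weight. Since `A₁` weights are `A₂` weights, the first step applies again with weight `w`.

The diagonal of the matrix of `T` is arbitrary, so it is not part of `K`; it enters only through the
bound of `T` on `ℓ^r`.
-/

namespace LocalCZ

open Finset

section OrderedSums

variable {ι κ M : Type*} [DecidableEq ι] [AddCommMonoid M] [PartialOrder M]
  [IsOrderedAddMonoid M] {f : ι → M}

theorem sum_union_le_of_nonneg (hf : ∀ i, 0 ≤ f i) (s t : Finset ι) :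
    ∑ i ∈ s ∪ t, f i ≤ ∑ i ∈ s, f i + ∑ i ∈ t, f i :=
  sum_union_inter (s₁ := s) (s₂ := t) (f := f) ▸
    le_add_of_nonneg_right (sum_nonneg fun i _ => hf i)

theorem sum_biUnion_le_of_nonneg (hf : ∀ i, 0 ≤ f i) (s : Finset κ) (t : κ → Finset ι) :
    ∑ i ∈ s.biUnion t, f i ≤ ∑ k ∈ s, ∑ i ∈ t k, f i := by
  classical
  induction s using Finset.induction_on with
  | empty => simp
  | insert k s hk ih =>
    rw [biUnion_insert, sum_insert hk]
    exact (sum_union_le_of_nonneg hf _ _).trans (by gcongr)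

end OrderedSums

theorem sum_filter_lt_mul_le {ι : Type*} {s : Finset ι} {w X : ι → ℝ} (hw : ∀ i, 0 ≤ w i)
    (hX : ∀ i, 0 ≤ X i) (τ : ℝ) : τ * ∑ i ∈ s with τ < X i, w i ≤ ∑ i ∈ s, X i * w i :=
  calc τ * ∑ i ∈ s with τ < X i, w i = ∑ i ∈ s with τ < X i, τ * w i := mul_sum _ _ _
    _ ≤ ∑ i ∈ s with τ < X i, X i * w i := sum_le_sum fun i hi =>
        mul_le_mul_of_nonneg_right (mem_filter.1 hi).2.le (hw i)
    _ ≤ ∑ i ∈ s, X i * w i := sum_le_sum_of_subset_of_nonneg (filter_subset _ _) fun i _ _ =>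
        mul_nonneg (hX i) (hw i)

/-- The dyadic interval `[j 2 ^ k, (j + 1) 2 ^ k)`. -/
def dyadic (k j : ℕ) : Finset ℕ := Ico (j * 2 ^ k) ((j + 1) * 2 ^ k)

/-- The union of the dyadic interval `dyadic k j` and its neighbours of the same length; for
`j = 0` truncated subtraction leaves out the missing left neighbour. -/
def triple (k j : ℕ) : Finset ℕ := Ico ((j - 1) * 2 ^ k) ((j + 2) * 2 ^ k)

theorem mem_dyadic {k j x : ℕ} : x ∈ dyadic k j ↔ x / 2 ^ k = j := by
  rw [dyadic, mem_Ico, ← Nat.le_div_iff_mul_le (by positivity),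
    ← Nat.div_lt_iff_lt_mul (by positivity)]
  lia

theorem mem_dyadic_self (k x : ℕ) : x ∈ dyadic k (x / 2 ^ k) := mem_dyadic.2 rfl

theorem mem_triple {k j x : ℕ} : x ∈ triple k j ↔ j ≤ x / 2 ^ k + 1 ∧ x / 2 ^ k ≤ j + 1 := by
  rw [triple, mem_Ico, ← Nat.le_div_iff_mul_le (by positivity),
    ← Nat.div_lt_iff_lt_mul (by positivity)]
  generalize x / 2 ^ k = a
  lia

theorem card_dyadic (k j : ℕ) : #(dyadic k j) = 2 ^ k := by
  simp [dyadic, add_mul]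

theorem card_triple_le (k j : ℕ) : #(triple k j) ≤ 3 * 2 ^ k := by
  rw [triple, Nat.card_Ico, ← Nat.sub_mul]
  gcongr
  lia

theorem dyadic_nonempty (k j : ℕ) : (dyadic k j).Nonempty :=
  card_pos.1 (card_dyadic k j ▸ by positivity)

theorem dyadic_zero (j : ℕ) : dyadic 0 j = {j} := by
  ext
  simp [mem_dyadic]

theorem dyadic_subset_triple (k j : ℕ) : dyadic k j ⊆ triple k j := by
  intro x hx
  rw [mem_dyadic] at hx
  rw [mem_triple]
  lia

theorem mem_triple_self (k x : ℕ) : x ∈ triple k (x / 2 ^ k) :=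
  dyadic_subset_triple _ _ (mem_dyadic_self k x)

theorem pairwiseDisjoint_dyadic (k : ℕ) (s : Set ℕ) : s.PairwiseDisjoint (dyadic k) :=
  fun _ _ _ _ hij => disjoint_left.2 fun _ hx hy =>
    hij ((mem_dyadic.1 hx).symm.trans (mem_dyadic.1 hy))

theorem div_two_pow_div {k i : ℕ} (h : k ≤ i) (x : ℕ) : x / 2 ^ k / 2 ^ (i - k) = x / 2 ^ i := by
  rw [Nat.div_div_eq_div_mul, ← pow_add, Nat.add_sub_cancel' h]

theorem div_two_pow_eq_of_le {k i x y : ℕ} (h : k ≤ i) (hxy : x / 2 ^ k = y / 2 ^ k) :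
    x / 2 ^ i = y / 2 ^ i := by
  rw [← div_two_pow_div h, hxy, div_two_pow_div h]

theorem dyadic_subset_of_le {k i x : ℕ} (h : k ≤ i) :
    dyadic k (x / 2 ^ k) ⊆ dyadic i (x / 2 ^ i) := fun _ hy =>
  mem_dyadic.2 (div_two_pow_eq_of_le h (mem_dyadic.1 hy))

theorem mem_triple_of_le {k i x y : ℕ} (h : k ≤ i) (hx : x ∈ triple k (y / 2 ^ k)) :
    x ∈ triple i (y / 2 ^ i) := by
  rw [mem_triple] at hx ⊢
  rw [← div_two_pow_div h x, ← div_two_pow_div h y]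
  have hd : 0 < 2 ^ (i - k) := by positivity
  rw [← Nat.add_div_right _ hd, ← Nat.add_div_right _ hd]
  constructor <;> refine Nat.div_le_div_right ?_ <;> lia

theorem triple_subset_of_le {k i x : ℕ} (h : k ≤ i) :
    triple k (x / 2 ^ k) ⊆ triple i (x / 2 ^ i) := fun _ hy => mem_triple_of_le h hy

theorem dyadic_subset_range {k N x : ℕ} (hk : k ≤ N) (hx : x < 2 ^ N) :
    dyadic k (x / 2 ^ k) ⊆ range (2 ^ N) := by
  intro y hy
  have h := dyadic_subset_of_le hk hy
  rw [mem_dyadic, Nat.div_eq_of_lt hx, Nat.div_eq_zero_iff] at h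
  exact mem_range.2 (h.resolve_left (by positivity))

theorem dyadic_eq_range {N j : ℕ} (h : dyadic N j ⊆ range (2 ^ N)) :
    dyadic N j = range (2 ^ N) :=
  eq_of_subset_of_card_le h (by rw [card_dyadic, card_range])

theorem dyadic_index_zero (N : ℕ) : dyadic N 0 = range (2 ^ N) := by
  ext
  simp [mem_dyadic, Nat.div_eq_zero_iff]

theorem triple_eq_biUnion (k j : ℕ) : triple k j = (Icc (j - 1) (j + 1)).biUnion (dyadic k) := by
  ext x
  simp only [mem_biUnion, mem_Icc, mem_dyadic, mem_triple, exists_eq_right']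
  generalize x / 2 ^ k = a
  lia

theorem sum_triple {M : Type*} [AddCommMonoid M] (k j : ℕ) (f : ℕ → M) :
    ∑ x ∈ triple k j, f x = ∑ i ∈ Icc (j - 1) (j + 1), ∑ x ∈ dyadic k i, f x := by
  rw [triple_eq_biUnion, sum_biUnion (pairwiseDisjoint_dyadic _ _)]

theorem sum_triple_pos {μ : ℕ → ℝ} (hμ : ∀ n, 0 < μ n) (k j : ℕ) : 0 < ∑ x ∈ triple k j, μ x :=
  sum_pos (fun x _ => hμ x) ((dyadic_nonempty k j).mono (dyadic_subset_triple k j))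

theorem abs_sub_le_of_div_two_pow_eq {k x y : ℕ} (h : x / 2 ^ k = y / 2 ^ k) :
    |(x : ℝ) - y| ≤ 2 ^ k := by
  have hx := mem_dyadic_self k x
  have hy := mem_dyadic_self k y
  rw [h, dyadic, mem_Ico, add_mul] at hx
  rw [dyadic, mem_Ico, add_mul] at hy
  have hxy : x ≤ y + 2 ^ k := by lia
  have hyx : y ≤ x + 2 ^ k := by lia
  rw [abs_sub_le_iff, sub_le_iff_le_add', sub_le_iff_le_add']
  exact ⟨mod_cast hxy, mod_cast hyx⟩

theorem mem_triple_of_abs_sub_lt {i x y : ℕ} (h : |(x : ℝ) - y| < 2 ^ i) :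
    x ∈ triple i (y / 2 ^ i) := by
  rw [abs_sub_lt_iff, sub_lt_iff_lt_add', sub_lt_iff_lt_add'] at h
  have hxy : x < y + 2 ^ i := mod_cast h.1
  have hyx : y < x + 2 ^ i := mod_cast h.2
  rw [mem_triple, ← Nat.add_div_right _ (by positivity), ← Nat.add_div_right _ (by positivity)]
  exact ⟨Nat.div_le_div_right hyx.le, Nat.div_le_div_right hxy.le⟩

theorem two_pow_le_abs_sub_of_notMem_triple {k x m : ℕ} (h : m ∉ triple k (x / 2 ^ k)) :
    (2 : ℝ) ^ k ≤ |(m : ℝ) - x| :=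
  not_lt.1 fun hc => h (mem_triple_of_abs_sub_lt hc)

open Classical in
/-- The maximal dyadic intervals in `[0, 2 ^ N)` with property `B`, each given by its scale and its
index: no dyadic interval of length at most `2 ^ N` strictly containing one of them has
property `B`. -/
noncomputable def maximalDyadic (N : ℕ) (B : ℕ → ℕ → Prop) : Finset (ℕ × ℕ) :=
  {P ∈ range (N + 1) ×ˢ range (2 ^ N) | B P.1 P.2 ∧ dyadic P.1 P.2 ⊆ range (2 ^ N) ∧
    ∀ x ∈ dyadic P.1 P.2, ∀ i, P.1 < i → i ≤ N → ¬ B i (x / 2 ^ i)}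

section MaximalDyadic

variable {N : ℕ} {B : ℕ → ℕ → Prop} {P : ℕ × ℕ}

theorem mem_maximalDyadic : P ∈ maximalDyadic N B ↔
    (P.1 ≤ N ∧ P.2 < 2 ^ N) ∧ B P.1 P.2 ∧ dyadic P.1 P.2 ⊆ range (2 ^ N) ∧
      ∀ x ∈ dyadic P.1 P.2, ∀ i, P.1 < i → i ≤ N → ¬ B i (x / 2 ^ i) := by
  simp only [maximalDyadic, mem_filter, mem_product, mem_range, Nat.lt_succ_iff]

theorem prop_of_mem_maximalDyadic (hP : P ∈ maximalDyadic N B) : B P.1 P.2 :=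
  (mem_maximalDyadic.1 hP).2.1

theorem dyadic_subset_of_mem_maximalDyadic (hP : P ∈ maximalDyadic N B) :
    dyadic P.1 P.2 ⊆ range (2 ^ N) :=
  (mem_maximalDyadic.1 hP).2.2.1

theorem not_prop_of_mem_maximalDyadic (hP : P ∈ maximalDyadic N B) {x i : ℕ}
    (hx : x ∈ dyadic P.1 P.2) (hi : P.1 < i) (hiN : i ≤ N) : ¬ B i (x / 2 ^ i) :=
  (mem_maximalDyadic.1 hP).2.2.2 x hx i hi hiN

theorem not_fst_lt_of_mem_maximalDyadic {Q : ℕ × ℕ} (hP : P ∈ maximalDyadic N B)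
    (hQ : Q ∈ maximalDyadic N B) {x : ℕ} (hxP : x ∈ dyadic P.1 P.2) (hxQ : x ∈ dyadic Q.1 Q.2) :
    ¬ P.1 < Q.1 := fun hlt =>
  not_prop_of_mem_maximalDyadic hP hxP hlt (mem_maximalDyadic.1 hQ).1.1
    ((mem_dyadic.1 hxQ).symm ▸ prop_of_mem_maximalDyadic hQ)

theorem pairwiseDisjoint_maximalDyadic (N : ℕ) (B : ℕ → ℕ → Prop) :
    (maximalDyadic N B : Set (ℕ × ℕ)).PairwiseDisjoint fun P => dyadic P.1 P.2 := by
  intro P hP Q hQ hne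
  refine disjoint_left.2 fun x hxP hxQ => hne ?_
  have hscale : P.1 = Q.1 := le_antisymm
    (not_lt.1 (not_fst_lt_of_mem_maximalDyadic hQ hP hxQ hxP))
    (not_lt.1 (not_fst_lt_of_mem_maximalDyadic hP hQ hxP hxQ))
  exact Prod.ext hscale (by rw [← mem_dyadic.1 hxP, ← mem_dyadic.1 hxQ, hscale])

theorem exists_mem_maximalDyadic {x k : ℕ} (hx : x < 2 ^ N) (hk : k ≤ N) (hB : B k (x / 2 ^ k)) :
    ∃ P ∈ maximalDyadic N B, x ∈ dyadic P.1 P.2 ∧ k ≤ P.1 := by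
  classical
  set i := Nat.findGreatest (fun i => B i (x / 2 ^ i)) N
  have hBi : B i (x / 2 ^ i) := Nat.findGreatest_spec (P := fun i => B i (x / 2 ^ i)) hk hB
  have hiN : i ≤ N := Nat.findGreatest_le N
  refine ⟨(i, x / 2 ^ i), mem_maximalDyadic.2 ⟨⟨hiN, (Nat.div_le_self _ _).trans_lt hx⟩, hBi,
    dyadic_subset_range hiN hx, fun y hy l hl hlN => ?_⟩, mem_dyadic_self _ _,
    Nat.le_findGreatest hk hB⟩
  rw [div_two_pow_eq_of_le hl.le (mem_dyadic.1 hy)]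
  exact Nat.findGreatest_is_greatest (P := fun i => B i (x / 2 ^ i)) hl hlN

end MaximalDyadic

section PoissonHardy

theorem exists_mem_triple_two_pow_le {N k n y : ℕ} (hn : n < 2 ^ N) (hy : y < 2 ^ N)
    (h : (2 : ℝ) ^ k ≤ |(n : ℝ) - y|) :
    ∃ i ∈ Ioc k N, n ∈ triple i (y / 2 ^ i) ∧ (2 : ℝ) ^ i ≤ 2 * |(n : ℝ) - y| := by
  set d : ℕ := ((n : ℤ) - y).natAbs with hd
  have hcast : |(n : ℝ) - y| = d := by simp [hd, Nat.cast_natAbs]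
  have hkd : 2 ^ k ≤ d := by exact_mod_cast hcast ▸ h
  have hd0 : d ≠ 0 := ((pow_pos two_pos k).trans_le hkd).ne'
  have hdN : d < 2 ^ N := by lia
  have hlow : (2 : ℝ) ^ Nat.log 2 d ≤ d := by exact_mod_cast Nat.pow_log_le_self 2 hd0
  refine ⟨Nat.log 2 d + 1, mem_Ioc.2 ⟨Nat.lt_succ_of_le (Nat.le_log_of_pow_le one_lt_two hkd),
    Nat.log_lt_of_lt_pow hd0 hdN⟩, mem_triple_of_abs_sub_lt ?_, ?_⟩
  · rw [hcast]
    exact_mod_cast Nat.lt_pow_succ_log_self one_lt_two d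
  · rw [hcast, pow_succ']
    linarith

theorem sum_Ioc_two_pow_div_le_one (k N : ℕ) : ∑ i ∈ Ioc k N, (2 : ℝ) ^ k / 2 ^ i ≤ 1 := by
  rcases le_total k N with hkN | hNk
  · have hsum : ∑ i ∈ Ioc k N, (2 : ℝ) ^ k / 2 ^ i = 1 - 2 ^ k / 2 ^ N := by
      induction N, hkN using Nat.le_induction with
      | base => simp
      | succ M hM ih =>
        rw [← insert_Ioc_right_eq_Ioc_add_one (by lia), sum_insert (by simp), ih, pow_succ]
        field_simp
        ring
    rw [hsum, sub_le_self_iff]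
    positivity
  · simp [Ioc_eq_empty_of_le hNk]

variable {N y : ℕ} {φ : ℕ → ℝ} {Λ : ℝ}

theorem sum_poisson_le (hy : y < 2 ^ N) (hφ : ∀ n, 0 ≤ φ n) (hΛ : 0 ≤ Λ)
    (h : ∀ i ≤ N, ∑ n ∈ triple i (y / 2 ^ i), φ n ≤ 2 ^ i * Λ) {k : ℕ} {s : Finset ℕ}
    (hs : s ⊆ range (2 ^ N)) (hsk : ∀ n ∈ s, (2 : ℝ) ^ k ≤ |(n : ℝ) - y|) :
    ∑ n ∈ s, 2 ^ k / |(n : ℝ) - y| ^ 2 * φ n ≤ 4 * Λ := by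
  set ψ : ℕ → ℕ → ℝ := fun i n =>
    if n ∈ triple i (y / 2 ^ i) then 4 * 2 ^ k / (2 ^ i) ^ 2 * φ n else 0
  have hψ (i n : ℕ) : 0 ≤ ψ i n := by
    have := hφ n
    dsimp only [ψ]
    split_ifs <;> positivity
  have hpoint : ∀ n ∈ s, 2 ^ k / |(n : ℝ) - y| ^ 2 * φ n ≤ ∑ i ∈ Ioc k N, ψ i n := by
    intro n hn
    obtain ⟨i, hi, hni, hle⟩ := exists_mem_triple_two_pow_le (mem_range.1 (hs hn)) hy (hsk n hn)
    have hpos : 0 < |(n : ℝ) - y| := (pow_pos two_pos k).trans_le (hsk n hn)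
    have hsq : ((2 : ℝ) ^ i) ^ 2 ≤ (2 * |(n : ℝ) - y|) ^ 2 := by gcongr
    refine le_trans ?_ (single_le_sum (fun i _ => hψ i n) hi)
    simp only [ψ, if_pos hni]
    refine mul_le_mul_of_nonneg_right ?_ (hφ n)
    rw [div_le_div_iff₀ (by positivity) (by positivity)]
    calc (2 : ℝ) ^ k * (2 ^ i) ^ 2 ≤ 2 ^ k * (2 * |(n : ℝ) - y|) ^ 2 := by gcongr
      _ = 4 * 2 ^ k * |(n : ℝ) - y| ^ 2 := by ring
  have hscale : ∀ i ∈ Ioc k N, ∑ n ∈ s, ψ i n ≤ 4 * Λ * (2 ^ k / 2 ^ i) := by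
    intro i hi
    simp only [ψ]
    rw [← sum_filter, ← mul_sum]
    calc 4 * 2 ^ k / (2 ^ i) ^ 2 * ∑ n ∈ s with n ∈ triple i (y / 2 ^ i), φ n
        ≤ 4 * 2 ^ k / (2 ^ i) ^ 2 * ∑ n ∈ triple i (y / 2 ^ i), φ n := by
          gcongr
          exacts [fun _ _ _ => hφ _, fun n hn => (mem_filter.1 hn).2]
      _ ≤ 4 * 2 ^ k / (2 ^ i) ^ 2 * (2 ^ i * Λ) := by
          gcongr
          exact h i (mem_Ioc.1 hi).2
      _ = 4 * Λ * (2 ^ k / 2 ^ i) := by field_simp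
  calc ∑ n ∈ s, 2 ^ k / |(n : ℝ) - y| ^ 2 * φ n
      ≤ ∑ n ∈ s, ∑ i ∈ Ioc k N, ψ i n := sum_le_sum hpoint
    _ = ∑ i ∈ Ioc k N, ∑ n ∈ s, ψ i n := sum_comm
    _ ≤ 4 * Λ * ∑ i ∈ Ioc k N, (2 : ℝ) ^ k / 2 ^ i := (sum_le_sum hscale).trans_eq (mul_sum ..).symm
    _ ≤ 4 * Λ * 1 := by
        gcongr
        exact sum_Ioc_two_pow_div_le_one k N
    _ = 4 * Λ := mul_one _

theorem range_subset_triple_log (y : ℕ) :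
    range (y + 1) ⊆ triple (Nat.log 2 (y + 1)) (y / 2 ^ Nat.log 2 (y + 1)) := by
  set i := Nat.log 2 (y + 1)
  have hlt : y + 1 < 2 ^ i * 2 := pow_succ 2 i ▸ Nat.lt_pow_succ_log_self one_lt_two (y + 1)
  have hyi : y / 2 ^ i < 2 := (Nat.div_lt_iff_lt_mul (by positivity)).2 (by lia)
  intro m hm
  have hmy : m / 2 ^ i ≤ y / 2 ^ i := Nat.div_le_div_right (Nat.lt_succ_iff.1 (mem_range.1 hm))
  exact mem_triple.2 ⟨by lia, by lia⟩

theorem sum_hardy_le (hy : y < 2 ^ N) (hφ : ∀ n, 0 ≤ φ n) (hΛ : 0 ≤ Λ)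
    (h : ∀ i ≤ N, ∑ n ∈ triple i (y / 2 ^ i), φ n ≤ 2 ^ i * Λ) :
    ∑ n ∈ range (y + 1), φ n / ((y : ℝ) + 1) ≤ Λ := by
  set i := Nat.log 2 (y + 1)
  have hi : 2 ^ i ≤ y + 1 := Nat.pow_log_le_self 2 (by lia)
  have hiN : i ≤ N := (Nat.pow_le_pow_iff_right one_lt_two).1 (hi.trans hy)
  rw [← sum_div, div_le_iff₀ (by positivity)]
  calc ∑ n ∈ range (y + 1), φ n ≤ ∑ n ∈ triple i (y / 2 ^ i), φ n :=
        sum_le_sum_of_subset_of_nonneg (range_subset_triple_log y) fun n _ _ => hφ n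
    _ ≤ 2 ^ i * Λ := h i hiN
    _ ≤ (y + 1) * Λ := by
        gcongr
        exact_mod_cast hi
    _ = Λ * (y + 1) := mul_comm _ _

end PoissonHardy

/-! ### The weighted dyadic maximal function -/

/-- The measure with density `μ` is doubling on dyadic intervals, with constant `D`. -/
def IsDyadicDoubling (μ : ℕ → ℝ) (D : ℝ) : Prop :=
  ∀ k j, ∑ x ∈ triple k j, μ x ≤ D * ∑ x ∈ dyadic k j, μ x

/-- The maximal function of `a` over triples of dyadic intervals of length at most `2 ^ N`,
relative to the measure with density `μ`. -/
noncomputable def tripleMax (μ a : ℕ → ℝ) (N x : ℕ) : ℝ :=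
  (range (N + 1)).sup' nonempty_range_add_one
    fun k => (∑ y ∈ triple k (x / 2 ^ k), a y) / ∑ y ∈ triple k (x / 2 ^ k), μ y

section LayerCake

theorem integrableOn_indicator_Iio_rpow {c q : ℝ} (hc : 0 ≤ c) (hq : -1 < q) :
    IntegrableOn ((Set.Iio c).indicator fun t : ℝ => t ^ q) (Set.Ioi 0) := by
  rw [IntegrableOn, integrable_indicator_iff measurableSet_Iio, IntegrableOn,
    Measure.restrict_restrict measurableSet_Iio, Set.Iio_inter_Ioi, ← IntegrableOn,
    ← intervalIntegrable_iff_integrableOn_Ioo_of_le hc]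
  exact intervalIntegral.intervalIntegrable_rpow' hq

theorem integral_indicator_Iio_rpow {c q : ℝ} (hc : 0 ≤ c) (hq : -1 < q) :
    ∫ t in Set.Ioi (0 : ℝ), (Set.Iio c).indicator (fun t : ℝ => t ^ q) t =
      c ^ (q + 1) / (q + 1) := by
  rw [integral_indicator measurableSet_Iio, Measure.restrict_restrict measurableSet_Iio,
    Set.Iio_inter_Ioi, ← integral_Ioc_eq_integral_Ioo, ← intervalIntegral.integral_of_le hc,
    integral_rpow (Or.inl hq), Real.zero_rpow (by linarith), sub_zero]

variable {ι : Type*} {s : Finset ι} {u c : ι → ℝ} {q : ℝ}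

theorem rpow_mul_sum_filter_lt (s : Finset ι) (u c : ι → ℝ) (q t : ℝ) :
    t ^ q * ∑ x ∈ s with t < u x, c x =
      ∑ x ∈ s, c x * (Set.Iio (u x)).indicator (fun t => t ^ q) t := by
  rw [sum_filter, mul_sum]
  refine sum_congr rfl fun x _ => ?_
  simp only [Set.indicator_apply, Set.mem_Iio]
  split_ifs <;> ring

theorem integrableOn_rpow_mul_sum_filter_lt (hu : ∀ x, 0 ≤ u x) (hq : -1 < q) :
    IntegrableOn (fun t => t ^ q * ∑ x ∈ s with t < u x, c x) (Set.Ioi 0) := by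
  simp only [rpow_mul_sum_filter_lt]
  exact integrable_finsetSum _ fun x _ => (integrableOn_indicator_Iio_rpow (hu x) hq).const_mul _

theorem integral_rpow_mul_sum_filter_lt (hu : ∀ x, 0 ≤ u x) (hq : -1 < q) :
    ∫ t in Set.Ioi (0 : ℝ), t ^ q * ∑ x ∈ s with t < u x, c x =
      ∑ x ∈ s, c x * (u x ^ (q + 1) / (q + 1)) := by
  simp only [rpow_mul_sum_filter_lt]
  rw [integral_finsetSum _ fun x _ => (integrableOn_indicator_Iio_rpow (hu x) hq).const_mul _]
  simp only [integral_const_mul, integral_indicator_Iio_rpow (hu _) hq]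

theorem sum_rpow_le_of_weak {μ h : ι → ℝ} (hu : ∀ x, 0 ≤ u x) (hh : ∀ x, 0 ≤ h x) {D p : ℝ}
    (hp : 1 < p)
    (H : ∀ t > 0, t * ∑ x ∈ s with t < u x, μ x ≤ D * ∑ x ∈ s with t < 2 * h x, h x * μ x) :
    ∑ x ∈ s, u x ^ p * μ x ≤ p * D * 2 ^ (p - 1) / (p - 1) * ∑ x ∈ s, h x ^ p * μ x := by
  have hp₁ : -1 < p - 1 := by linarith
  have hp₂ : -1 < p - 2 := by linarith
  have hh₂ (x : ι) : 0 ≤ 2 * h x := mul_nonneg zero_le_two (hh x)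
  have hlevel : ∀ t ∈ Set.Ioi (0 : ℝ), t ^ (p - 1) * ∑ x ∈ s with t < u x, μ x ≤
      D * (t ^ (p - 2) * ∑ x ∈ s with t < 2 * h x, h x * μ x) := by
    intro t ht
    have hsplit : t ^ (p - 1) = t ^ (p - 2) * t := by
      rw [← Real.rpow_add_one (ne_of_gt ht)]
      ring_nf
    rw [hsplit, mul_assoc, mul_left_comm D]
    exact mul_le_mul_of_nonneg_left (H t ht) (Real.rpow_nonneg (le_of_lt ht) _)
  have hint := setIntegral_mono_on (integrableOn_rpow_mul_sum_filter_lt hu hp₁)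
    ((integrableOn_rpow_mul_sum_filter_lt hh₂ hp₂).const_mul D) measurableSet_Ioi hlevel
  rw [integral_const_mul, integral_rpow_mul_sum_filter_lt hu hp₁,
    integral_rpow_mul_sum_filter_lt hh₂ hp₂, sub_add_cancel,
    show p - 2 + 1 = p - 1 by ring] at hint
  have hpow (x : ι) : h x ^ p = h x ^ (p - 1) * h x := by
    rw [← Real.rpow_add_one' (hh x) (by linarith), sub_add_cancel]
  calc ∑ x ∈ s, u x ^ p * μ x = p * ∑ x ∈ s, μ x * (u x ^ p / p) := by
        rw [mul_sum]
        refine sum_congr rfl fun x _ => ?_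
        field_simp
    _ ≤ p * (D * ∑ x ∈ s, h x * μ x * ((2 * h x) ^ (p - 1) / (p - 1))) := by gcongr
    _ = p * D * 2 ^ (p - 1) / (p - 1) * ∑ x ∈ s, h x ^ p * μ x := by
        simp only [mul_sum]
        refine sum_congr rfl fun x _ => ?_
        rw [hpow, Real.mul_rpow zero_le_two (hh x)]
        ring

end LayerCake

section MaximalFunction

variable {μ a : ℕ → ℝ} {D : ℝ} {N : ℕ}

theorem IsDyadicDoubling.nonneg (hD : IsDyadicDoubling μ D) (hμ : ∀ n, 0 < μ n) : 0 ≤ D :=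
  (pos_of_mul_pos_left ((sum_triple_pos hμ 0 0).trans_le (hD 0 0))
    (sum_nonneg fun n _ => (hμ n).le)).le

theorem subset_biUnion_triple_maximalDyadic (hμ : ∀ n, 0 ≤ μ n) (haN : ∀ n, 2 ^ N ≤ n → a n = 0)
    {t : ℝ} (ht : 0 ≤ t) {s : Finset ℕ}
    (hst : ∀ x ∈ s, ∃ k ≤ N,
      t * ∑ y ∈ triple k (x / 2 ^ k), μ y < ∑ y ∈ triple k (x / 2 ^ k), a y) :
    s ⊆ (maximalDyadic N fun k j => t * ∑ y ∈ dyadic k j, μ y < ∑ y ∈ dyadic k j, a y).biUnion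
      fun P => triple P.1 P.2 := by
  intro x hx
  obtain ⟨k, hk, hlt⟩ := hst x hx
  rw [sum_triple, sum_triple, mul_sum] at hlt
  obtain ⟨j, hj, hlt⟩ := exists_lt_of_sum_lt hlt
  obtain ⟨y, hy, hay⟩ := exists_ne_zero_of_sum_ne_zero
    ((mul_nonneg ht (sum_nonneg fun y _ => hμ y)).trans_lt hlt).ne'
  have hyN : y < 2 ^ N := not_le.1 fun hc => hay (haN y hc)
  have hyj := mem_dyadic.1 hy
  rw [← hyj] at hlt
  obtain ⟨P, hP, hyP, hkP⟩ := exists_mem_maximalDyadic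
    (B := fun k j => t * ∑ y ∈ dyadic k j, μ y < ∑ y ∈ dyadic k j, a y) hyN hk hlt
  refine mem_biUnion.2 ⟨P, hP, ?_⟩
  rw [← mem_dyadic.1 hyP]
  refine mem_triple_of_le hkP ?_
  rw [mem_Icc] at hj
  rw [mem_triple, hyj]
  lia

theorem IsDyadicDoubling.mul_sum_le (hD : IsDyadicDoubling μ D) (hμ : ∀ n, 0 < μ n)
    (ha : ∀ n, 0 ≤ a n) (haN : ∀ n, 2 ^ N ≤ n → a n = 0) {t : ℝ} (ht : 0 ≤ t) {s : Finset ℕ}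
    (hst : ∀ x ∈ s, ∃ k ≤ N,
      t * ∑ y ∈ triple k (x / 2 ^ k), μ y < ∑ y ∈ triple k (x / 2 ^ k), a y) :
    t * ∑ x ∈ s, μ x ≤ D * ∑ x ∈ range (2 ^ N), a x := by
  have hμ' (n : ℕ) : 0 ≤ μ n := (hμ n).le
  have hD₀ := hD.nonneg hμ
  set 𝓜 := maximalDyadic N fun k j => t * ∑ y ∈ dyadic k j, μ y < ∑ y ∈ dyadic k j, a y
  calc t * ∑ x ∈ s, μ x ≤ t * ∑ x ∈ 𝓜.biUnion (fun P => triple P.1 P.2), μ x := by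
        gcongr
        exacts [fun _ _ _ => hμ' _, subset_biUnion_triple_maximalDyadic hμ' haN ht hst]
    _ ≤ t * ∑ P ∈ 𝓜, ∑ x ∈ triple P.1 P.2, μ x := by
        gcongr
        exact sum_biUnion_le_of_nonneg hμ' 𝓜 _
    _ ≤ t * ∑ P ∈ 𝓜, D * ∑ x ∈ dyadic P.1 P.2, μ x := by
        gcongr
        exact hD _ _
    _ = D * ∑ P ∈ 𝓜, t * ∑ x ∈ dyadic P.1 P.2, μ x := by
        simp only [← mul_sum]
        ring
    _ ≤ D * ∑ P ∈ 𝓜, ∑ x ∈ dyadic P.1 P.2, a x := by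
        gcongr with P hP
        exact (prop_of_mem_maximalDyadic hP).le
    _ = D * ∑ x ∈ 𝓜.biUnion (fun P => dyadic P.1 P.2), a x := by
        rw [sum_biUnion (pairwiseDisjoint_maximalDyadic _ _)]
    _ ≤ D * ∑ x ∈ range (2 ^ N), a x := by
        gcongr
        exacts [fun _ _ _ => ha _,
          biUnion_subset.2 fun P hP => dyadic_subset_of_mem_maximalDyadic hP]

theorem le_tripleMax (μ a : ℕ → ℝ) {k : ℕ} (hk : k ≤ N) (x : ℕ) :
    (∑ y ∈ triple k (x / 2 ^ k), a y) / ∑ y ∈ triple k (x / 2 ^ k), μ y ≤ tripleMax μ a N x :=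
  le_sup' (fun k => (∑ y ∈ triple k (x / 2 ^ k), a y) / ∑ y ∈ triple k (x / 2 ^ k), μ y)
    (mem_range.2 (Nat.lt_succ_of_le hk))

theorem tripleMax_nonneg (hμ : ∀ n, 0 ≤ μ n) (ha : ∀ n, 0 ≤ a n) (N x : ℕ) :
    0 ≤ tripleMax μ a N x :=
  (div_nonneg (sum_nonneg fun _ _ => ha _) (sum_nonneg fun _ _ => hμ _)).trans
    (le_tripleMax μ a (Nat.zero_le N) x)

theorem exists_lt_sum_triple_of_lt_tripleMax (hμ : ∀ n, 0 < μ n) {t : ℝ} {x : ℕ}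
    (h : t < tripleMax μ a N x) :
    ∃ k ≤ N, t * ∑ y ∈ triple k (x / 2 ^ k), μ y < ∑ y ∈ triple k (x / 2 ^ k), a y := by
  obtain ⟨k, hk, hlt⟩ := (lt_sup'_iff _).1 h
  exact ⟨k, Nat.lt_succ_iff.1 (mem_range.1 hk), (lt_div_iff₀ (sum_triple_pos hμ _ _)).1 hlt⟩

-- The part of `a` where `a ≤ (t / 2) μ` contributes at most `t / 2` to every average of `a`.
theorem IsDyadicDoubling.mul_sum_lt_tripleMax_le (hD : IsDyadicDoubling μ D) (hμ : ∀ n, 0 < μ n)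
    (ha : ∀ n, 0 ≤ a n) (haN : ∀ n, 2 ^ N ≤ n → a n = 0) {t : ℝ} (ht : 0 < t) :
    t * ∑ x ∈ range (2 ^ N) with t < tripleMax μ a N x, μ x ≤
      2 * D * ∑ x ∈ range (2 ^ N) with t < 2 * (a x / μ x), a x := by
  set a' : ℕ → ℝ := fun x => if t < 2 * (a x / μ x) then a x else 0 with ha'
  have ha'₀ (n : ℕ) : 0 ≤ a' n := ite_nonneg (ha n) le_rfl
  have ha'N : ∀ n, 2 ^ N ≤ n → a' n = 0 := fun n hn => by simp only [ha', haN n hn, ite_self]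
  have hle (y : ℕ) : a y ≤ a' y + t / 2 * μ y := by
    have hμy := hμ y
    simp only [ha']
    split_ifs with hy
    · exact le_add_of_nonneg_right (by positivity)
    · rw [not_lt, ← mul_div_assoc, div_le_iff₀ hμy] at hy
      linarith
  have hlarge : ∀ x ∈ {x ∈ range (2 ^ N) | t < tripleMax μ a N x}, ∃ k ≤ N,
      t / 2 * ∑ y ∈ triple k (x / 2 ^ k), μ y < ∑ y ∈ triple k (x / 2 ^ k), a' y := by
    intro x hx
    obtain ⟨k, hk, hlt⟩ := exists_lt_sum_triple_of_lt_tripleMax hμ (mem_filter.1 hx).2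
    refine ⟨k, hk, ?_⟩
    have hsum := sum_le_sum fun y (_ : y ∈ triple k (x / 2 ^ k)) => hle y
    rw [sum_add_distrib, ← mul_sum] at hsum
    linarith
  have hweak := hD.mul_sum_le hμ ha'₀ ha'N (half_pos ht).le hlarge
  rw [← sum_filter] at hweak
  linarith

theorem IsDyadicDoubling.sum_tripleMax_rpow_le (hD : IsDyadicDoubling μ D) (hμ : ∀ n, 0 < μ n)
    {p : ℝ} (hp : 1 < p) (ha : ∀ n, 0 ≤ a n) (haN : ∀ n, 2 ^ N ≤ n → a n = 0) :
    ∑ x ∈ range (2 ^ N), tripleMax μ a N x ^ p * μ x ≤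
      p * (2 * D) * 2 ^ (p - 1) / (p - 1) * ∑ x ∈ range (2 ^ N), (a x / μ x) ^ p * μ x := by
  refine sum_rpow_le_of_weak (tripleMax_nonneg (fun n => (hμ n).le) ha N)
    (fun x => div_nonneg (ha x) (hμ x).le) hp fun t ht => ?_
  simp only [div_mul_cancel₀ _ (hμ _).ne']
  exact hD.mul_sum_lt_tripleMax_le hμ ha haN ht

end MaximalFunction

/-! ### Oscillation of the kernel -/

section Oscillation

/-- The majorant for the oscillation of a local standard kernel over a dyadic interval of length
`2 ^ k` containing `y`, seen from a point `m` outside of the triple of that interval. The second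
term is what is left when the kernel is irregular between `y` and `m`. -/
noncomputable def oscMajorant (k y m : ℕ) : ℝ :=
  2 ^ k / |(m : ℝ) - y| ^ 2 + 1 / (max (y : ℝ) m + 1)

section Cases

variable {G : Type*} [SeminormedAddCommGroup G] {a b : G} {C d e L : ℝ}

theorem norm_sub_le_of_size_of_le (hC : 0 ≤ C) (hL : 0 < L) (ha : ‖a‖ ≤ C / d) (hb : ‖b‖ ≤ C / e)
    (hd : L ≤ d) (he : L ≤ e) (heL : e ≤ 3 * L) : ‖a - b‖ ≤ 18 * C * (L / e ^ 2) := by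
  have he₀ : 0 < e := hL.trans_le he
  have hsq : e ^ 2 ≤ (3 * L) ^ 2 := by gcongr
  calc ‖a - b‖ ≤ C / d + C / e := (norm_sub_le _ _).trans (add_le_add ha hb)
    _ ≤ C / L + C / L := by gcongr
    _ = 2 * C / L := by ring
    _ ≤ 18 * C * (L / e ^ 2) := by
        rw [← mul_div_assoc, div_le_div_iff₀ hL (by positivity)]
        nlinarith

theorem norm_sub_le_of_size_of_far {M : ℝ} (hC : 0 ≤ C) (hM : 0 < M) (ha : ‖a‖ ≤ C / d)
    (hb : ‖b‖ ≤ C / e) (he : 0 < e) (hed : e ≤ 2 * d) (hMe : M ≤ 6 * e) :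
    ‖a - b‖ ≤ 18 * C * (1 / M) := by
  calc ‖a - b‖ ≤ C / d + C / e := (norm_sub_le _ _).trans (add_le_add ha hb)
    _ ≤ C / (e / 2) + C / e := by
        gcongr
        linarith
    _ = 18 * C * (1 / (6 * e)) := by
        field_simp
        ring
    _ ≤ 18 * C * (1 / M) := by gcongr

theorem norm_sub_le_of_regularity {δ : ℝ} (hC : 0 ≤ C) (hL : 0 < L) (he : 0 < e)
    (h : ‖a - b‖ ≤ C * (δ / d ^ 2)) (hδ : δ ≤ L) (hed : e ≤ 2 * d) :
    ‖a - b‖ ≤ 18 * C * (L / e ^ 2) :=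
  calc ‖a - b‖ ≤ C * (δ / d ^ 2) := h
    _ ≤ C * (L / (e / 2) ^ 2) := by
        gcongr
        linarith
    _ = 4 * C * (L / e ^ 2) := by
        field_simp
        ring
    _ ≤ 18 * C * (L / e ^ 2) := by
        gcongr
        norm_num

end Cases

theorem norm_sub_le_oscMajorant {G : Type*} [SeminormedAddCommGroup G] {κ : ℕ → ℕ → G} {C : ℝ}
    (hC : 0 ≤ C) (hsize : ∀ n m : ℕ, n ≠ m → ‖κ n m‖ ≤ C / |(n : ℝ) - m|)
    (hreg : ∀ n m l : ℕ, |(n : ℝ) - m| > 2 * |(n : ℝ) - l| →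
      (m : ℝ) / 2 < n → (n : ℝ) < 3 * m / 2 → (m : ℝ) / 2 < l → (l : ℝ) < 3 * m / 2 →
      ‖κ n m - κ l m‖ ≤ C * (|(n : ℝ) - l| / |(n : ℝ) - m| ^ 2))
    {k x y m : ℕ} (hxy : x / 2 ^ k = y / 2 ^ k) (hm : m ∉ triple k (y / 2 ^ k)) :
    ‖κ x m - κ y m‖ ≤ 18 * C * oscMajorant k y m := by
  have hL : (1 : ℝ) ≤ 2 ^ k := one_le_pow₀ one_le_two
  have hym : (2 : ℝ) ^ k ≤ |(y : ℝ) - m| :=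
    abs_sub_comm (m : ℝ) y ▸ two_pow_le_abs_sub_of_notMem_triple hm
  have hxm : (2 : ℝ) ^ k ≤ |(x : ℝ) - m| :=
    abs_sub_comm (m : ℝ) x ▸ two_pow_le_abs_sub_of_notMem_triple (hxy ▸ hm)
  have hδ : |(x : ℝ) - y| ≤ 2 ^ k := abs_sub_le_of_div_two_pow_eq hxy
  have hne {z : ℕ} (hz : (2 : ℝ) ^ k ≤ |(z : ℝ) - m|) : z ≠ m := by
    rintro rfl
    rw [sub_self, abs_zero] at hz
    linarith
  have hsx := hsize x m (hne hxm)
  have hsy := hsize y m (hne hym)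
  have he₀ : 0 < |(y : ℝ) - m| := by linarith
  have htri : |(y : ℝ) - m| ≤ |(x : ℝ) - y| + |(x : ℝ) - m| :=
    abs_sub_comm (x : ℝ) y ▸ abs_sub_le _ _ _
  rw [oscMajorant, abs_sub_comm (m : ℝ), mul_add]
  have hpoisson : 0 ≤ 18 * C * (2 ^ k / |(y : ℝ) - m| ^ 2) := by positivity
  have htail : 0 ≤ 18 * C * (1 / (max (y : ℝ) m + 1)) := by positivity
  rcases le_or_gt |(x : ℝ) - m| (2 * |(x : ℝ) - y|) with hnear | hfar
  · exact le_add_of_le_of_nonneg (norm_sub_le_of_size_of_le hC (by linarith) hsx hsy hxm hym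
      (by linarith)) htail
  by_cases hloc : (m : ℝ) / 2 < x ∧ (x : ℝ) < 3 * m / 2 ∧ (m : ℝ) / 2 < y ∧ (y : ℝ) < 3 * m / 2
  · obtain ⟨hx₁, hx₂, hy₁, hy₂⟩ := hloc
    exact le_add_of_le_of_nonneg (norm_sub_le_of_regularity hC (by linarith) he₀
      (hreg x m y hfar hx₁ hx₂ hy₁ hy₂) hδ (by linarith)) htail
  · have hm4 : (m : ℝ) ≤ 4 * |(y : ℝ) - m| := by
      have hx := abs_sub_le (x : ℝ) y m
      have := abs_le.1 (le_refl |(x : ℝ) - m|)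
      have := abs_le.1 (le_refl |(y : ℝ) - m|)
      by_contra
      exact hloc ⟨by linarith, by linarith, by linarith, by linarith⟩
    have hmax : max (y : ℝ) m ≤ 5 * |(y : ℝ) - m| :=
      max_le (by linarith [le_abs_self ((y : ℝ) - m)]) (by linarith)
    exact le_add_of_nonneg_of_le hpoisson (norm_sub_le_of_size_of_far hC (by positivity) hsx hsy
      he₀ (by linarith) (by linarith))

end Oscillation

section Kernel

variable {𝕜 E F : Type*} [RCLike 𝕜] [NormedAddCommGroup E] [NormedSpace 𝕜 E]
  [NormedAddCommGroup F] [NormedSpace 𝕜 F] {K : ℕ → ℕ → E →L[𝕜] F} {C : ℝ}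

/-- Oscillation bounds of a matrix kernel in both variables over dyadic intervals. -/
structure HasOscBound (K : ℕ → ℕ → E →L[𝕜] F) (C : ℝ) : Prop where
  left : ∀ {k x y m : ℕ}, x / 2 ^ k = y / 2 ^ k → m ∉ triple k (y / 2 ^ k) →
    ‖K x m - K y m‖ ≤ C * oscMajorant k y m
  right : ∀ {k x y m : ℕ}, x / 2 ^ k = y / 2 ^ k → m ∉ triple k (y / 2 ^ k) →
    ‖K m x - K m y‖ ≤ C * oscMajorant k y m

theorem HasOscBound.nonneg (hK : HasOscBound K C) : 0 ≤ C :=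
  nonneg_of_mul_nonneg_left ((norm_nonneg _).trans
    (hK.left (k := 0) (x := 0) (y := 0) (m := 2) rfl (by simp [mem_triple])))
    (by unfold oscMajorant; positivity)

theorem exists_hasOscBound (hK : IsLocalStandardKernel K) :
    ∃ C, HasOscBound K C := by
  obtain ⟨C, hC, hsize, hleft, hright⟩ := hK
  refine ⟨18 * C, norm_sub_le_oscMajorant hC.le hsize hleft,
    norm_sub_le_oscMajorant (κ := fun n m => K m n) hC.le (fun n m hnm => ?_) hright⟩
  rw [abs_sub_comm]
  exact hsize m n hnm.symm

/-- The operator with matrix `K`, applied to the restriction of `f` to `S`. -/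
noncomputable def matApply (K : ℕ → ℕ → E →L[𝕜] F) (S : Finset ℕ) (f : ℕ → E) (n : ℕ) : F :=
  ∑ m ∈ S, K n m (f m)

theorem matApply_add (K : ℕ → ℕ → E →L[𝕜] F) (S : Finset ℕ) (f g : ℕ → E) (n : ℕ) :
    matApply K S (f + g) n = matApply K S f n + matApply K S g n := by
  simp [matApply, sum_add_distrib]

/-- The part of `oscMajorant k m n` that is summed over `n` by means of the `A₁` condition; for
`m < n` the tail of `oscMajorant` is a Hardy average in `m` and is kept apart. -/
noncomputable def adjointMajorant (k n m : ℕ) : ℝ :=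
  2 ^ k / |(n : ℝ) - m| ^ 2 + if n ≤ m then 1 / ((m : ℝ) + 1) else 0

theorem adjointMajorant_nonneg (k n m : ℕ) : 0 ≤ adjointMajorant k n m := by
  unfold adjointMajorant
  split_ifs <;> positivity

theorem oscMajorant_le_adjointMajorant_add (k m n : ℕ) :
    oscMajorant k m n ≤ adjointMajorant k n m + if m ≤ n then 1 / ((n : ℝ) + 1) else 0 := by
  rw [oscMajorant, adjointMajorant, add_assoc]
  gcongr
  rcases le_total n m with h | h
  · rw [if_pos h, max_eq_left (mod_cast h)]
    exact le_add_of_nonneg_right (ite_nonneg (by positivity) le_rfl)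
  · rw [if_pos h, max_eq_right (mod_cast h)]
    exact le_add_of_nonneg_left (ite_nonneg (by positivity) le_rfl)

-- The cancellation of `b` replaces `K n m` by its oscillation over the interval.
theorem HasOscBound.norm_sum_dyadic_le (hK : HasOscBound K C) {k j n : ℕ} {b : ℕ → E}
    (hb : ∑ m ∈ dyadic k j, b m = 0) (hn : n ∉ triple k j) :
    ‖∑ m ∈ dyadic k j, K n m (b m)‖ ≤ C * ∑ m ∈ dyadic k j, oscMajorant k m n * ‖b m‖ := by
  obtain ⟨c, hc⟩ := dyadic_nonempty k j
  have hcancel : ∑ m ∈ dyadic k j, K n m (b m) = -∑ m ∈ dyadic k j, (K n c - K n m) (b m) := by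
    simp only [sub_apply]
    rw [sum_sub_distrib, ← map_sum, hb, map_zero, zero_sub, neg_neg]
  rw [hcancel, norm_neg, mul_sum]
  refine norm_sum_le_of_le _ fun m hm => (ContinuousLinearMap.le_opNorm _ _).trans ?_
  rw [← mul_assoc]
  gcongr
  have hmj := mem_dyadic.1 hm
  exact hK.right ((mem_dyadic.1 hc).trans hmj.symm) (hmj ▸ hn)

theorem HasOscBound.norm_matApply_le (hK : HasOscBound K C) {𝓜 : Finset (ℕ × ℕ)} {S : Finset ℕ}
    {b : ℕ → E} (hd : (𝓜 : Set (ℕ × ℕ)).PairwiseDisjoint fun P => dyadic P.1 P.2)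
    (hS : ∀ P ∈ 𝓜, dyadic P.1 P.2 ⊆ S) (hb : ∀ P ∈ 𝓜, ∑ n ∈ dyadic P.1 P.2, b n = 0)
    (hb₀ : ∀ n ∈ S, n ∉ 𝓜.biUnion (fun P => dyadic P.1 P.2) → b n = 0) {n : ℕ}
    (hn : ∀ P ∈ 𝓜, n ∉ triple P.1 P.2) :
    ‖matApply K S b n‖ ≤
      C * (∑ P ∈ 𝓜, ∑ m ∈ dyadic P.1 P.2, adjointMajorant P.1 n m * ‖b m‖ +
        (∑ m ∈ range (n + 1), ‖b m‖) / ((n : ℝ) + 1)) := by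
  have hC := hK.nonneg
  have hsplit : matApply K S b n = ∑ P ∈ 𝓜, ∑ m ∈ dyadic P.1 P.2, K n m (b m) := by
    rw [matApply, ← sum_subset (biUnion_subset.2 hS), sum_biUnion hd]
    intro m hm hmU
    rw [hb₀ m hm hmU, map_zero]
  have htail : ∑ P ∈ 𝓜, ∑ m ∈ dyadic P.1 P.2, (if m ≤ n then 1 / ((n : ℝ) + 1) else 0) * ‖b m‖ ≤
      (∑ m ∈ range (n + 1), ‖b m‖) / ((n : ℝ) + 1) := by
    simp only [ite_mul, zero_mul, one_div_mul_eq_div]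
    rw [← sum_biUnion hd, ← sum_filter, sum_div]
    refine sum_le_sum_of_subset_of_nonneg (fun m hm => ?_) fun _ _ _ => by positivity
    exact mem_range.2 (Nat.lt_succ_of_le (mem_filter.1 hm).2)
  calc ‖matApply K S b n‖
      ≤ ∑ P ∈ 𝓜, C * ∑ m ∈ dyadic P.1 P.2, oscMajorant P.1 m n * ‖b m‖ :=
        hsplit ▸ norm_sum_le_of_le _ fun P hP => hK.norm_sum_dyadic_le (hb P hP) (hn P hP)
    _ ≤ ∑ P ∈ 𝓜, C * ∑ m ∈ dyadic P.1 P.2,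
        (adjointMajorant P.1 n m + if m ≤ n then 1 / ((n : ℝ) + 1) else 0) * ‖b m‖ := by
        gcongr
        exact oscMajorant_le_adjointMajorant_add _ _ _
    _ = C * (∑ P ∈ 𝓜, ∑ m ∈ dyadic P.1 P.2, adjointMajorant P.1 n m * ‖b m‖ + ∑ P ∈ 𝓜,
        ∑ m ∈ dyadic P.1 P.2, (if m ≤ n then 1 / ((n : ℝ) + 1) else 0) * ‖b m‖) := by
        simp only [← mul_sum, add_mul, sum_add_distrib]
    _ ≤ _ := by gcongr

end Kernel

/-- The `A₁` condition with constant `A`, with every interval written as `Finset.Ico a b`. -/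
def A1Bound (w : ℕ → ℝ) (A : ℝ) : Prop :=
  ∀ a b : ℕ, ∀ x ∈ Ico a b, ∑ y ∈ Ico a b, w y ≤ A * #(Ico a b) * w x

namespace A1Bound

variable {w : ℕ → ℝ} {A : ℝ}

theorem one_le (hA : A1Bound w A) (hw : ∀ n, 0 < w n) : 1 ≤ A := by
  have h := hA 0 1 0 (by simp)
  rw [Nat.Ico_succ_singleton, sum_singleton, card_singleton, Nat.cast_one, mul_one] at h
  exact le_of_mul_le_mul_right (by rwa [one_mul]) (hw 0)

theorem sum_range_le (hA : A1Bound w A) (m : ℕ) :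
    ∑ n ∈ range (m + 1), w n ≤ A * (m + 1) * w m := by
  simpa using hA 0 (m + 1) m (by simp)

theorem sum_triple_le (hA : A1Bound w A) (hw : ∀ n, 0 < w n) {k j x : ℕ} (hx : x ∈ triple k j) :
    ∑ y ∈ triple k j, w y ≤ 2 ^ k * (3 * A * w x) := by
  have hA₁ := hA.one_le hw
  have hwx := hw x
  have hcard : (#(triple k j) : ℝ) ≤ 3 * 2 ^ k := mod_cast card_triple_le k j
  calc ∑ y ∈ triple k j, w y ≤ A * #(triple k j) * w x := hA _ _ x hx
    _ ≤ A * (3 * 2 ^ k) * w x := by gcongr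
    _ = 2 ^ k * (3 * A * w x) := by ring

theorem sum_mul_sum_le (hA : A1Bound w A) {a b : ℕ} {s : Finset ℕ} (hs : s ⊆ Ico a b) {c : ℕ → ℝ}
    (hc : ∀ n, 0 ≤ c n) :
    (∑ x ∈ s, c x) * ∑ y ∈ Ico a b, w y ≤ A * #(Ico a b) * ∑ x ∈ s, c x * w x := by
  rw [sum_mul, mul_sum]
  refine sum_le_sum fun x hx => ?_
  rw [mul_left_comm]
  exact mul_le_mul_of_nonneg_left (hA a b x (hs hx)) (hc x)

-- Only the largest element `n` of `s` matters, because `s ⊆ range (n + 1)`.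
theorem mul_sum_le_of_lt_hardy (hA : A1Bound w A) (hw : ∀ n, 0 < w n) {M : ℕ} {c : ℕ → ℝ}
    (hc : ∀ n, 0 ≤ c n) {τ : ℝ} (hτ : 0 ≤ τ) {s : Finset ℕ} (hs : s ⊆ range M)
    (hst : ∀ n ∈ s, τ < (∑ m ∈ range (n + 1), c m) / ((n : ℝ) + 1)) :
    τ * ∑ n ∈ s, w n ≤ A * ∑ m ∈ range M, c m * w m := by
  have hA₁ := hA.one_le hw
  have hcw (m : ℕ) : 0 ≤ c m * w m := mul_nonneg (hc m) (hw m).le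
  rcases s.eq_empty_or_nonempty with rfl | hne
  · rw [sum_empty, mul_zero]
    exact mul_nonneg (by linarith) (sum_nonneg fun m _ => hcw m)
  set n := s.max' hne
  have hsn : s ⊆ range (n + 1) := fun x hx => mem_range.2 (Nat.lt_succ_of_le (s.le_max' x hx))
  have hnM : range (n + 1) ⊆ range M :=
    range_subset_range.2 (mem_range.1 (hs (s.max'_mem hne)))
  have hτn := ((lt_div_iff₀ (by positivity)).1 (hst n (s.max'_mem hne))).le
  have hw_nonneg : 0 ≤ ∑ x ∈ range (n + 1), w x := sum_nonneg fun x _ => (hw x).le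
  have hpair : (∑ m ∈ range (n + 1), c m) * ∑ x ∈ range (n + 1), w x ≤
      A * (n + 1) * ∑ m ∈ range (n + 1), c m * w m := by
    simpa using hA.sum_mul_sum_le (range_eq_Ico (n + 1)).subset hc
  refine le_of_mul_le_mul_left ?_ (by positivity : (0 : ℝ) < n + 1)
  calc (n + 1 : ℝ) * (τ * ∑ x ∈ s, w x) = τ * (n + 1) * ∑ x ∈ s, w x := by ring
    _ ≤ τ * (n + 1) * ∑ x ∈ range (n + 1), w x := by
        gcongr
        exact fun x _ _ => (hw x).le
    _ ≤ (∑ m ∈ range (n + 1), c m) * ∑ x ∈ range (n + 1), w x := by gcongr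
    _ ≤ A * (n + 1) * ∑ m ∈ range (n + 1), c m * w m := hpair
    _ ≤ A * (n + 1) * ∑ m ∈ range M, c m * w m := by
        gcongr
        exact fun x _ _ => hcw x
    _ = (n + 1) * (A * ∑ m ∈ range M, c m * w m) := by ring

theorem sum_adjointMajorant_le (hA : A1Bound w A) (hw : ∀ n, 0 < w n) {N k m : ℕ}
    (hm : m < 2 ^ N) {s : Finset ℕ} (hs : s ⊆ range (2 ^ N))
    (hsk : ∀ n ∈ s, n ∉ triple k (m / 2 ^ k)) :
    ∑ n ∈ s, adjointMajorant k n m * w n ≤ 13 * A * w m := by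
  have hA₁ := hA.one_le hw
  have hwm := hw m
  have hpoisson : ∑ n ∈ s, 2 ^ k / |(n : ℝ) - m| ^ 2 * w n ≤ 4 * (3 * A * w m) :=
    sum_poisson_le hm (fun n => (hw n).le) (by positivity)
      (fun i _ => hA.sum_triple_le hw (mem_triple_self i m)) hs
      fun n hn => two_pow_le_abs_sub_of_notMem_triple (hsk n hn)
  have htail : ∑ n ∈ s, (if n ≤ m then 1 / ((m : ℝ) + 1) else 0) * w n ≤ A * w m := by
    simp only [ite_mul, zero_mul]
    rw [← sum_filter]
    calc ∑ n ∈ s with n ≤ m, 1 / ((m : ℝ) + 1) * w n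
        ≤ ∑ n ∈ range (m + 1), 1 / ((m : ℝ) + 1) * w n := by
          refine sum_le_sum_of_subset_of_nonneg (fun n hn => ?_) fun n _ _ => ?_
          · exact mem_range.2 (Nat.lt_succ_of_le (mem_filter.1 hn).2)
          · exact mul_nonneg (by positivity) (hw n).le
      _ ≤ 1 / ((m : ℝ) + 1) * (A * (m + 1) * w m) := by
          rw [← mul_sum]
          gcongr
          exact hA.sum_range_le m
      _ = A * w m := by field_simp
  simp only [adjointMajorant, add_mul]
  rw [sum_add_distrib]
  linarith

end A1Bound

/-! ### The Calderón–Zygmund decomposition -/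

section CalderonZygmund

variable (𝕜 : Type*) {E : Type*} [RCLike 𝕜] [NormedAddCommGroup E] [NormedSpace 𝕜 E]

/-- The mean of `f` over the dyadic interval with scale `P.1` and index `P.2`. -/
noncomputable def dyadicMean (f : ℕ → E) (P : ℕ × ℕ) : E :=
  ((2 : 𝕜) ^ P.1)⁻¹ • ∑ m ∈ dyadic P.1 P.2, f m

/-- The intervals of the Calderón-Zygmund decomposition of `f` at height `t`: the maximal dyadic
intervals in `[0, 2 ^ N)` on which the mean of `‖f‖` exceeds `t`. -/
noncomputable def czIntervals (f : ℕ → E) (t : ℝ) (N : ℕ) : Finset (ℕ × ℕ) :=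
  maximalDyadic N fun k j => t * 2 ^ k < ∑ n ∈ dyadic k j, ‖f n‖

/-- The union of the intervals of the Calderón-Zygmund decomposition. -/
noncomputable def czSet (f : ℕ → E) (t : ℝ) (N : ℕ) : Finset ℕ :=
  (czIntervals f t N).biUnion fun P => dyadic P.1 P.2

/-- The exceptional set of the Calderón-Zygmund decomposition: the union of the triples of its
intervals. -/
noncomputable def czTriples (f : ℕ → E) (t : ℝ) (N : ℕ) : Finset ℕ :=
  (czIntervals f t N).biUnion fun P => triple P.1 P.2

/-- The good part of the Calderón-Zygmund decomposition: `f` is replaced by its mean on each of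
the intervals. By disjointness the sum has exactly one term. -/
noncomputable def czGood (f : ℕ → E) (t : ℝ) (N n : ℕ) : E :=
  if n ∈ czSet f t N then
    ∑ P ∈ czIntervals f t N with n ∈ dyadic P.1 P.2, dyadicMean 𝕜 f P
  else f n

/-- The bad part of the Calderón-Zygmund decomposition. -/
noncomputable def czBad (f : ℕ → E) (t : ℝ) (N n : ℕ) : E := f n - czGood 𝕜 f t N n

/-- The part of the bound `HasOscBound.norm_matApply_le` for the bad part which is summed by means
of `adjointMajorant`. -/
noncomputable def czBadMajorant (f : ℕ → E) (t : ℝ) (N n : ℕ) : ℝ :=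
  ∑ P ∈ czIntervals f t N, ∑ m ∈ dyadic P.1 P.2, adjointMajorant P.1 n m * ‖czBad 𝕜 f t N m‖

variable {𝕜} {f : ℕ → E} {t : ℝ} {N n : ℕ} {P : ℕ × ℕ}

theorem two_pow_mul_norm_dyadicMean_le (f : ℕ → E) (P : ℕ × ℕ) :
    2 ^ P.1 * ‖dyadicMean 𝕜 f P‖ ≤ ∑ n ∈ dyadic P.1 P.2, ‖f n‖ := by
  rw [dyadicMean, norm_smul, norm_inv, norm_pow, RCLike.norm_ofNat,
    mul_inv_cancel_left₀ (by positivity)]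
  exact norm_sum_le _ _

theorem pairwiseDisjoint_czIntervals (f : ℕ → E) (t : ℝ) (N : ℕ) :
    (czIntervals f t N : Set (ℕ × ℕ)).PairwiseDisjoint fun P => dyadic P.1 P.2 :=
  pairwiseDisjoint_maximalDyadic _ _

theorem dyadic_subset_range_of_mem_czIntervals (hP : P ∈ czIntervals f t N) :
    dyadic P.1 P.2 ⊆ range (2 ^ N) :=
  dyadic_subset_of_mem_maximalDyadic hP

theorem lt_sum_norm_of_mem_czIntervals (hP : P ∈ czIntervals f t N) :
    t * 2 ^ P.1 < ∑ n ∈ dyadic P.1 P.2, ‖f n‖ :=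
  prop_of_mem_maximalDyadic hP

theorem czSet_subset_range : czSet f t N ⊆ range (2 ^ N) :=
  biUnion_subset.2 fun _ hP => dyadic_subset_range_of_mem_czIntervals hP

theorem sum_czSet {M : Type*} [AddCommMonoid M] (φ : ℕ → M) :
    ∑ n ∈ czSet f t N, φ n = ∑ P ∈ czIntervals f t N, ∑ n ∈ dyadic P.1 P.2, φ n :=
  sum_biUnion (pairwiseDisjoint_czIntervals f t N)

theorem czGood_of_notMem (hn : n ∉ czSet f t N) : czGood 𝕜 f t N n = f n := if_neg hn

theorem czGood_eq_dyadicMean (hP : P ∈ czIntervals f t N) (hn : n ∈ dyadic P.1 P.2) :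
    czGood 𝕜 f t N n = dyadicMean 𝕜 f P := by
  have honly : {Q ∈ czIntervals f t N | n ∈ dyadic Q.1 Q.2} = {P} := by
    refine eq_singleton_iff_unique_mem.2 ⟨mem_filter.2 ⟨hP, hn⟩, fun Q hQ => ?_⟩
    obtain ⟨hQ, hnQ⟩ := mem_filter.1 hQ
    exact (pairwiseDisjoint_czIntervals f t N).elim_finset hQ hP n hnQ hn
  have hmem : n ∈ czSet f t N := mem_biUnion.2 ⟨P, hP, hn⟩
  rw [czGood, if_pos hmem, honly, sum_singleton]

theorem sum_czBad_eq_zero (hP : P ∈ czIntervals f t N) :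
    ∑ n ∈ dyadic P.1 P.2, czBad 𝕜 f t N n = 0 := by
  simp only [czBad]
  rw [sum_sub_distrib, sum_congr rfl fun n hn => czGood_eq_dyadicMean hP hn, sum_const,
    card_dyadic, ← Nat.cast_smul_eq_nsmul 𝕜, dyadicMean, Nat.cast_pow, Nat.cast_ofNat,
    smul_inv_smul₀ (pow_ne_zero _ two_ne_zero), sub_self]

theorem norm_le_of_notMem_czSet (hnN : n < 2 ^ N) (hn : n ∉ czSet f t N) : ‖f n‖ ≤ t := by
  by_contra hlt
  obtain ⟨P, hP, hnP, -⟩ := exists_mem_maximalDyadic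
    (B := fun k j => t * 2 ^ k < ∑ n ∈ dyadic k j, ‖f n‖) hnN (Nat.zero_le N)
    (by simpa [dyadic_zero] using hlt)
  exact hn (mem_biUnion.2 ⟨P, hP, hnP⟩)

-- By maximality the mean of `‖f‖` over the dyadic parent is at most `t`.
theorem norm_dyadicMean_le (htop : ∑ n ∈ range (2 ^ N), ‖f n‖ ≤ t * 2 ^ N)
    (hP : P ∈ czIntervals f t N) : ‖dyadicMean 𝕜 f P‖ ≤ 2 * t := by
  have hlt : P.1 < N := by
    refine lt_of_le_of_ne (mem_maximalDyadic.1 hP).1.1 fun heq => ?_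
    have hsub := dyadic_subset_range_of_mem_czIntervals hP
    have hlarge := lt_sum_norm_of_mem_czIntervals hP
    rw [heq] at hsub hlarge
    rw [dyadic_eq_range hsub] at hlarge
    exact hlarge.not_ge htop
  obtain ⟨n, hn⟩ := dyadic_nonempty P.1 P.2
  have hparent := not_lt.1 (not_prop_of_mem_maximalDyadic hP hn (Nat.lt_succ_self _) hlt)
  refine le_of_mul_le_mul_left ?_ (pow_pos two_pos P.1 : (0 : ℝ) < 2 ^ P.1)
  calc 2 ^ P.1 * ‖dyadicMean 𝕜 f P‖ ≤ ∑ y ∈ dyadic P.1 P.2, ‖f y‖ :=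
        two_pow_mul_norm_dyadicMean_le f P
    _ ≤ ∑ y ∈ dyadic (P.1 + 1) (n / 2 ^ (P.1 + 1)), ‖f y‖ := by
        refine sum_le_sum_of_subset_of_nonneg ?_ fun _ _ _ => norm_nonneg _
        exact mem_dyadic.1 hn ▸ dyadic_subset_of_le (Nat.le_succ _)
    _ ≤ t * 2 ^ (P.1 + 1) := hparent
    _ = 2 ^ P.1 * (2 * t) := by ring

theorem norm_czGood_le (ht : 0 ≤ t) (htop : ∑ n ∈ range (2 ^ N), ‖f n‖ ≤ t * 2 ^ N)
    (hn : n < 2 ^ N) : ‖czGood 𝕜 f t N n‖ ≤ 2 * t := by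
  by_cases hnU : n ∈ czSet f t N
  · obtain ⟨P, hP, hnP⟩ := mem_biUnion.1 hnU
    exact czGood_eq_dyadicMean (𝕜 := 𝕜) hP hnP ▸ norm_dyadicMean_le htop hP
  · rw [czGood_of_notMem hnU]
    linarith [norm_le_of_notMem_czSet hn hnU]

variable (f t N n) in
theorem czBadMajorant_nonneg : 0 ≤ czBadMajorant 𝕜 f t N n :=
  sum_nonneg fun _ _ => sum_nonneg fun _ _ =>
    mul_nonneg (adjointMajorant_nonneg _ _ _) (norm_nonneg _)

section Weighted

variable {w : ℕ → ℝ} {A : ℝ}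

theorem A1Bound.mul_sum_range_le (hA : A1Bound w A) (hw : ∀ n, 0 < w n)
    (htop : t * 2 ^ N < ∑ n ∈ range (2 ^ N), ‖f n‖) :
    t * ∑ n ∈ range (2 ^ N), w n ≤ A * ∑ n ∈ range (2 ^ N), ‖f n‖ * w n := by
  have hpair : (∑ n ∈ range (2 ^ N), ‖f n‖) * ∑ n ∈ range (2 ^ N), w n ≤
      A * 2 ^ N * ∑ n ∈ range (2 ^ N), ‖f n‖ * w n := by
    simpa using hA.sum_mul_sum_le (range_eq_Ico (2 ^ N)).subset fun n => norm_nonneg (f n)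
  have hw_nonneg : 0 ≤ ∑ n ∈ range (2 ^ N), w n := sum_nonneg fun n _ => (hw n).le
  refine le_of_mul_le_mul_left ?_ (pow_pos two_pos N : (0 : ℝ) < 2 ^ N)
  calc (2 : ℝ) ^ N * (t * ∑ n ∈ range (2 ^ N), w n)
      = t * 2 ^ N * ∑ n ∈ range (2 ^ N), w n := by ring
    _ ≤ (∑ n ∈ range (2 ^ N), ‖f n‖) * ∑ n ∈ range (2 ^ N), w n := by gcongr
    _ ≤ A * 2 ^ N * ∑ n ∈ range (2 ^ N), ‖f n‖ * w n := hpair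
    _ = 2 ^ N * (A * ∑ n ∈ range (2 ^ N), ‖f n‖ * w n) := by ring

theorem A1Bound.norm_dyadicMean_mul_sum_le (hA : A1Bound w A) (hw : ∀ n, 0 < w n) (f : ℕ → E)
    (P : ℕ × ℕ) : ‖dyadicMean 𝕜 f P‖ * ∑ n ∈ dyadic P.1 P.2, w n ≤
      A * ∑ n ∈ dyadic P.1 P.2, ‖f n‖ * w n := by
  have hpair : (∑ n ∈ dyadic P.1 P.2, ‖f n‖) * ∑ n ∈ dyadic P.1 P.2, w n ≤
      A * #(dyadic P.1 P.2) * ∑ n ∈ dyadic P.1 P.2, ‖f n‖ * w n :=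
    hA.sum_mul_sum_le Subset.rfl fun n => norm_nonneg (f n)
  rw [card_dyadic, Nat.cast_pow, Nat.cast_ofNat] at hpair
  refine le_of_mul_le_mul_left ?_ (pow_pos two_pos P.1 : (0 : ℝ) < 2 ^ P.1)
  calc 2 ^ P.1 * (‖dyadicMean 𝕜 f P‖ * ∑ n ∈ dyadic P.1 P.2, w n)
      ≤ (∑ n ∈ dyadic P.1 P.2, ‖f n‖) * ∑ n ∈ dyadic P.1 P.2, w n := by
        rw [← mul_assoc]
        exact mul_le_mul_of_nonneg_right (two_pow_mul_norm_dyadicMean_le f P)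
          (sum_nonneg fun n _ => (hw n).le)
    _ ≤ A * 2 ^ P.1 * ∑ n ∈ dyadic P.1 P.2, ‖f n‖ * w n := hpair
    _ = 2 ^ P.1 * (A * ∑ n ∈ dyadic P.1 P.2, ‖f n‖ * w n) := by ring

variable (f t N) in
theorem sum_czSet_norm_mul_le (hw : ∀ n, 0 < w n) :
    ∑ n ∈ czSet f t N, ‖f n‖ * w n ≤ ∑ n ∈ range (2 ^ N), ‖f n‖ * w n :=
  sum_le_sum_of_subset_of_nonneg czSet_subset_range fun n _ _ =>
    mul_nonneg (norm_nonneg _) (hw n).le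

variable (𝕜 f t N) in
theorem A1Bound.sum_norm_czGood_le (hA : A1Bound w A) (hw : ∀ n, 0 < w n) :
    ∑ n ∈ range (2 ^ N), ‖czGood 𝕜 f t N n‖ * w n ≤
      (1 + A) * ∑ n ∈ range (2 ^ N), ‖f n‖ * w n := by
  have hA₁ := hA.one_le hw
  have hU : ∑ n ∈ czSet f t N, ‖czGood 𝕜 f t N n‖ * w n ≤
      A * ∑ n ∈ czSet f t N, ‖f n‖ * w n := by
    rw [sum_czSet, sum_czSet, mul_sum]
    refine sum_le_sum fun P hP => ?_
    calc ∑ n ∈ dyadic P.1 P.2, ‖czGood 𝕜 f t N n‖ * w n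
        = ‖dyadicMean 𝕜 f P‖ * ∑ n ∈ dyadic P.1 P.2, w n := by
          rw [mul_sum]
          exact sum_congr rfl fun n hn => by rw [czGood_eq_dyadicMean hP hn]
      _ ≤ A * ∑ n ∈ dyadic P.1 P.2, ‖f n‖ * w n := hA.norm_dyadicMean_mul_sum_le hw f P
  calc ∑ n ∈ range (2 ^ N), ‖czGood 𝕜 f t N n‖ * w n
      = ∑ n ∈ range (2 ^ N) \ czSet f t N, ‖f n‖ * w n +
          ∑ n ∈ czSet f t N, ‖czGood 𝕜 f t N n‖ * w n := by
        rw [← sum_sdiff (czSet_subset_range (f := f) (t := t))]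
        congr 1
        exact sum_congr rfl fun n hn => by rw [czGood_of_notMem (mem_sdiff.1 hn).2]
    _ ≤ ∑ n ∈ range (2 ^ N), ‖f n‖ * w n + A * ∑ n ∈ range (2 ^ N), ‖f n‖ * w n := by
        refine add_le_add ?_ (hU.trans
          (mul_le_mul_of_nonneg_left (sum_czSet_norm_mul_le f t N hw) (by linarith)))
        exact sum_le_sum_of_subset_of_nonneg sdiff_subset fun n _ _ =>
          mul_nonneg (norm_nonneg _) (hw n).le
    _ = (1 + A) * ∑ n ∈ range (2 ^ N), ‖f n‖ * w n := by ring

variable (𝕜 f t N) in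
theorem A1Bound.sum_norm_czBad_le (hA : A1Bound w A) (hw : ∀ n, 0 < w n) :
    ∑ n ∈ range (2 ^ N), ‖czBad 𝕜 f t N n‖ * w n ≤
      (2 + A) * ∑ n ∈ range (2 ^ N), ‖f n‖ * w n :=
  calc ∑ n ∈ range (2 ^ N), ‖czBad 𝕜 f t N n‖ * w n
      ≤ ∑ n ∈ range (2 ^ N), (‖f n‖ * w n + ‖czGood 𝕜 f t N n‖ * w n) := by
        refine sum_le_sum fun n _ => ?_
        rw [← add_mul]
        exact mul_le_mul_of_nonneg_right (norm_sub_le _ _) (hw n).le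
    _ = ∑ n ∈ range (2 ^ N), ‖f n‖ * w n +
          ∑ n ∈ range (2 ^ N), ‖czGood 𝕜 f t N n‖ * w n := sum_add_distrib
    _ ≤ (2 + A) * ∑ n ∈ range (2 ^ N), ‖f n‖ * w n := by
        linarith [hA.sum_norm_czGood_le 𝕜 f t N hw]

theorem A1Bound.mul_sum_triple_le (hA : A1Bound w A) (hw : ∀ n, 0 < w n)
    (hP : P ∈ czIntervals f t N) :
    t * ∑ n ∈ triple P.1 P.2, w n ≤ 3 * A * ∑ n ∈ dyadic P.1 P.2, ‖f n‖ * w n := by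
  have hw_nonneg : 0 ≤ ∑ n ∈ triple P.1 P.2, w n := sum_nonneg fun n _ => (hw n).le
  refine le_of_mul_le_mul_left ?_ (pow_pos two_pos P.1 : (0 : ℝ) < 2 ^ P.1)
  calc (2 : ℝ) ^ P.1 * (t * ∑ n ∈ triple P.1 P.2, w n)
      = t * 2 ^ P.1 * ∑ n ∈ triple P.1 P.2, w n := by ring
    _ ≤ (∑ n ∈ dyadic P.1 P.2, ‖f n‖) * ∑ n ∈ triple P.1 P.2, w n := by
        gcongr
        exact (lt_sum_norm_of_mem_czIntervals hP).le
    _ ≤ ∑ n ∈ dyadic P.1 P.2, ‖f n‖ * (2 ^ P.1 * (3 * A * w n)) := by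
        rw [sum_mul]
        gcongr with n hn
        exact hA.sum_triple_le hw (dyadic_subset_triple _ _ hn)
    _ = 2 ^ P.1 * (3 * A * ∑ n ∈ dyadic P.1 P.2, ‖f n‖ * w n) := by
        simp only [mul_sum]
        exact sum_congr rfl fun n _ => by ring

variable (f N) in
theorem A1Bound.mul_sum_czTriples_le (hA : A1Bound w A) (hw : ∀ n, 0 < w n) (ht : 0 ≤ t) :
    t * ∑ n ∈ czTriples f t N, w n ≤ 3 * A * ∑ n ∈ range (2 ^ N), ‖f n‖ * w n := by
  have hA₁ := hA.one_le hw
  calc t * ∑ n ∈ czTriples f t N, w n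
      ≤ t * ∑ P ∈ czIntervals f t N, ∑ n ∈ triple P.1 P.2, w n := by
        gcongr
        exact sum_biUnion_le_of_nonneg (fun n => (hw n).le) _ _
    _ ≤ ∑ P ∈ czIntervals f t N, 3 * A * ∑ n ∈ dyadic P.1 P.2, ‖f n‖ * w n := by
        rw [mul_sum]
        exact sum_le_sum fun P hP => hA.mul_sum_triple_le hw hP
    _ = 3 * A * ∑ n ∈ czSet f t N, ‖f n‖ * w n := by rw [← mul_sum, sum_czSet]
    _ ≤ 3 * A * ∑ n ∈ range (2 ^ N), ‖f n‖ * w n :=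
        mul_le_mul_of_nonneg_left (sum_czSet_norm_mul_le f t N hw) (by linarith)

variable (𝕜 f t N) in
theorem A1Bound.sum_czBadMajorant_le (hA : A1Bound w A) (hw : ∀ n, 0 < w n) :
    ∑ n ∈ range (2 ^ N) \ czTriples f t N, czBadMajorant 𝕜 f t N n * w n ≤
      13 * A * ((2 + A) * ∑ n ∈ range (2 ^ N), ‖f n‖ * w n) := by
  have hA₁ := hA.one_le hw
  set s := range (2 ^ N) \ czTriples f t N
  set b := czBad 𝕜 f t N
  calc ∑ n ∈ s, czBadMajorant 𝕜 f t N n * w n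
      = ∑ P ∈ czIntervals f t N, ∑ m ∈ dyadic P.1 P.2,
          ‖b m‖ * ∑ n ∈ s, adjointMajorant P.1 n m * w n := by
        simp only [czBadMajorant, sum_mul, mul_sum]
        rw [sum_comm]
        refine sum_congr rfl fun P _ => ?_
        rw [sum_comm]
        exact sum_congr rfl fun m _ => sum_congr rfl fun n _ => by ring
    _ ≤ ∑ P ∈ czIntervals f t N, ∑ m ∈ dyadic P.1 P.2, ‖b m‖ * (13 * A * w m) := by
        gcongr with P hP m hm
        refine hA.sum_adjointMajorant_le hw
          (mem_range.1 (dyadic_subset_range_of_mem_czIntervals hP hm)) sdiff_subset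
          fun n hn hnP => (mem_sdiff.1 hn).2 (mem_biUnion.2 ⟨P, hP, ?_⟩)
        rwa [mem_dyadic.1 hm] at hnP
    _ = 13 * A * ∑ m ∈ czSet f t N, ‖b m‖ * w m := by
        rw [← sum_czSet, mul_sum]
        exact sum_congr rfl fun m _ => by ring
    _ ≤ 13 * A * ∑ m ∈ range (2 ^ N), ‖b m‖ * w m := by
        gcongr
        exacts [fun m _ _ => mul_nonneg (norm_nonneg _) (hw m).le, czSet_subset_range]
    _ ≤ 13 * A * ((2 + A) * ∑ n ∈ range (2 ^ N), ‖f n‖ * w n) := by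
        gcongr
        exact hA.sum_norm_czBad_le 𝕜 f t N hw

variable (𝕜 f t N) in
theorem A1Bound.mul_sum_lt_czBadMajorant_le (hA : A1Bound w A) (hw : ∀ n, 0 < w n) {c : ℝ}
    (hc : 0 ≤ c) :
    t * ∑ n ∈ range (2 ^ N) \ czTriples f t N with t < c * czBadMajorant 𝕜 f t N n, w n ≤
      c * (13 * A * ((2 + A) * ∑ n ∈ range (2 ^ N), ‖f n‖ * w n)) := by
  refine (sum_filter_lt_mul_le (fun n => (hw n).le)
    (fun n => mul_nonneg hc (czBadMajorant_nonneg f t N n)) t).trans ?_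
  simp only [mul_assoc c, ← mul_sum]
  exact mul_le_mul_of_nonneg_left (hA.sum_czBadMajorant_le 𝕜 f t N hw) hc

variable (𝕜 f N) in
theorem A1Bound.mul_sum_lt_hardy_czBad_le (hA : A1Bound w A) (hw : ∀ n, 0 < w n) {c : ℝ}
    (hc : 0 ≤ c) (ht : 0 ≤ t) :
    t * ∑ n ∈ range (2 ^ N) with
        t < (∑ m ∈ range (n + 1), c * ‖czBad 𝕜 f t N m‖) / ((n : ℝ) + 1), w n ≤
      A * (c * ((2 + A) * ∑ n ∈ range (2 ^ N), ‖f n‖ * w n)) := by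
  have hA₁ := hA.one_le hw
  refine (hA.mul_sum_le_of_lt_hardy hw (fun m => by positivity) ht (filter_subset _ _)
    fun n hn => (mem_filter.1 hn).2).trans ?_
  simp only [mul_assoc c, ← mul_sum]
  gcongr
  exact hA.sum_norm_czBad_le 𝕜 f t N hw

end Weighted

end CalderonZygmund

/-! ### Weak type bounds -/

section WeakType

variable {𝕜 E F : Type*} [RCLike 𝕜] [NormedAddCommGroup E] [NormedSpace 𝕜 E]
  [NormedAddCommGroup F] [NormedSpace 𝕜 F] {K : ℕ → ℕ → E →L[𝕜] F} {C p B t A : ℝ}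
  {w : ℕ → ℝ} {f : ℕ → E} {N n : ℕ}

/-- The operator with matrix `K` is of strong type `(p, p)` with respect to the weight `w`,
uniformly over the finite sections of the matrix. The inequality is raised to the power `p`, so that
`B` bounds the `p`-th power of the norm. -/
def StrongType (K : ℕ → ℕ → E →L[𝕜] F) (p : ℝ) (w : ℕ → ℝ) (B : ℝ) : Prop :=
  ∀ (S W : Finset ℕ) (f : ℕ → E),
    ∑ n ∈ W, ‖matApply K S f n‖ ^ p * w n ≤ B * ∑ m ∈ S, ‖f m‖ ^ p * w m

/-- The operator with matrix `K` is of weak type `(1, 1)` with respect to the weight `w`, uniformly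
over the finite sections of the matrix. -/
def WeakType (K : ℕ → ℕ → E →L[𝕜] F) (w : ℕ → ℝ) (B : ℝ) : Prop :=
  ∀ (S W : Finset ℕ) (f : ℕ → E) ⦃t : ℝ⦄, 0 < t →
    t * ∑ n ∈ W with t < ‖matApply K S f n‖, w n ≤ B * ∑ m ∈ S, ‖f m‖ * w m

theorem matApply_indicator (K : ℕ → ℕ → E →L[𝕜] F) {S R : Finset ℕ} (h : S ⊆ R) (f : ℕ → E) :
    matApply K R (Set.indicator S f) = matApply K S f := by
  ext n
  rw [matApply, matApply, ← sum_subset h]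
  · exact sum_congr rfl fun m hm => by rw [Set.indicator_of_mem (mem_coe.2 hm)]
  · exact fun m _ hm => by rw [Set.indicator_of_notMem (mt mem_coe.1 hm), map_zero]

theorem sum_indicator_of_subset {S R : Finset ℕ} (h : S ⊆ R) (f : ℕ → E) {φ : ℕ → E → ℝ}
    (hφ : ∀ n, φ n 0 = 0) : ∑ m ∈ R, φ m (Set.indicator S f m) = ∑ m ∈ S, φ m (f m) := by
  rw [← sum_subset h]
  · exact sum_congr rfl fun m hm => by rw [Set.indicator_of_mem (mem_coe.2 hm)]
  · exact fun m _ hm => by rw [Set.indicator_of_notMem (mt mem_coe.1 hm), hφ]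

theorem exists_subset_range_two_pow (S : Finset ℕ) : ∃ N, S ⊆ range (2 ^ N) := by
  obtain ⟨M, hM⟩ := S.exists_nat_subset_range
  exact ⟨M, hM.trans (range_subset_range.2 Nat.lt_two_pow_self.le)⟩

theorem StrongType.of_range (hw : ∀ n, 0 < w n) (hp : p ≠ 0)
    (h : ∀ (N : ℕ) (f : ℕ → E), ∑ n ∈ range (2 ^ N), ‖matApply K (range (2 ^ N)) f n‖ ^ p * w n ≤
      B * ∑ m ∈ range (2 ^ N), ‖f m‖ ^ p * w m) : StrongType K p w B := by
  intro S W f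
  obtain ⟨N, hN⟩ := exists_subset_range_two_pow (S ∪ W)
  have hind := h N (Set.indicator S f)
  rw [matApply_indicator K (union_subset_left hN),
    sum_indicator_of_subset (union_subset_left hN) f (φ := fun m v => ‖v‖ ^ p * w m)
      fun m => by simp [hp]] at hind
  exact (sum_le_sum_of_subset_of_nonneg (union_subset_right hN) fun n _ _ =>
    mul_nonneg (Real.rpow_nonneg (norm_nonneg _) _) (hw n).le).trans hind

theorem WeakType.of_range (hw : ∀ n, 0 < w n)
    (h : ∀ (N : ℕ) (f : ℕ → E) ⦃t : ℝ⦄, 0 < t →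
      t * ∑ n ∈ range (2 ^ N) with t < ‖matApply K (range (2 ^ N)) f n‖, w n ≤
        B * ∑ m ∈ range (2 ^ N), ‖f m‖ * w m) : WeakType K w B := by
  intro S W f t ht
  obtain ⟨N, hN⟩ := exists_subset_range_two_pow (S ∪ W)
  have hind := h N (Set.indicator S f) ht
  rw [matApply_indicator K (union_subset_left hN),
    sum_indicator_of_subset (union_subset_left hN) f (φ := fun m v => ‖v‖ * w m)
      fun m => by simp] at hind
  refine le_trans (mul_le_mul_of_nonneg_left ?_ ht.le) hind
  exact sum_le_sum_of_subset_of_nonneg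
    (filter_subset_filter _ (union_subset_right hN)) fun n _ _ => (hw n).le

theorem sum_norm_rpow_mul_le {S : Finset ℕ} {g : ℕ → E} {M : ℝ} (hw : ∀ n, 0 < w n) (hp : 1 ≤ p)
    (hg : ∀ n ∈ S, ‖g n‖ ≤ M) :
    ∑ m ∈ S, ‖g m‖ ^ p * w m ≤ M ^ (p - 1) * ∑ m ∈ S, ‖g m‖ * w m := by
  rw [mul_sum]
  refine sum_le_sum fun m hm => ?_
  have hsplit : ‖g m‖ ^ p = ‖g m‖ ^ (p - 1) * ‖g m‖ := by
    rw [← Real.rpow_add_one' (norm_nonneg _) (by linarith), sub_add_cancel]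
  rw [hsplit, mul_assoc]
  exact mul_le_mul_of_nonneg_right
    (Real.rpow_le_rpow (norm_nonneg _) (hg m hm) (by linarith))
    (mul_nonneg (norm_nonneg _) (hw m).le)

theorem StrongType.mul_sum_lt_norm_matApply_le (h : StrongType K p w B) (hw : ∀ n, 0 < w n)
    (hp : 1 ≤ p) (hB : 0 ≤ B) (ht : 0 < t) {S : Finset ℕ} (W : Finset ℕ) {g : ℕ → E}
    (hg : ∀ n ∈ S, ‖g n‖ ≤ 2 * t) :
    t * ∑ n ∈ W with t / 2 < ‖matApply K S g n‖, w n ≤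
      B * 2 ^ (2 * p) * ∑ m ∈ S, ‖g m‖ * w m := by
  set Z := ∑ m ∈ S, ‖g m‖ * w m
  have hZ : 0 ≤ Z := sum_nonneg fun m _ => mul_nonneg (norm_nonneg _) (hw m).le
  have hfilter : {n ∈ W | t / 2 < ‖matApply K S g n‖} =
      {n ∈ W | (t / 2) ^ p < ‖matApply K S g n‖ ^ p} := filter_congr fun n _ =>
    (Real.rpow_lt_rpow_iff (by positivity) (norm_nonneg _) (by linarith)).symm
  have hpow : t * (2 * t) ^ (p - 1) = (t / 2) ^ p * (2 ^ (2 * p) / 2) := by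
    rw [Real.rpow_sub_one (by positivity), Real.mul_rpow zero_le_two ht.le,
      Real.div_rpow ht.le zero_le_two, two_mul p, Real.rpow_add two_pos]
    have : (2 : ℝ) ^ p ≠ 0 := by positivity
    field_simp
  rw [hfilter]
  refine le_of_mul_le_mul_left ?_ (by positivity : 0 < (t / 2) ^ p)
  calc (t / 2) ^ p * (t * ∑ n ∈ W with (t / 2) ^ p < ‖matApply K S g n‖ ^ p, w n)
      = t * ((t / 2) ^ p * ∑ n ∈ W with (t / 2) ^ p < ‖matApply K S g n‖ ^ p, w n) := by ring
    _ ≤ t * ∑ n ∈ W, ‖matApply K S g n‖ ^ p * w n := by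
        gcongr
        exact sum_filter_lt_mul_le (fun n => (hw n).le)
          (fun n => Real.rpow_nonneg (norm_nonneg _) _) _
    _ ≤ t * (B * ((2 * t) ^ (p - 1) * Z)) := by
        gcongr
        exact (h S W g).trans (mul_le_mul_of_nonneg_left (sum_norm_rpow_mul_le hw hp hg) hB)
    _ = (t / 2) ^ p * (B * 2 ^ (2 * p) * Z) / 2 := by linear_combination B * Z * hpow
    _ ≤ (t / 2) ^ p * (B * 2 ^ (2 * p) * Z) := half_le_self (by positivity)

theorem HasOscBound.norm_matApply_czBad_le (hK : HasOscBound K C) (hn : n ∉ czTriples f t N) :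
    ‖matApply K (range (2 ^ N)) (czBad 𝕜 f t N) n‖ ≤
      C * (czBadMajorant 𝕜 f t N n +
        (∑ m ∈ range (n + 1), ‖czBad 𝕜 f t N m‖) / ((n : ℝ) + 1)) := by
  refine hK.norm_matApply_le (pairwiseDisjoint_czIntervals f t N)
    (fun P => dyadic_subset_range_of_mem_czIntervals) (fun P => sum_czBad_eq_zero)
    (fun m _ hm => ?_) fun P hP hnP => hn (mem_biUnion.2 ⟨P, hP, hnP⟩)
  rw [czBad, czGood_of_notMem hm, sub_self]

theorem HasOscBound.filter_lt_norm_matApply_subset (hK : HasOscBound K C) (f : ℕ → E) (t : ℝ)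
    (N : ℕ) :
    {n ∈ range (2 ^ N) | t < ‖matApply K (range (2 ^ N)) f n‖} ⊆
      czTriples f t N ∪ {n ∈ range (2 ^ N) |
          t / 2 < ‖matApply K (range (2 ^ N)) (czGood 𝕜 f t N) n‖} ∪
        {n ∈ range (2 ^ N) \ czTriples f t N | t < 4 * C * czBadMajorant 𝕜 f t N n} ∪
        {n ∈ range (2 ^ N) |
          t < (∑ m ∈ range (n + 1), 4 * C * ‖czBad 𝕜 f t N m‖) / ((n : ℝ) + 1)} := by
  intro n hn
  obtain ⟨hnN, hnt⟩ := mem_filter.1 hn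
  by_contra hc
  simp only [mem_union, mem_filter, mem_sdiff, not_or, not_and, not_lt, and_imp, ← mul_sum,
    mul_div_assoc] at hc
  obtain ⟨⟨⟨hnV, hgood⟩, hlocal⟩, hhardy⟩ := hc
  have hsum : f = czGood 𝕜 f t N + czBad 𝕜 f t N := by
    ext n
    simp [czBad]
  have hbad := hK.norm_matApply_czBad_le hnV
  have htri := norm_add_le (matApply K (range (2 ^ N)) (czGood 𝕜 f t N) n)
    (matApply K (range (2 ^ N)) (czBad 𝕜 f t N) n)
  rw [← matApply_add, ← hsum] at htri
  linarith [hgood hnN, hlocal hnN hnV, hhardy hnN]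

theorem HasOscBound.weakType (hK : HasOscBound K C) (hw : ∀ n, 0 < w n) (hA : A1Bound w A)
    (hp : 1 ≤ p) (hB : 0 ≤ B) (h : StrongType K p w B) :
    WeakType K w (3 * A + B * 2 ^ (2 * p) * (1 + A) + 4 * C * (13 * A * (2 + A)) +
      A * (4 * C * (2 + A))) := by
  refine WeakType.of_range hw fun N f t ht => ?_
  have hA₁ := hA.one_le hw
  have hC := hK.nonneg
  have hw₀ : ∀ n, 0 ≤ w n := fun n => (hw n).le
  set R := range (2 ^ N)
  set Z := ∑ m ∈ R, ‖f m‖ * w m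
  have hZ : 0 ≤ Z := sum_nonneg fun n _ => mul_nonneg (norm_nonneg _) (hw₀ n)
  rcases lt_or_ge (t * 2 ^ N) (∑ n ∈ R, ‖f n‖) with htop | htop
  · calc t * ∑ n ∈ R with t < ‖matApply K R f n‖, w n ≤ t * ∑ n ∈ R, w n := by
          gcongr
          exacts [fun n _ _ => hw₀ n, filter_subset _ _]
      _ ≤ A * Z := hA.mul_sum_range_le hw htop
      _ ≤ _ := by
          gcongr
          have : 0 ≤ B * 2 ^ (2 * p) * (1 + A) := by positivity
          have : 0 ≤ 4 * C * (13 * A * (2 + A)) := by positivity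
          have : 0 ≤ A * (4 * C * (2 + A)) := by positivity
          linarith
  have hgood : t * ∑ n ∈ R with t / 2 < ‖matApply K R (czGood 𝕜 f t N) n‖, w n ≤
      B * 2 ^ (2 * p) * ((1 + A) * Z) :=
    (h.mul_sum_lt_norm_matApply_le hw hp hB ht R fun n hn =>
      norm_czGood_le ht.le htop (mem_range.1 hn)).trans
      (mul_le_mul_of_nonneg_left (hA.sum_norm_czGood_le 𝕜 f t N hw) (by positivity))
  calc t * ∑ n ∈ R with t < ‖matApply K R f n‖, w n
      ≤ t * (∑ n ∈ czTriples f t N, w n + _ + _ + _) := by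
        gcongr
        exact (sum_le_sum_of_subset_of_nonneg (hK.filter_lt_norm_matApply_subset f t N)
          fun n _ _ => hw₀ n).trans <| (sum_union_le_of_nonneg hw₀ _ _).trans <|
          add_le_add_left ((sum_union_le_of_nonneg hw₀ _ _).trans <|
            add_le_add_left (sum_union_le_of_nonneg hw₀ _ _) _) _
    _ ≤ _ := by
        linarith [hA.mul_sum_czTriples_le f N hw ht.le,
          hA.mul_sum_lt_czBadMajorant_le 𝕜 f t N hw (by positivity : 0 ≤ 4 * C),
          hA.mul_sum_lt_hardy_czBad_le 𝕜 f N hw (by positivity : 0 ≤ 4 * C) ht.le]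

end WeakType

/-! ### Sparse domination -/

section SparseDomination

variable {𝕜 E F : Type*} [RCLike 𝕜] [NormedAddCommGroup E] [NormedSpace 𝕜 E]
  [NormedAddCommGroup F] [NormedSpace 𝕜 F] {K : ℕ → ℕ → E →L[𝕜] F} {f : ℕ → E} {C C₁ c Λ : ℝ}
  {N k j y : ℕ}

/-- The average of `‖f‖` over the triple of a dyadic interval, up to a factor at most `3`. -/
noncomputable def tripleAvg (f : ℕ → E) (k j : ℕ) : ℝ := (∑ m ∈ triple k j, ‖f m‖) / 2 ^ k

theorem tripleAvg_nonneg (f : ℕ → E) (k j : ℕ) : 0 ≤ tripleAvg f k j :=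
  div_nonneg (sum_nonneg fun _ _ => norm_nonneg _) (by positivity)

theorem tripleAvg_mul_two_pow (f : ℕ → E) (k j : ℕ) :
    tripleAvg f k j * 2 ^ k = ∑ m ∈ triple k j, ‖f m‖ :=
  div_mul_cancel₀ _ (by positivity)

theorem mul_card_filter_lt_dual_hardy_le {S W : Finset ℕ} {φ : ℕ → ℝ} (hφ : ∀ n, 0 ≤ φ n) (t : ℝ) :
    t * #{n ∈ W | t < ∑ m ∈ S with n ≤ m, φ m / ((m : ℝ) + 1)} ≤ ∑ m ∈ S, φ m := by
  have hφ' (m : ℕ) : 0 ≤ φ m / ((m : ℝ) + 1) := div_nonneg (hφ m) (by positivity)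
  have hcheb := sum_filter_lt_mul_le (s := W) (w := fun _ => 1)
    (X := fun n => ∑ m ∈ S with n ≤ m, φ m / ((m : ℝ) + 1)) (fun _ => zero_le_one)
    (fun n => sum_nonneg fun m _ => hφ' m) t
  rw [sum_const, nsmul_one] at hcheb
  simp only [mul_one, sum_filter] at hcheb
  rw [sum_comm] at hcheb
  simp only [← sum_filter] at hcheb
  refine hcheb.trans (sum_le_sum fun m _ => ?_)
  have hcard : #{n ∈ W | n ≤ m} ≤ m + 1 := by
    refine (card_le_card fun n hn => ?_).trans_eq (card_range (m + 1))
    exact mem_range.2 (Nat.lt_succ_of_le (mem_filter.1 hn).2)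
  calc ∑ n ∈ W with n ≤ m, φ m / ((m : ℝ) + 1)
      = #{n ∈ W | n ≤ m} * (φ m / ((m : ℝ) + 1)) := by rw [sum_const, nsmul_eq_mul]
    _ ≤ ((m : ℝ) + 1) * (φ m / ((m : ℝ) + 1)) := by
        gcongr
        · exact hφ' m
        · exact_mod_cast hcard
    _ = φ m := by field_simp

theorem sum_one_div_max_mul_le {φ : ℕ → ℝ} (hφ : ∀ n, 0 ≤ φ n) (s : Finset ℕ) (y : ℕ) :
    ∑ m ∈ s, 1 / (max (y : ℝ) m + 1) * φ m ≤
      ∑ m ∈ range (y + 1), φ m / ((y : ℝ) + 1) + ∑ m ∈ s with y ≤ m, φ m / ((m : ℝ) + 1) := by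
  have hle : ∑ m ∈ s with ¬ y ≤ m, φ m / ((y : ℝ) + 1) ≤
      ∑ m ∈ range (y + 1), φ m / ((y : ℝ) + 1) := by
    refine sum_le_sum_of_subset_of_nonneg (fun m hm => ?_) fun m _ _ =>
      div_nonneg (hφ m) (by positivity)
    exact mem_range.2 (Nat.lt_succ_of_lt (not_le.1 (mem_filter.1 hm).2))
  refine le_trans (le_of_eq ?_) (add_le_add_left hle _)
  rw [← sum_filter_not_add_sum_filter s (fun m => y ≤ m)]
  congr 1 <;> refine sum_congr rfl fun m hm => ?_
  · rw [max_eq_left (by exact_mod_cast (not_le.1 (mem_filter.1 hm).2).le), one_div_mul_eq_div]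
  · rw [max_eq_right (by exact_mod_cast (mem_filter.1 hm).2), one_div_mul_eq_div]

theorem sum_oscMajorant_mul_le {φ : ℕ → ℝ} (hy : y < 2 ^ N) (hφ : ∀ n, 0 ≤ φ n) (hΛ : 0 ≤ Λ)
    (hmax : ∀ i ≤ N, ∑ n ∈ triple i (y / 2 ^ i), φ n ≤ 2 ^ i * Λ) {s : Finset ℕ}
    (hs : s ⊆ range (2 ^ N)) (hdual : ∑ m ∈ s with y ≤ m, φ m / ((m : ℝ) + 1) ≤ Λ) {i : ℕ}
    (hsi : ∀ m ∈ s, m ∉ triple i (y / 2 ^ i)) : ∑ m ∈ s, oscMajorant i y m * φ m ≤ 6 * Λ := by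
  have hpoisson := sum_poisson_le hy hφ hΛ hmax hs
    fun n hn => two_pow_le_abs_sub_of_notMem_triple (hsi n hn)
  have hhardy := sum_hardy_le hy hφ hΛ hmax
  have hsplit := sum_one_div_max_mul_le hφ s y
  simp only [oscMajorant, add_mul]
  rw [sum_add_distrib]
  linarith

/-- At the point `y`, both the operator applied to `f` on the triple of the dyadic interval with
scale `k` and index `j` and the off-diagonal oscillations of its kernel are controlled by `Λ`. -/
structure IsControlled (K : ℕ → ℕ → E →L[𝕜] F) (f : ℕ → E) (k j : ℕ) (Λ : ℝ) (y : ℕ) : Prop where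
  norm_matApply_le : ‖matApply K (triple k j) f y‖ ≤ Λ
  sum_oscMajorant_le : ∀ (i : ℕ), ∀ s ⊆ triple k j, (∀ m ∈ s, m ∉ triple i (y / 2 ^ i)) →
    ∑ m ∈ s, oscMajorant i y m * ‖f m‖ ≤ 6 * Λ

open Classical in
/-- The points of a dyadic interval at which the operator or the oscillations of its kernel are not
controlled by `c` times the average of `‖f‖`. -/
noncomputable def exceptionalSet (K : ℕ → ℕ → E →L[𝕜] F) (f : ℕ → E) (c : ℝ) (k j : ℕ) : Finset ℕ :=
  {y ∈ dyadic k j | ¬ IsControlled K f k j (c * tripleAvg f k j) y}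

theorem isControlled_of_notMem_exceptionalSet (hy : y ∈ dyadic k j)
    (h : y ∉ exceptionalSet K f c k j) : IsControlled K f k j (c * tripleAvg f k j) y := by
  classical exact not_not.1 fun hc => h (mem_filter.2 ⟨hy, hc⟩)

theorem exceptionalSet_subset : exceptionalSet K f c k j ⊆ dyadic k j := by
  classical exact filter_subset _ _

theorem isControlled_of_le (hN : triple k j ⊆ range (2 ^ N)) (hy : y ∈ dyadic k j)
    (hop : ‖matApply K (triple k j) f y‖ ≤ Λ)
    (hdual : ∑ m ∈ triple k j with y ≤ m, ‖f m‖ / ((m : ℝ) + 1) ≤ Λ)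
    (hmax : ∀ i ≤ N, ∑ n ∈ triple i (y / 2 ^ i), Set.indicator (triple k j) (fun m => ‖f m‖) n ≤
      2 ^ i * Λ) : IsControlled K f k j Λ y := by
  refine ⟨hop, fun i s hs hsi => ?_⟩
  set φ := Set.indicator (triple k j : Set ℕ) fun m => ‖f m‖
  have hφ (n : ℕ) : 0 ≤ φ n := Set.indicator_nonneg (fun m _ => norm_nonneg (f m)) n
  have hφs {m : ℕ} (hm : m ∈ s) : φ m = ‖f m‖ := Set.indicator_of_mem (mem_coe.2 (hs hm)) _
  have hdual' : ∑ m ∈ s with y ≤ m, φ m / ((m : ℝ) + 1) ≤ Λ := by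
    rw [sum_congr rfl fun m hm => by rw [hφs (mem_filter.1 hm).1]]
    exact (sum_le_sum_of_subset_of_nonneg (filter_subset_filter _ hs)
      fun m _ _ => by positivity).trans hdual
  have hosc := sum_oscMajorant_mul_le (mem_range.1 (hN (dyadic_subset_triple k j hy))) hφ
    ((norm_nonneg _).trans hop) hmax (hs.trans hN) hdual' hsi
  rwa [sum_congr rfl fun m hm => by rw [hφs hm]] at hosc

theorem isDyadicDoubling_one : IsDyadicDoubling 1 3 := by
  intro k j
  simpa [card_dyadic] using
    (show (#(triple k j) : ℝ) ≤ 3 * 2 ^ k from mod_cast card_triple_le k j)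

theorem mul_card_filter_lt_sum_triple_le {φ : ℕ → ℝ} (hφ : ∀ n, 0 ≤ φ n)
    (hφN : ∀ n, 2 ^ N ≤ n → φ n = 0) (hΛ : 0 ≤ Λ) (s : Finset ℕ) :
    Λ * #{n ∈ s | ∃ i ≤ N, 2 ^ i * Λ < ∑ m ∈ triple i (n / 2 ^ i), φ m} ≤
      9 * ∑ n ∈ range (2 ^ N), φ n := by
  have hst : ∀ n ∈ {n ∈ s | ∃ i ≤ N, 2 ^ i * Λ < ∑ m ∈ triple i (n / 2 ^ i), φ m},
      ∃ i ≤ N, Λ / 3 * ∑ m ∈ triple i (n / 2 ^ i), (1 : ℕ → ℝ) m <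
        ∑ m ∈ triple i (n / 2 ^ i), φ m := by
    intro n hn
    obtain ⟨i, hi, hlt⟩ := (mem_filter.1 hn).2
    refine ⟨i, hi, lt_of_le_of_lt ?_ hlt⟩
    have hcard : (#(triple i (n / 2 ^ i)) : ℝ) ≤ 3 * 2 ^ i := mod_cast card_triple_le _ _
    simp only [Pi.one_apply, sum_const, nsmul_one]
    calc Λ / 3 * #(triple i (n / 2 ^ i)) ≤ Λ / 3 * (3 * 2 ^ i) := by gcongr
      _ = 2 ^ i * Λ := by ring
  have hmax := isDyadicDoubling_one.mul_sum_le (fun _ => one_pos) hφ hφN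
    (div_nonneg hΛ zero_le_three) hst
  simp only [Pi.one_apply, sum_const, nsmul_one] at hmax
  linarith

theorem mul_card_exceptionalSet_le (hweak : WeakType K 1 C₁) (hpos : 0 < c * tripleAvg f k j) :
    c * tripleAvg f k j * #(exceptionalSet K f c k j) ≤
      (C₁ + 10) * ∑ m ∈ triple k j, ‖f m‖ := by
  classical
  set Λ := c * tripleAvg f k j
  obtain ⟨N, hN⟩ := exists_subset_range_two_pow (triple k j)
  set φ := Set.indicator (triple k j : Set ℕ) fun m => ‖f m‖
  set X₁ := {n ∈ dyadic k j | Λ < ‖matApply K (triple k j) f n‖} with hX₁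
  set X₂ := {n ∈ dyadic k j | Λ < ∑ m ∈ triple k j with n ≤ m, ‖f m‖ / ((m : ℝ) + 1)} with hX₂
  set X₃ := {n ∈ dyadic k j | ∃ i ≤ N, 2 ^ i * Λ < ∑ m ∈ triple i (n / 2 ^ i), φ m} with hX₃
  have hsub : exceptionalSet K f c k j ⊆ X₁ ∪ X₂ ∪ X₃ := by
    intro y hy
    obtain ⟨hyQ, hbad⟩ := mem_filter.1 hy
    contrapose! hbad
    simp only [mem_union, hX₁, hX₂, hX₃, mem_filter, hyQ, true_and, not_or, not_exists, not_and,
      not_lt] at hbad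
    exact isControlled_of_le hN hyQ hbad.1.1 hbad.1.2 hbad.2
  have hcard : (#(exceptionalSet K f c k j) : ℝ) ≤ #X₁ + #X₂ + #X₃ := by
    have := (card_le_card hsub).trans ((card_union_le _ _).trans
      (add_le_add_left (card_union_le X₁ X₂) _))
    exact_mod_cast this
  have h₁ : Λ * #X₁ ≤ C₁ * ∑ m ∈ triple k j, ‖f m‖ := by
    simpa using hweak (triple k j) (dyadic k j) f hpos
  have h₂ : Λ * #X₂ ≤ ∑ m ∈ triple k j, ‖f m‖ :=
    mul_card_filter_lt_dual_hardy_le (fun n => norm_nonneg (f n)) Λ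
  have h₃ : Λ * #X₃ ≤ 9 * ∑ m ∈ triple k j, ‖f m‖ := by
    refine (mul_card_filter_lt_sum_triple_le
      (Set.indicator_nonneg fun m _ => norm_nonneg (f m)) (fun n hn => ?_) hpos.le _).trans_eq ?_
    · exact Set.indicator_of_notMem (fun hm => hn.not_gt (mem_range.1 (hN hm))) _
    · rw [sum_indicator_subset _ hN]
  have := mul_le_mul_of_nonneg_left hcard hpos.le
  linarith

theorem exceptionalSet_eq_empty (h : tripleAvg f k j = 0) : exceptionalSet K f c k j = ∅ := by
  classical
  have hf : ∀ m ∈ triple k j, f m = 0 := by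
    have hsum : ∑ m ∈ triple k j, ‖f m‖ = 0 := by rw [← tripleAvg_mul_two_pow, h, zero_mul]
    rw [sum_eq_zero_iff_of_nonneg fun _ _ => norm_nonneg _] at hsum
    exact fun m hm => norm_eq_zero.1 (hsum m hm)
  refine filter_eq_empty_iff.2 fun y _ => not_not.2 ⟨?_, fun i s hs _ => ?_⟩
  · rw [h, matApply, sum_eq_zero fun m hm => by rw [hf m hm, map_zero]]
    simp
  · rw [h, sum_eq_zero fun m hm => by rw [hf m (hs hm), norm_zero, mul_zero]]
    simp

theorem eight_mul_card_exceptionalSet_le (hC₁ : 0 ≤ C₁) (hweak : WeakType K 1 C₁) (f : ℕ → E)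
    (k j : ℕ) : 8 * #(exceptionalSet K f (8 * (C₁ + 10)) k j) ≤ 2 ^ k := by
  rcases (tripleAvg_nonneg f k j).eq_or_lt with h₀ | hpos
  · simp [exceptionalSet_eq_empty h₀.symm]
  have h := mul_card_exceptionalSet_le (c := 8 * (C₁ + 10)) hweak (by positivity)
  rw [← tripleAvg_mul_two_pow] at h
  have hM : 0 < (C₁ + 10) * tripleAvg f k j := by positivity
  have h8 : (C₁ + 10) * tripleAvg f k j * (8 * #(exceptionalSet K f (8 * (C₁ + 10)) k j)) ≤
      (C₁ + 10) * tripleAvg f k j * 2 ^ k := by linarith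
  exact_mod_cast le_of_mul_le_mul_left h8 hM

/-- The maximal dyadic intervals more than a quarter of whose points are in `X`. -/
noncomputable def stoppingIntervals (X : Finset ℕ) (N : ℕ) : Finset (ℕ × ℕ) :=
  maximalDyadic N fun i l => 2 ^ i < 4 * #(dyadic i l ∩ X)

section StoppingIntervals

variable {X : Finset ℕ} {P : ℕ × ℕ}

theorem fst_lt_of_mem_stoppingIntervals (hcard : 8 * #X ≤ 2 ^ k)
    (hP : P ∈ stoppingIntervals X N) : P.1 < k := by
  have hB := prop_of_mem_maximalDyadic hP
  have hle := card_le_card (inter_subset_right (s₁ := dyadic P.1 P.2) (s₂ := X))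
  refine (Nat.pow_lt_pow_iff_right one_lt_two).1 ?_
  lia

theorem exists_mem_dyadic_inter_of_mem_stoppingIntervals (hP : P ∈ stoppingIntervals X N) :
    (dyadic P.1 P.2 ∩ X).Nonempty := by
  have hB := prop_of_mem_maximalDyadic hP
  exact card_pos.1 (by lia)

theorem dyadic_subset_of_mem_stoppingIntervals (hX : X ⊆ dyadic k j) (hcard : 8 * #X ≤ 2 ^ k)
    (hP : P ∈ stoppingIntervals X N) : dyadic P.1 P.2 ⊆ dyadic k j := by
  obtain ⟨x, hx⟩ := exists_mem_dyadic_inter_of_mem_stoppingIntervals hP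
  rw [mem_inter] at hx
  rw [← mem_dyadic.1 hx.1, ← mem_dyadic.1 (hX hx.2)]
  exact dyadic_subset_of_le (fst_lt_of_mem_stoppingIntervals hcard hP).le

theorem triple_subset_of_mem_stoppingIntervals (hX : X ⊆ dyadic k j) (hcard : 8 * #X ≤ 2 ^ k)
    (hP : P ∈ stoppingIntervals X N) : triple P.1 P.2 ⊆ triple k j := by
  obtain ⟨x, hx⟩ := exists_mem_dyadic_inter_of_mem_stoppingIntervals hP
  rw [mem_inter] at hx
  rw [← mem_dyadic.1 hx.1, ← mem_dyadic.1 (hX hx.2)]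
  exact triple_subset_of_le (fst_lt_of_mem_stoppingIntervals hcard hP).le

theorem two_mul_card_inter_le_of_mem_stoppingIntervals (hcard : 8 * #X ≤ 2 ^ k) (hkN : k ≤ N)
    (hP : P ∈ stoppingIntervals X N) : 2 * #(dyadic P.1 P.2 ∩ X) ≤ 2 ^ P.1 := by
  obtain ⟨x, hx⟩ := dyadic_nonempty P.1 P.2
  have hlt := fst_lt_of_mem_stoppingIntervals hcard hP
  have hmax := not_prop_of_mem_maximalDyadic hP hx (Nat.lt_succ_self _) (hlt.trans_le hkN)
  have hsub : dyadic P.1 P.2 ⊆ dyadic (P.1 + 1) (x / 2 ^ (P.1 + 1)) := by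
    conv_lhs => rw [← mem_dyadic.1 hx]
    exact dyadic_subset_of_le (Nat.le_succ _)
  have hle := card_le_card (inter_subset_inter_right (u := X) hsub)
  rw [Nat.succ_eq_add_one, pow_succ] at hmax
  lia

theorem subset_biUnion_stoppingIntervals (hX : X ⊆ range (2 ^ N)) :
    X ⊆ (stoppingIntervals X N).biUnion fun P => dyadic P.1 P.2 := by
  intro x hx
  have hB : 2 ^ 0 < 4 * #(dyadic 0 (x / 2 ^ 0) ∩ X) := by
    have := card_pos.2 ⟨x, mem_inter.2 ⟨mem_dyadic_self 0 x, hx⟩⟩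
    lia
  obtain ⟨P, hP, hxP, -⟩ := exists_mem_maximalDyadic (B := fun i l => 2 ^ i < 4 * #(dyadic i l ∩ X))
    (mem_range.1 (hX hx)) (Nat.zero_le N) hB
  exact mem_biUnion.2 ⟨P, hP, hxP⟩

theorem pairwiseDisjoint_stoppingIntervals (X : Finset ℕ) (N : ℕ) :
    (stoppingIntervals X N : Set (ℕ × ℕ)).PairwiseDisjoint fun P => dyadic P.1 P.2 :=
  pairwiseDisjoint_maximalDyadic N _

theorem card_biUnion_stoppingIntervals_le (X : Finset ℕ) (N : ℕ) :
    #((stoppingIntervals X N).biUnion fun P => dyadic P.1 P.2) ≤ 4 * #X := by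
  have hd := pairwiseDisjoint_stoppingIntervals X N
  calc #((stoppingIntervals X N).biUnion fun P => dyadic P.1 P.2)
      = ∑ P ∈ stoppingIntervals X N, 2 ^ P.1 := by
        rw [card_biUnion hd]
        exact sum_congr rfl fun P _ => card_dyadic _ _
    _ ≤ ∑ P ∈ stoppingIntervals X N, 4 * #(dyadic P.1 P.2 ∩ X) :=
        sum_le_sum fun P hP => (prop_of_mem_maximalDyadic hP).le
    _ = 4 * #((stoppingIntervals X N).biUnion fun P => dyadic P.1 P.2 ∩ X) := by
        rw [← mul_sum, card_biUnion fun P hP Q hQ hPQ =>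
          (hd hP hQ hPQ).mono inter_subset_left inter_subset_left]
    _ ≤ 4 * #X := by
        gcongr
        exact biUnion_subset.2 fun P _ => inter_subset_right

end StoppingIntervals

theorem HasOscBound.norm_matApply_sub_le (hK : HasOscBound K C) {i x : ℕ} {s : Finset ℕ}
    (hxy : x / 2 ^ i = y / 2 ^ i) (hs : ∀ m ∈ s, m ∉ triple i (y / 2 ^ i)) (f : ℕ → E) :
    ‖matApply K s f x - matApply K s f y‖ ≤ C * ∑ m ∈ s, oscMajorant i y m * ‖f m‖ := by
  rw [matApply, matApply, ← sum_sub_distrib, mul_sum]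
  refine norm_sum_le_of_le _ fun m hm => ?_
  rw [← sub_apply, ← mul_assoc]
  exact ((K x m - K y m).le_opNorm _).trans
    (mul_le_mul_of_nonneg_right (hK.left hxy (hs m hm)) (norm_nonneg _))

-- Compare the part of `f` off the smaller triple at `x` and at the controlled point `y`.
theorem HasOscBound.norm_matApply_triple_le (hK : HasOscBound K C) {i l x : ℕ} {Λ' : ℝ}
    (hsub : triple i l ⊆ triple k j) (hx : x ∈ dyadic i l) (hy : y ∈ dyadic i l)
    (hΛ : IsControlled K f k j Λ y) (hΛ' : IsControlled K f i l Λ' y) :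
    ‖matApply K (triple k j) f x‖ ≤
      ‖matApply K (triple i l) f x‖ + (6 * C + 1) * Λ + Λ' := by
  rw [mem_dyadic] at hx hy
  set D := triple k j \ triple i l
  have hD : ∀ m ∈ D, m ∉ triple i (y / 2 ^ i) := fun m hm => hy ▸ (mem_sdiff.1 hm).2
  have hosc : ‖matApply K D f x - matApply K D f y‖ ≤ C * (6 * Λ) :=
    (hK.norm_matApply_sub_le (hx.trans hy.symm) hD f).trans
      (mul_le_mul_of_nonneg_left (hΛ.sum_oscMajorant_le i D sdiff_subset hD) hK.nonneg)
  have hsplit (n : ℕ) : matApply K (triple k j) f n =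
      matApply K D f n + matApply K (triple i l) f n := (sum_sdiff hsub).symm
  have heq : matApply K (triple k j) f x = matApply K (triple i l) f x +
      (matApply K D f x - matApply K D f y) +
      (matApply K (triple k j) f y - matApply K (triple i l) f y) := by
    rw [hsplit x, hsplit y]
    abel
  have hy_le := norm_sub_le (matApply K (triple k j) f y) (matApply K (triple i l) f y)
  have hadd := heq ▸ norm_add₃_le
    (a := matApply K (triple i l) f x) (b := matApply K D f x - matApply K D f y)
    (c := matApply K (triple k j) f y - matApply K (triple i l) f y)
  linarith [hΛ.norm_matApply_le, hΛ'.norm_matApply_le]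

theorem HasOscBound.norm_matApply_le_of_mem_stoppingIntervals (hK : HasOscBound K C)
    (hexc : ∀ k j, 8 * #(exceptionalSet K f c k j) ≤ 2 ^ k) (hkN : k ≤ N) {P : ℕ × ℕ}
    (hP : P ∈ stoppingIntervals (exceptionalSet K f c k j) N) {x : ℕ} (hx : x ∈ dyadic P.1 P.2) :
    ‖matApply K (triple k j) f x‖ ≤ ‖matApply K (triple P.1 P.2) f x‖ +
      (6 * C + 1) * (c * tripleAvg f k j) + c * tripleAvg f P.1 P.2 := by
  set X := exceptionalSet K f c k j
  set Y := exceptionalSet K f c P.1 P.2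
  obtain ⟨y, hy⟩ : (dyadic P.1 P.2 \ (dyadic P.1 P.2 ∩ X ∪ Y)).Nonempty := by
    have hsdiff := le_card_sdiff (dyadic P.1 P.2 ∩ X ∪ Y) (dyadic P.1 P.2)
    have hunion := card_union_le (dyadic P.1 P.2 ∩ X) Y
    have hhalf := two_mul_card_inter_le_of_mem_stoppingIntervals (hexc k j) hkN hP
    have heighth := hexc P.1 P.2
    have hpos : 0 < 2 ^ P.1 := by positivity
    rw [card_dyadic] at hsdiff
    exact card_pos.1 (by lia)
  simp only [mem_sdiff, mem_union, mem_inter, not_or, not_and] at hy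
  obtain ⟨hyP, hyX, hyY⟩ := hy
  exact hK.norm_matApply_triple_le
    (triple_subset_of_mem_stoppingIntervals exceptionalSet_subset (hexc k j) hP) hx hyP
    (isControlled_of_notMem_exceptionalSet
      (dyadic_subset_of_mem_stoppingIntervals exceptionalSet_subset (hexc k j) hP hyP) (hyX hyP))
    (isControlled_of_notMem_exceptionalSet hyP hyY)

variable {G Φ : ℕ → ℝ}

theorem sum_sdiff_stoppingIntervals_le (hG : ∀ n, 0 ≤ G n) {U : Finset ℕ}
    (hU : exceptionalSet K f c k j ⊆ U) :
    ∑ n ∈ dyadic k j \ U, ‖matApply K (triple k j) f n‖ * G n ≤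
      c * tripleAvg f k j * ∑ n ∈ dyadic k j \ U, G n := by
  rw [mul_sum]
  refine sum_le_sum fun n hn => mul_le_mul_of_nonneg_right ?_ (hG n)
  rw [mem_sdiff] at hn
  exact (isControlled_of_notMem_exceptionalSet hn.1 fun h => hn.2 (hU h)).norm_matApply_le

theorem HasOscBound.sum_biUnion_stoppingIntervals_le (hK : HasOscBound K C)
    (hG : ∀ n, 0 ≤ G n) (hexc : ∀ k j, 8 * #(exceptionalSet K f c k j) ≤ 2 ^ k) (hkN : k ≤ N)
    {C₂ : ℝ} (ih : ∀ i < k, ∀ l, c * tripleAvg f i l * ∑ n ∈ dyadic i l, G n +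
      ∑ n ∈ dyadic i l, ‖matApply K (triple i l) f n‖ * G n ≤ C₂ * ∑ n ∈ dyadic i l, Φ n) :
    ∑ n ∈ (stoppingIntervals (exceptionalSet K f c k j) N).biUnion (fun P => dyadic P.1 P.2),
        ‖matApply K (triple k j) f n‖ * G n ≤
      (6 * C + 1) * (c * tripleAvg f k j) *
          ∑ n ∈ (stoppingIntervals (exceptionalSet K f c k j) N).biUnion
            (fun P => dyadic P.1 P.2), G n +
        C₂ * ∑ n ∈ (stoppingIntervals (exceptionalSet K f c k j) N).biUnion
          (fun P => dyadic P.1 P.2), Φ n := by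
  have hd := pairwiseDisjoint_stoppingIntervals (exceptionalSet K f c k j) N
  rw [sum_biUnion hd, sum_biUnion hd, sum_biUnion hd, mul_sum, mul_sum, ← sum_add_distrib]
  refine sum_le_sum fun P hP => ?_
  have hle := ih P.1 (fst_lt_of_mem_stoppingIntervals (hexc k j) hP) P.2
  calc ∑ n ∈ dyadic P.1 P.2, ‖matApply K (triple k j) f n‖ * G n
      ≤ ∑ n ∈ dyadic P.1 P.2, (‖matApply K (triple P.1 P.2) f n‖ * G n +
        (6 * C + 1) * (c * tripleAvg f k j) * G n + c * tripleAvg f P.1 P.2 * G n) := by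
        refine sum_le_sum fun n hn => ?_
        rw [← add_mul, ← add_mul]
        exact mul_le_mul_of_nonneg_right
          (hK.norm_matApply_le_of_mem_stoppingIntervals hexc hkN hP hn) (hG n)
    _ = ∑ n ∈ dyadic P.1 P.2, ‖matApply K (triple P.1 P.2) f n‖ * G n +
        (6 * C + 1) * (c * tripleAvg f k j) * ∑ n ∈ dyadic P.1 P.2, G n +
        c * tripleAvg f P.1 P.2 * ∑ n ∈ dyadic P.1 P.2, G n := by
        rw [sum_add_distrib, sum_add_distrib, ← mul_sum, ← mul_sum]
    _ ≤ _ := by linarith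

theorem HasOscBound.tripleAvg_mul_sum_add_sum_le (hK : HasOscBound K C) (hc : 0 ≤ c)
    (hG : ∀ n, 0 ≤ G n) (hexc : ∀ k j, 8 * #(exceptionalSet K f c k j) ≤ 2 ^ k)
    (H : ∀ s ⊆ dyadic k j, 2 ^ k ≤ 2 * #s →
      tripleAvg f k j * ∑ n ∈ dyadic k j, G n ≤ ∑ n ∈ s, Φ n)
    (ih : ∀ i < k, ∀ l, c * tripleAvg f i l * ∑ n ∈ dyadic i l, G n +
      ∑ n ∈ dyadic i l, ‖matApply K (triple i l) f n‖ * G n ≤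
        (6 * C + 2) * c * ∑ n ∈ dyadic i l, Φ n) :
    c * tripleAvg f k j * ∑ n ∈ dyadic k j, G n +
      ∑ n ∈ dyadic k j, ‖matApply K (triple k j) f n‖ * G n ≤
        (6 * C + 2) * c * ∑ n ∈ dyadic k j, Φ n := by
  have hC := hK.nonneg
  obtain ⟨N, hN⟩ := exists_subset_range_two_pow (dyadic k j)
  have hNk : dyadic k j ⊆ range (2 ^ (N + k)) :=
    hN.trans (range_subset_range.2 (Nat.pow_le_pow_right two_pos (N.le_add_right k)))
  set X := exceptionalSet K f c k j
  set U := (stoppingIntervals X (N + k)).biUnion fun P => dyadic P.1 P.2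
  have hUQ : U ⊆ dyadic k j := biUnion_subset.2 fun P hP =>
    dyadic_subset_of_mem_stoppingIntervals exceptionalSet_subset (hexc k j) hP
  have hhalf : 2 ^ k ≤ 2 * #(dyadic k j \ U) := by
    have hcardU := card_biUnion_stoppingIntervals_le X (N + k)
    have hcard := card_sdiff_add_card_eq_card hUQ
    have heighth := hexc k j
    rw [card_dyadic] at hcard
    lia
  have hsparse := mul_le_mul_of_nonneg_left (H (dyadic k j \ U) sdiff_subset hhalf)
    (by positivity : 0 ≤ (6 * C + 2) * c)
  have hout := sum_sdiff_stoppingIntervals_le hG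
    (subset_biUnion_stoppingIntervals (exceptionalSet_subset.trans hNk) : X ⊆ U)
  have hin := hK.sum_biUnion_stoppingIntervals_le hG hexc (Nat.le_add_left k N) ih (j := j)
  have hGout : 0 ≤ C * (c * tripleAvg f k j * ∑ n ∈ dyadic k j \ U, G n) :=
    mul_nonneg hC (mul_nonneg (mul_nonneg hc (tripleAvg_nonneg f k j))
      (sum_nonneg fun n _ => hG n))
  rw [← sum_sdiff hUQ (f := G)] at hsparse ⊢
  rw [← sum_sdiff hUQ, ← sum_sdiff hUQ (f := Φ)]
  linarith

theorem HasOscBound.sum_norm_matApply_mul_le (hK : HasOscBound K C) (hc : 0 ≤ c)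
    (hG : ∀ n, 0 ≤ G n) (hexc : ∀ k j, 8 * #(exceptionalSet K f c k j) ≤ 2 ^ k)
    (H : ∀ i l : ℕ, ∀ s ⊆ dyadic i l, i ≤ k → 2 ^ i ≤ 2 * #s →
      tripleAvg f i l * ∑ n ∈ dyadic i l, G n ≤ ∑ n ∈ s, Φ n) (j : ℕ) :
    ∑ n ∈ dyadic k j, ‖matApply K (triple k j) f n‖ * G n ≤
      (6 * C + 2) * c * ∑ n ∈ dyadic k j, Φ n := by
  suffices h : ∀ i ≤ k, ∀ j, c * tripleAvg f i j * ∑ n ∈ dyadic i j, G n +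
      ∑ n ∈ dyadic i j, ‖matApply K (triple i j) f n‖ * G n ≤
        (6 * C + 2) * c * ∑ n ∈ dyadic i j, Φ n from
    le_of_add_le_of_nonneg_right (h k le_rfl j)
      (mul_nonneg (mul_nonneg hc (tripleAvg_nonneg f k j)) (sum_nonneg fun n _ => hG n))
  intro i
  induction i using Nat.strong_induction_on with
  | _ i ih =>
    intro hi j
    exact hK.tripleAvg_mul_sum_add_sum_le hc hG hexc (fun s hs => H i j s hs hi)
      fun l hl => ih l hl (hl.le.trans hi)

end SparseDomination

/-! ### Muckenhoupt weights -/

section Muckenhoupt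

variable {p q : ℝ} {w σ : ℕ → ℝ} {A C : ℝ} {k j N : ℕ} {s : Finset ℕ}

/-- The `A_p` condition for a weight `w` with dual weight `σ = w ^ (-1 / (p - 1))` and constant
`A ^ p`, in a form invariant under `(p, w) ↔ (q, σ)`. The value of `σ` is encoded by
`mul_eq_one`. -/
structure DualWeights (p q : ℝ) (w σ : ℕ → ℝ) (A : ℝ) : Prop where
  conj : p.HolderConjugate q
  pos : ∀ n, 0 < w n
  pos' : ∀ n, 0 < σ n
  mul_eq_one : ∀ n, w n ^ (1 / p) * σ n ^ (1 / q) = 1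
  bound : ∀ a b : ℕ,
    (∑ n ∈ Ico a b, w n) ^ (1 / p) * (∑ n ∈ Ico a b, σ n) ^ (1 / q) ≤ A * #(Ico a b)

theorem rpow_one_div_rpow_cancel {x : ℝ} (hx : 0 ≤ x) (hp : p ≠ 0) : (x ^ (1 / p)) ^ p = x := by
  rw [one_div, Real.rpow_inv_rpow hx hp]

-- Young's inequality with the factors `1 / p` and `1 / q` on the right dropped.
theorem mul_rpow_mul_mul_rpow_le (hpq : p.HolderConjugate q) {a b x y : ℝ} (ha : 0 ≤ a)
    (hb : 0 ≤ b) (hx : 0 ≤ x) (hy : 0 ≤ y) :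
    a * x ^ (1 / p) * (b * y ^ (1 / q)) ≤ a ^ p * x + b ^ q * y := by
  have hyoung := Real.young_inequality_of_nonneg (a := a * x ^ (1 / p)) (b := b * y ^ (1 / q))
    (by positivity) (by positivity) hpq
  rw [Real.mul_rpow ha (by positivity), Real.mul_rpow hb (by positivity),
    rpow_one_div_rpow_cancel hx hpq.ne_zero, rpow_one_div_rpow_cancel hy hpq.symm.ne_zero] at hyoung
  exact hyoung.trans (add_le_add (div_le_self (by positivity) hpq.lt.le)
    (div_le_self (by positivity) hpq.symm.lt.le))

theorem div_rpow_mul_eq {x y v : ℝ} (hx : 0 ≤ x) (hy : 0 < y) (h : y ^ (1 - p) = v) :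
    (x / y) ^ p * y = x ^ p * v := by
  rw [← h, Real.div_rpow hx hy.le, Real.rpow_sub hy, Real.rpow_one]
  have : 0 < y ^ p := by positivity
  field_simp

-- Testing on `g = δ Θ ^ (p - 1)` with `δ ^ q = δ / (2 C)` absorbs the `g`-term on the right.
theorem sum_rpow_mul_le_of_pairing (hpq : p.HolderConjugate q) (hC : 0 < C) {Θ : ℕ → ℝ} {Y : ℝ}
    (hΘ : ∀ n, 0 ≤ Θ n)
    (H : ∀ g : ℕ → ℝ, (∀ n, 0 ≤ g n) →
      ∑ n ∈ s, Θ n * (g n * w n) ≤ C * (Y + ∑ n ∈ s, g n ^ q * w n)) :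
    ∑ n ∈ s, Θ n ^ p * w n ≤ (2 * C) ^ p * Y := by
  set δ := (2 * C) ^ (1 - p) with hδ
  have hδ₀ : 0 < δ := by positivity
  have hδC : δ * (2 * C) ^ p = 2 * C := by
    rw [hδ, ← Real.rpow_add (by positivity), sub_add_cancel, Real.rpow_one]
  have hδq : δ ^ q * (2 * C) = δ := by
    rw [hδ, ← Real.rpow_mul (by positivity), ← Real.rpow_add_one (by positivity)]
    congr 1
    linear_combination -hpq.sub_one_mul_conj
  have hpow (n : ℕ) : Θ n ^ p = Θ n ^ (p - 1) * Θ n := by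
    rw [← Real.rpow_add_one' (hΘ n) (by linarith [hpq.pos]), sub_add_cancel]
  have htest := H (fun n => δ * Θ n ^ (p - 1)) fun n =>
    mul_nonneg hδ₀.le (Real.rpow_nonneg (hΘ n) _)
  have hleft : ∑ n ∈ s, Θ n * (δ * Θ n ^ (p - 1) * w n) = δ * ∑ n ∈ s, Θ n ^ p * w n := by
    rw [mul_sum]
    exact sum_congr rfl fun n _ => by rw [hpow]; ring
  have hright : ∑ n ∈ s, (δ * Θ n ^ (p - 1)) ^ q * w n = δ ^ q * ∑ n ∈ s, Θ n ^ p * w n := by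
    rw [mul_sum]
    refine sum_congr rfl fun n _ => ?_
    rw [Real.mul_rpow hδ₀.le (Real.rpow_nonneg (hΘ n) _), ← Real.rpow_mul (hΘ n),
      hpq.sub_one_mul_conj, mul_assoc]
  rw [hleft, hright] at htest
  refine le_of_mul_le_mul_left ?_ hδ₀
  linear_combination 2 * htest + (∑ n ∈ s, Θ n ^ p * w n) * hδq - Y * hδC

namespace DualWeights

theorem symm (h : DualWeights p q w σ A) : DualWeights q p σ w A where
  conj := h.conj.symm
  pos := h.pos'
  pos' := h.pos
  mul_eq_one n := by rw [mul_comm, h.mul_eq_one]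
  bound a b := by rw [mul_comm]; exact h.bound a b

theorem const_pos (h : DualWeights p q w σ A) : 0 < A := by
  have hone := h.bound 0 1
  rw [Nat.Ico_succ_singleton, sum_singleton, sum_singleton, h.mul_eq_one, card_singleton,
    Nat.cast_one, mul_one] at hone
  exact one_pos.trans_le hone

theorem weight_sum_nonneg (h : DualWeights p q w σ A) (s : Finset ℕ) : 0 ≤ ∑ n ∈ s, w n :=
  sum_nonneg fun n _ => (h.pos n).le

theorem dual_rpow (h : DualWeights p q w σ A) (n : ℕ) : σ n ^ (1 - p) = w n := by
  have hσ := h.pos' n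
  have hone := congrArg (· ^ p) (h.mul_eq_one n)
  simp only [Real.mul_rpow (Real.rpow_nonneg (h.pos n).le _) (Real.rpow_nonneg hσ.le _),
    rpow_one_div_rpow_cancel (h.pos n).le h.conj.ne_zero, ← Real.rpow_mul hσ.le, Real.one_rpow,
    one_div_mul_eq_div, h.conj.div_conj_eq_sub_one] at hone
  rw [← neg_sub, Real.rpow_neg hσ.le]
  exact (eq_inv_of_mul_eq_one_left hone).symm

theorem card_le (h : DualWeights p q w σ A) (s : Finset ℕ) :
    #s ≤ (∑ n ∈ s, w n) ^ (1 / p) * (∑ n ∈ s, σ n) ^ (1 / q) := by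
  have hholder := Real.inner_le_Lp_mul_Lq_of_nonneg s h.conj (f := fun n => w n ^ (1 / p))
    (g := fun n => σ n ^ (1 / q)) (fun n _ => Real.rpow_nonneg (h.pos n).le _)
    fun n _ => Real.rpow_nonneg (h.pos' n).le _
  simpa only [h.mul_eq_one, sum_const, nsmul_one,
    rpow_one_div_rpow_cancel (h.pos _).le h.conj.ne_zero,
    rpow_one_div_rpow_cancel (h.pos' _).le h.symm.conj.ne_zero] using hholder

theorem bound_triple (h : DualWeights p q w σ A) (k j : ℕ) :
    (∑ n ∈ triple k j, w n) ^ (1 / p) * (∑ n ∈ triple k j, σ n) ^ (1 / q) ≤ 3 * A * 2 ^ k := by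
  have hcard : (#(triple k j) : ℝ) ≤ 3 * 2 ^ k := mod_cast card_triple_le k j
  have hA := h.const_pos
  calc (∑ n ∈ triple k j, w n) ^ (1 / p) * (∑ n ∈ triple k j, σ n) ^ (1 / q)
      ≤ A * #(triple k j) := h.bound _ _
    _ ≤ A * (3 * 2 ^ k) := by gcongr
    _ = 3 * A * 2 ^ k := by ring

theorem rpow_sum_triple_le (h : DualWeights p q w σ A) (hs : s ⊆ triple k j)
    (hcard : 2 ^ k ≤ 2 * #s) :
    (∑ n ∈ triple k j, w n) ^ (1 / p) ≤ 6 * A * (∑ n ∈ s, w n) ^ (1 / p) := by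
  have hws := Real.rpow_nonneg (h.weight_sum_nonneg s) (1 / p)
  have hwT := Real.rpow_nonneg (h.weight_sum_nonneg (triple k j)) (1 / p)
  have hσs := h.symm.weight_sum_nonneg s
  have hq := h.conj.symm.pos
  have hA := h.const_pos
  have hcard' : (2 : ℝ) ^ k ≤ 2 * #s := mod_cast hcard
  have hs₀ : (0 : ℝ) < #s := by
    have : (0 : ℝ) < 2 ^ k := by positivity
    linarith
  refine le_of_mul_le_mul_left ?_ hs₀
  calc #s * (∑ n ∈ triple k j, w n) ^ (1 / p)
      ≤ (∑ n ∈ s, w n) ^ (1 / p) * (∑ n ∈ s, σ n) ^ (1 / q) *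
        (∑ n ∈ triple k j, w n) ^ (1 / p) := mul_le_mul_of_nonneg_right (h.card_le s) hwT
    _ ≤ (∑ n ∈ s, w n) ^ (1 / p) * (∑ n ∈ triple k j, σ n) ^ (1 / q) *
        (∑ n ∈ triple k j, w n) ^ (1 / p) := by
        gcongr
        exact fun n _ _ => (h.pos' n).le
    _ = (∑ n ∈ s, w n) ^ (1 / p) * ((∑ n ∈ triple k j, w n) ^ (1 / p) *
        (∑ n ∈ triple k j, σ n) ^ (1 / q)) := by ring
    _ ≤ (∑ n ∈ s, w n) ^ (1 / p) * (3 * A * (2 * #s)) :=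
        mul_le_mul_of_nonneg_left ((h.bound_triple k j).trans (by gcongr)) hws
    _ = #s * (6 * A * (∑ n ∈ s, w n) ^ (1 / p)) := by ring

theorem sum_triple_le (h : DualWeights p q w σ A) (hs : s ⊆ triple k j) (hcard : 2 ^ k ≤ 2 * #s) :
    ∑ n ∈ triple k j, w n ≤ (6 * A) ^ p * ∑ n ∈ s, w n := by
  have hA := h.const_pos
  have hpow := Real.rpow_le_rpow (Real.rpow_nonneg (h.weight_sum_nonneg _) _)
    (h.rpow_sum_triple_le hs hcard) h.conj.nonneg
  rwa [Real.mul_rpow (by positivity) (Real.rpow_nonneg (h.weight_sum_nonneg _) _),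
    rpow_one_div_rpow_cancel (h.weight_sum_nonneg _) h.conj.ne_zero,
    rpow_one_div_rpow_cancel (h.weight_sum_nonneg _) h.conj.ne_zero] at hpow

theorem isDyadicDoubling (h : DualWeights p q w σ A) : IsDyadicDoubling w ((6 * A) ^ p) :=
  fun k j => h.sum_triple_le (dyadic_subset_triple k j) (by rw [card_dyadic]; lia)

theorem rpow_conj_sum_triple_le (h : DualWeights p q w σ A) (hs : s ⊆ triple k j)
    (hcard : 2 ^ k ≤ 2 * #s) :
    (∑ n ∈ triple k j, w n) ^ (1 / q) ≤ (6 * A) ^ (p / q) * (∑ n ∈ s, w n) ^ (1 / q) := by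
  have hA := h.const_pos
  have hpow := Real.rpow_le_rpow (h.weight_sum_nonneg _) (h.sum_triple_le hs hcard)
    (one_div_pos.2 h.conj.symm.pos).le
  rwa [Real.mul_rpow (by positivity) (h.weight_sum_nonneg _), ← Real.rpow_mul (by positivity),
    mul_one_div] at hpow

theorem sum_mul_sum_le (h : DualWeights p q w σ A) (hs : s ⊆ triple k j)
    (hcard : 2 ^ k ≤ 2 * #s) :
    (∑ n ∈ triple k j, σ n) * ∑ n ∈ triple k j, w n ≤
      2 ^ k * (3 * A * (6 * A) ^ (q / p + p / q)) *
        ((∑ n ∈ s, σ n) ^ (1 / p) * (∑ n ∈ s, w n) ^ (1 / q)) := by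
  have hA := h.const_pos
  have hsplit {x : ℝ} (hx : 0 ≤ x) : x = x ^ (1 / p) * x ^ (1 / q) := by
    rw [← Real.rpow_add_of_nonneg hx (one_div_pos.2 h.conj.pos).le
      (one_div_pos.2 h.conj.symm.pos).le, one_div, one_div, h.conj.inv_add_inv_eq_one,
      Real.rpow_one]
  have hw := h.rpow_conj_sum_triple_le hs hcard
  have hσ := h.symm.rpow_conj_sum_triple_le hs hcard
  have hw₀ := Real.rpow_nonneg (h.weight_sum_nonneg (triple k j)) (1 / q)
  have hσ₀ := Real.rpow_nonneg (h.symm.weight_sum_nonneg s) (1 / p)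
  have hσ₁ := Real.rpow_nonneg (h.symm.weight_sum_nonneg (triple k j)) (1 / p)
  calc (∑ n ∈ triple k j, σ n) * ∑ n ∈ triple k j, w n
      = (∑ n ∈ triple k j, σ n) ^ (1 / p) * (∑ n ∈ triple k j, σ n) ^ (1 / q) *
        ((∑ n ∈ triple k j, w n) ^ (1 / p) * (∑ n ∈ triple k j, w n) ^ (1 / q)) := by
        rw [← hsplit (h.symm.weight_sum_nonneg _), ← hsplit (h.weight_sum_nonneg _)]
    _ = (∑ n ∈ triple k j, w n) ^ (1 / p) * (∑ n ∈ triple k j, σ n) ^ (1 / q) *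
        ((∑ n ∈ triple k j, σ n) ^ (1 / p) * (∑ n ∈ triple k j, w n) ^ (1 / q)) := by ring
    _ ≤ 3 * A * 2 ^ k * ((6 * A) ^ (q / p) * (∑ n ∈ s, σ n) ^ (1 / p) *
        ((6 * A) ^ (p / q) * (∑ n ∈ s, w n) ^ (1 / q))) :=
        mul_le_mul (h.bound_triple k j) (mul_le_mul hσ hw hw₀ (by positivity)) (by positivity)
          (by positivity)
    _ = 2 ^ k * (3 * A * (6 * A) ^ (q / p + p / q)) *
        ((∑ n ∈ s, σ n) ^ (1 / p) * (∑ n ∈ s, w n) ^ (1 / q)) := by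
        rw [Real.rpow_add (by positivity)]
        ring

theorem sum_triple_mul_sum_triple_le (h : DualWeights p q w σ A) {φ ψ : ℕ → ℝ}
    (hφ : ∀ n, 0 ≤ φ n) (hψ : ∀ n, 0 ≤ ψ n) (hk : k ≤ N) (hs : s ⊆ dyadic k j)
    (hcard : 2 ^ k ≤ 2 * #s) :
    (∑ n ∈ triple k j, φ n) * ∑ n ∈ triple k j, ψ n ≤
      2 ^ k * (3 * A * (6 * A) ^ (q / p + p / q)) *
        ∑ n ∈ s, (tripleMax σ φ N n ^ p * σ n + tripleMax w ψ N n ^ q * w n) := by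
  set M := 3 * A * (6 * A) ^ (q / p + p / q)
  set a := (∑ m ∈ triple k j, φ m) / ∑ m ∈ triple k j, σ m with ha
  set b := (∑ m ∈ triple k j, ψ m) / ∑ m ∈ triple k j, w m with hb
  have hA := h.const_pos
  have hp := h.conj.nonneg
  have hq := h.symm.conj.nonneg
  have ha₀ : 0 ≤ a := div_nonneg (sum_nonneg fun m _ => hφ m) (h.symm.weight_sum_nonneg _)
  have hb₀ : 0 ≤ b := div_nonneg (sum_nonneg fun m _ => hψ m) (h.weight_sum_nonneg _)
  have haM : ∀ n ∈ s, a ≤ tripleMax σ φ N n := fun n hn => by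
    rw [ha, ← mem_dyadic.1 (hs hn)]
    exact le_tripleMax σ φ hk n
  have hbM : ∀ n ∈ s, b ≤ tripleMax w ψ N n := fun n hn => by
    rw [hb, ← mem_dyadic.1 (hs hn)]
    exact le_tripleMax w ψ hk n
  calc (∑ n ∈ triple k j, φ n) * ∑ n ∈ triple k j, ψ n
      = a * b * ((∑ n ∈ triple k j, σ n) * ∑ n ∈ triple k j, w n) := by
        rw [mul_mul_mul_comm, ha, hb, div_mul_cancel₀ _ (sum_triple_pos h.pos' k j).ne',
          div_mul_cancel₀ _ (sum_triple_pos h.pos k j).ne']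
    _ ≤ a * b * (2 ^ k * M * ((∑ n ∈ s, σ n) ^ (1 / p) * (∑ n ∈ s, w n) ^ (1 / q))) :=
        mul_le_mul_of_nonneg_left
          (h.sum_mul_sum_le (hs.trans (dyadic_subset_triple k j)) hcard) (mul_nonneg ha₀ hb₀)
    _ = 2 ^ k * M * (a * (∑ n ∈ s, σ n) ^ (1 / p) * (b * (∑ n ∈ s, w n) ^ (1 / q))) := by ring
    _ ≤ 2 ^ k * M * (a ^ p * ∑ n ∈ s, σ n + b ^ q * ∑ n ∈ s, w n) := by
        gcongr
        exact mul_rpow_mul_mul_rpow_le h.conj ha₀ hb₀ (h.symm.weight_sum_nonneg s)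
          (h.weight_sum_nonneg s)
    _ = 2 ^ k * M * ∑ n ∈ s, (a ^ p * σ n + b ^ q * w n) := by
        rw [sum_add_distrib, mul_sum, mul_sum]
    _ ≤ 2 ^ k * M * ∑ n ∈ s, (tripleMax σ φ N n ^ p * σ n + tripleMax w ψ N n ^ q * w n) := by
        gcongr with n hn
        exacts [(h.pos' n).le, haM n hn, (h.pos n).le, hbM n hn]

theorem exists_sum_tripleMax_rpow_le (h : DualWeights p q w σ A) : ∃ c > 0, ∀ (N : ℕ) (a : ℕ → ℝ),
    (∀ n, 0 ≤ a n) → (∀ n, 2 ^ N ≤ n → a n = 0) →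
      ∑ n ∈ range (2 ^ N), tripleMax w a N n ^ q * w n ≤
        c * ∑ n ∈ range (2 ^ N), (a n / w n) ^ q * w n := by
  have hA := h.const_pos
  have hq := h.symm.conj.pos
  have hq₁ : 0 < q - 1 := h.symm.conj.sub_one_pos
  exact ⟨q * (2 * (6 * A) ^ p) * 2 ^ (q - 1) / (q - 1), by positivity, fun N a ha haN =>
    h.isDyadicDoubling.sum_tripleMax_rpow_le h.pos h.symm.conj.lt ha haN⟩

section Operator

variable {𝕜 E F : Type*} [RCLike 𝕜] [NormedAddCommGroup E] [NormedSpace 𝕜 E]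
  [NormedAddCommGroup F] [NormedSpace 𝕜 F] {K : ℕ → ℕ → E →L[𝕜] F} {C₁ : ℝ}

theorem tripleAvg_mul_sum_le (h : DualWeights p q w σ A) (f : ℕ → E) {g : ℕ → ℝ}
    (hg : ∀ n, 0 ≤ g n) (hk : k ≤ N) (hs : s ⊆ dyadic k j) (hcard : 2 ^ k ≤ 2 * #s) :
    tripleAvg f k j * ∑ n ∈ dyadic k j, g n * w n ≤
      ∑ n ∈ s, 3 * A * (6 * A) ^ (q / p + p / q) *
        (tripleMax σ (fun m => ‖f m‖) N n ^ p * σ n +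
          tripleMax w (fun m => g m * w m) N n ^ q * w n) := by
  have hgw (n : ℕ) : 0 ≤ g n * w n := mul_nonneg (hg n) (h.pos n).le
  refine le_of_mul_le_mul_left ?_ (by positivity : (0 : ℝ) < 2 ^ k)
  calc 2 ^ k * (tripleAvg f k j * ∑ n ∈ dyadic k j, g n * w n)
      = (∑ n ∈ triple k j, ‖f n‖) * ∑ n ∈ dyadic k j, g n * w n := by
        rw [← tripleAvg_mul_two_pow]
        ring
    _ ≤ (∑ n ∈ triple k j, ‖f n‖) * ∑ n ∈ triple k j, g n * w n :=
        mul_le_mul_of_nonneg_left (sum_le_sum_of_subset_of_nonneg (dyadic_subset_triple k j)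
          fun n _ _ => hgw n) (sum_nonneg fun n _ => norm_nonneg _)
    _ ≤ _ := h.sum_triple_mul_sum_triple_le (fun n => norm_nonneg (f n)) hgw hk hs hcard
    _ = _ := by rw [← mul_sum, mul_assoc]

theorem exists_pairing_le (h : DualWeights p q w σ A) (hK : HasOscBound K C) (hC₁ : 0 ≤ C₁)
    (hweak : WeakType K 1 C₁) : ∃ M > 0, ∀ (N : ℕ) (f : ℕ → E) (g : ℕ → ℝ), (∀ n, 0 ≤ g n) →
      (∀ n, 2 ^ N ≤ n → f n = 0) → (∀ n, 2 ^ N ≤ n → g n = 0) →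
        ∑ n ∈ range (2 ^ N), ‖matApply K (triple N 0) f n‖ * (g n * w n) ≤
          M * (∑ n ∈ range (2 ^ N), ‖f n‖ ^ p * w n + ∑ n ∈ range (2 ^ N), g n ^ q * w n) := by
  obtain ⟨c₁, hc₁, hmaxf⟩ := h.symm.exists_sum_tripleMax_rpow_le
  obtain ⟨c₂, hc₂, hmaxg⟩ := h.exists_sum_tripleMax_rpow_le
  have hA := h.const_pos
  have hC := hK.nonneg
  set c := 8 * (C₁ + 10)
  set M := 3 * A * (6 * A) ^ (q / p + p / q)
  refine ⟨(6 * C + 2) * c * (M * (c₁ + c₂)), by positivity, fun N f g hg hfN hgN => ?_⟩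
  have hgw (n : ℕ) : 0 ≤ g n * w n := mul_nonneg (hg n) (h.pos n).le
  have hsparse := hK.sum_norm_matApply_mul_le (by positivity : 0 ≤ c) hgw
    (eight_mul_card_exceptionalSet_le hC₁ hweak f)
    (fun i l s hs hi hcard => h.tripleAvg_mul_sum_le f hg hi hs hcard) (k := N) 0
  have hf' := hmaxf N (fun n => ‖f n‖) (fun n => norm_nonneg _) fun n hn => by
    rw [hfN n hn, norm_zero]
  have hg' := hmaxg N (fun n => g n * w n) hgw fun n hn => by rw [hgN n hn, zero_mul]
  simp only [div_rpow_mul_eq (norm_nonneg _) (h.pos' _) (h.dual_rpow _)] at hf'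
  simp only [mul_div_cancel_right₀ _ (h.pos _).ne'] at hg'
  rw [dyadic_index_zero, ← mul_sum, sum_add_distrib] at hsparse
  set Y := ∑ n ∈ range (2 ^ N), ‖f n‖ ^ p * w n
  set Z := ∑ n ∈ range (2 ^ N), g n ^ q * w n
  have hY : 0 ≤ Y := sum_nonneg fun n _ =>
    mul_nonneg (Real.rpow_nonneg (norm_nonneg _) _) (h.pos n).le
  have hZ : 0 ≤ Z := sum_nonneg fun n _ => mul_nonneg (Real.rpow_nonneg (hg n) _) (h.pos n).le
  calc _ ≤ (6 * C + 2) * c * (M * (c₁ * Y + c₂ * Z)) := hsparse.trans (by gcongr)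
    _ ≤ (6 * C + 2) * c * (M * ((c₁ + c₂) * Y + (c₁ + c₂) * Z)) := by
        gcongr
        exacts [le_add_of_nonneg_right hc₂.le, le_add_of_nonneg_left hc₁.le]
    _ = _ := by ring

theorem exists_strongType (h : DualWeights p q w σ A) (hK : HasOscBound K C) (hC₁ : 0 ≤ C₁)
    (hweak : WeakType K 1 C₁) : ∃ B ≥ 0, StrongType K p w B := by
  obtain ⟨M, hM, hpair⟩ := h.exists_pairing_le hK hC₁ hweak
  refine ⟨(2 * M) ^ p, by positivity, StrongType.of_range h.pos h.conj.ne_zero fun N f =>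
    sum_rpow_mul_le_of_pairing h.conj hM (fun n => norm_nonneg _) fun g hg => ?_⟩
  set R := range (2 ^ N)
  have hRT : R ⊆ triple N 0 := (dyadic_index_zero N).symm.subset.trans (dyadic_subset_triple N 0)
  have hR {n : ℕ} (hn : 2 ^ N ≤ n) : n ∉ (R : Set ℕ) := fun h =>
    hn.not_gt (mem_range.1 (mem_coe.1 h))
  have hind := hpair N (Set.indicator R f) (Set.indicator R g)
    (fun n => Set.indicator_nonneg (fun n _ => hg n) n)
    (fun n hn => Set.indicator_of_notMem (hR hn) f) fun n hn => Set.indicator_of_notMem (hR hn) g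
  rwa [matApply_indicator K hRT,
    sum_indicator_of_subset subset_rfl g (φ := fun n v => ‖matApply K R f n‖ * (v * w n))
      fun n => by rw [zero_mul, mul_zero],
    sum_indicator_of_subset subset_rfl f (φ := fun n v => ‖v‖ ^ p * w n)
      fun n => by rw [norm_zero, Real.zero_rpow h.conj.ne_zero, zero_mul],
    sum_indicator_of_subset subset_rfl g (φ := fun n v => v ^ q * w n)
      fun n => by rw [Real.zero_rpow h.symm.conj.ne_zero, zero_mul]] at hind

end Operator

end DualWeights

end Muckenhoupt

section MuckenhouptWeights

variable {p A : ℝ} {w : ℕ → ℝ}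

theorem cast_card_Icc {a m : ℕ} (h : a ≤ m) : (#(Icc a m) : ℝ) = m - a + 1 := by
  rw [Nat.card_Icc, Nat.cast_sub (by omega), Nat.cast_succ]
  ring

theorem exists_sum_Ico_mul_rpow_le (hw : IsMuckenhouptAp p w) :
    ∃ A ≥ 0, ∀ a b : ℕ, (∑ n ∈ Ico a b, w n) * (∑ n ∈ Ico a b, w n ^ (-1 / (p - 1))) ^ (p - 1) ≤
      A * (#(Ico a b) : ℝ) ^ p := by
  obtain ⟨-, A, hA⟩ := hw
  refine ⟨max A 0, le_max_right _ _, fun a b => ?_⟩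
  rcases le_or_gt b a with hba | hab
  · rw [Ico_eq_empty hba.not_gt, sum_empty, zero_mul]
    positivity
  obtain ⟨m, rfl⟩ := Nat.exists_eq_add_one.2 (Nat.zero_lt_of_lt hab)
  have ham : a ≤ m := Nat.lt_succ_iff.1 hab
  have : (0 : ℝ) < #(Icc a m) := by simpa using hab
  rw [Ico_add_one_right_eq_Icc]
  calc _ ≤ A * (#(Icc a m) : ℝ) ^ p := by
        rw [← div_le_iff₀ (by positivity), div_eq_inv_mul, ← mul_assoc, inv_eq_one_div,
          cast_card_Icc ham]
        exact hA a m ham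
    _ ≤ _ := by gcongr; exact le_max_left A 0

theorem exists_dualWeights (hp : 1 < p) (hw : IsMuckenhouptAp p w) :
    ∃ A, DualWeights p p.conjExponent w (fun n => w n ^ (-1 / (p - 1))) A := by
  obtain ⟨A, hA, hbound⟩ := exists_sum_Ico_mul_rpow_le hw
  have hpq := Real.HolderConjugate.conjExponent hp
  have hp₀ := hpq.pos
  have hp₁ : p - 1 ≠ 0 := hpq.sub_one_ne_zero
  have hq : 1 / p.conjExponent = (p - 1) * (1 / p) := by
    rw [Real.conjExponent]
    field_simp
  refine ⟨A ^ (1 / p), hpq, hw.1, fun n => Real.rpow_pos_of_pos (hw.1 n) _, fun n => ?_,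
    fun a b => ?_⟩
  · have hexp : 1 / p + -1 / (p - 1) * ((p - 1) * (1 / p)) = 0 := by
      field_simp
      ring
    rw [hq, ← Real.rpow_mul (hw.1 n).le, ← Real.rpow_add (hw.1 n), hexp, Real.rpow_zero]
  · have hw₀ : 0 ≤ ∑ n ∈ Ico a b, w n := sum_nonneg fun n _ => (hw.1 n).le
    have hσ₀ : 0 ≤ ∑ n ∈ Ico a b, w n ^ (-1 / (p - 1)) :=
      sum_nonneg fun n _ => Real.rpow_nonneg (hw.1 n).le _
    rw [hq, Real.rpow_mul hσ₀, ← Real.mul_rpow hw₀ (by positivity)]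
    refine (Real.rpow_le_rpow (by positivity) (hbound a b) (by positivity)).trans_eq ?_
    rw [Real.mul_rpow hA (by positivity), one_div, Real.rpow_rpow_inv (by positivity) hp₀.ne']

theorem exists_a1Bound (hw : IsMuckenhouptA1 w) : ∃ A, A1Bound w A := by
  obtain ⟨hpos, A, hA⟩ := hw
  refine ⟨A, fun a b x hx => ?_⟩
  obtain ⟨hax, hxb⟩ := mem_Ico.1 hx
  obtain ⟨m, rfl⟩ := Nat.exists_eq_add_one.2 (Nat.zero_lt_of_lt hxb)
  rw [Ico_add_one_right_eq_Icc] at hx ⊢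
  have ham := hax.trans (mem_Icc.1 hx).2
  have : (0 : ℝ) < #(Icc a m) := mod_cast card_pos.2 ⟨x, hx⟩
  have hx₀ := hpos x
  rw [mul_assoc, ← div_le_iff₀ (by positivity)]
  calc (∑ y ∈ Icc a m, w y) / (#(Icc a m) * w x)
      = 1 / (#(Icc a m) : ℝ) * (∑ y ∈ Icc a m, w y) * (1 / w x) := by field_simp
    _ ≤ 1 / (#(Icc a m) : ℝ) * (∑ y ∈ Icc a m, w y) *
          (Icc a m).sup' (nonempty_Icc.2 ham) fun k => 1 / w k := by
        gcongr
        exacts [mul_nonneg (by positivity) (sum_nonneg fun n _ => (hpos n).le),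
          le_sup' (fun k => 1 / w k) hx]
    _ ≤ A := by
        rw [cast_card_Icc ham]
        exact hA a m ham

theorem a1Bound_one : A1Bound 1 1 := fun a b x _ => by simp

theorem A1Bound.dualWeights (hA : A1Bound w A) (hw : ∀ n, 0 < w n) :
    DualWeights 2 2 w (fun n => (w n)⁻¹) (A ^ (1 / 2 : ℝ)) := by
  have hA₀ : 0 ≤ A := zero_le_one.trans (hA.one_le hw)
  refine ⟨Real.HolderConjugate.two_two, hw, fun n => inv_pos.2 (hw n), fun n => ?_, fun a b => ?_⟩
  · rw [← Real.mul_rpow (hw n).le (inv_pos.2 (hw n)).le, mul_inv_cancel₀ (hw n).ne', Real.one_rpow]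
  · have hprod : (∑ n ∈ Ico a b, w n) * ∑ n ∈ Ico a b, (w n)⁻¹ ≤ A * (#(Ico a b) : ℝ) ^ 2 :=
      calc (∑ n ∈ Ico a b, w n) * ∑ n ∈ Ico a b, (w n)⁻¹
          = ∑ x ∈ Ico a b, (∑ n ∈ Ico a b, w n) * (w x)⁻¹ := mul_sum ..
        _ ≤ ∑ _x ∈ Ico a b, A * #(Ico a b) := by
            refine sum_le_sum fun x hx => ?_
            rw [← div_eq_mul_inv, div_le_iff₀ (hw x)]
            exact hA a b x hx
        _ = A * (#(Ico a b) : ℝ) ^ 2 := by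
            rw [sum_const, nsmul_eq_mul]
            ring
    rw [← Real.mul_rpow (sum_nonneg fun n _ => (hw n).le)
      (sum_nonneg fun n _ => (inv_pos.2 (hw n)).le), ← Real.sqrt_eq_rpow, ← Real.sqrt_eq_rpow]
    refine (Real.sqrt_le_sqrt hprod).trans_eq ?_
    rw [Real.sqrt_mul hA₀, Real.sqrt_sq (Nat.cast_nonneg _)]

end MuckenhouptWeights

section WeightedBounds

variable {𝕜 E F : Type*} [RCLike 𝕜] [NormedAddCommGroup E] [NormedSpace 𝕜 E]
  [NormedAddCommGroup F] [NormedSpace 𝕜 F] {K : ℕ → ℕ → E →L[𝕜] F} {p q A B : ℝ} {w : ℕ → ℝ}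

theorem StrongType.exists_weakType (h : StrongType K q w B) (hK : IsLocalStandardKernel K)
    (hw : ∀ n, 0 < w n) (hA : A1Bound w A) (hq : 1 ≤ q) (hB : 0 ≤ B) :
    ∃ B' ≥ 0, WeakType K w B' := by
  obtain ⟨C, hC⟩ := exists_hasOscBound hK
  have hA₁ := hA.one_le hw
  have hC₀ := hC.nonneg
  exact ⟨_, by positivity, hC.weakType hw hA hq hB h⟩

theorem StrongType.exists_strongType_of_dualWeights {σ : ℕ → ℝ} {p' : ℝ} (h : StrongType K q 1 B)
    (hK : IsLocalStandardKernel K) (hw : DualWeights p p' w σ A) (hq : 1 ≤ q) (hB : 0 ≤ B) :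
    ∃ B' ≥ 0, StrongType K p w B' := by
  obtain ⟨C, hC⟩ := exists_hasOscBound hK
  obtain ⟨C₁, hC₁, hweak⟩ := h.exists_weakType hK (fun _ => one_pos) a1Bound_one hq hB
  exact hw.exists_strongType hC hC₁ hweak

theorem StrongType.exists_strongType_of_isMuckenhouptAp (h : StrongType K q 1 B)
    (hK : IsLocalStandardKernel K) (hp : 1 < p) (hw : IsMuckenhouptAp p w) (hq : 1 ≤ q)
    (hB : 0 ≤ B) : ∃ B' ≥ 0, StrongType K p w B' := by
  obtain ⟨A, hA⟩ := exists_dualWeights hp hw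
  exact h.exists_strongType_of_dualWeights hK hA hq hB

theorem StrongType.exists_weakType_of_isMuckenhouptA1 (h : StrongType K q 1 B)
    (hK : IsLocalStandardKernel K) (hw : IsMuckenhouptA1 w) (hq : 1 ≤ q) (hB : 0 ≤ B) :
    ∃ B' ≥ 0, WeakType K w B' := by
  obtain ⟨A, hA⟩ := exists_a1Bound hw
  obtain ⟨B', hB', h₂⟩ := h.exists_strongType_of_dualWeights hK (hA.dualWeights hw.1) hq hB
  exact h₂.exists_weakType hK hw.1 hA one_le_two hB'

end WeightedBounds

/-! ### Weighted sequence spaces -/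

section WeightMeasure

variable {E : Type*} [NormedAddCommGroup E] {p : ℝ} {w : ℕ → ℝ} {f : ℕ → E}

theorem lintegral_weightMeasure (w : ℕ → ℝ) (φ : ℕ → ℝ≥0∞) :
    ∫⁻ n, φ n ∂weightMeasure w = ∑' n, ENNReal.ofReal (w n) * φ n := by
  simp [weightMeasure, lintegral_sum_measure]

theorem weightMeasure_apply (w : ℕ → ℝ) (s : Set ℕ) :
    weightMeasure w s = ∑' n, s.indicator (fun n => ENNReal.ofReal (w n)) n := by
  rw [weightMeasure, Measure.sum_apply _ (MeasurableSet.of_discrete)]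
  refine tsum_congr fun n => ?_
  by_cases hn : n ∈ s <;> simp [hn]

theorem eLpNorm_weightMeasure (hp : 0 < p) (w : ℕ → ℝ) (f : ℕ → E) :
    eLpNorm f (ENNReal.ofReal p) (weightMeasure w) =
      (∑' n, ENNReal.ofReal (‖f n‖ ^ p * w n)) ^ (1 / p) := by
  rw [eLpNorm_eq_lintegral_rpow_enorm_toReal (ENNReal.ofReal_pos.2 hp).ne' ENNReal.ofReal_ne_top,
    ENNReal.toReal_ofReal hp.le, lintegral_weightMeasure]
  congr 2 with n
  rw [mul_comm, ENNReal.ofReal_mul (by positivity), ← ENNReal.ofReal_rpow_of_nonneg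
    (norm_nonneg _) hp.le, ofReal_norm]

theorem eLpNorm_one_weightMeasure (w : ℕ → ℝ) (f : ℕ → E) :
    eLpNorm f 1 (weightMeasure w) = ∑' n, ENNReal.ofReal (‖f n‖ * w n) := by
  simpa using eLpNorm_weightMeasure one_pos w f

theorem memLp_weightMeasure_iff (hp : 0 < p) (hw : ∀ n, 0 < w n) :
    MemLp f (ENNReal.ofReal p) (weightMeasure w) ↔ Summable fun n => ‖f n‖ ^ p * w n := by
  have hterm (n : ℕ) : 0 ≤ ‖f n‖ ^ p * w n := mul_nonneg (by positivity) (hw n).le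
  rw [MemLp, and_iff_right AEStronglyMeasurable.of_discrete, eLpNorm_weightMeasure hp,
    ENNReal.rpow_lt_top_iff_of_pos (by positivity)]
  refine ⟨fun h => ?_, Summable.tsum_ofReal_lt_top⟩
  simpa only [ENNReal.toReal_ofReal (hterm _)] using ENNReal.summable_toReal h.ne

theorem memLp_one_weightMeasure_iff (hw : ∀ n, 0 < w n) :
    MemLp f 1 (weightMeasure w) ↔ Summable fun n => ‖f n‖ * w n := by
  simpa using memLp_weightMeasure_iff (f := f) one_pos hw

theorem weakL1Norm_le_ofReal {D : ℝ} (hw : ∀ n, 0 < w n)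
    (h : ∀ (W : Finset ℕ) ⦃t : ℝ⦄, 0 < t → t * ∑ n ∈ W with t < ‖f n‖, w n ≤ D) :
    weakL1Norm w f ≤ ENNReal.ofReal D := by
  refine iSup_le fun t => ?_
  rcases eq_zero_or_pos t with rfl | ht
  · simp
  rw [weightMeasure_apply, ← ENNReal.tsum_mul_left]
  refine ENNReal.tsum_le_of_sum_range_le fun N => ?_
  have hfilter : ∑ n ∈ range N, {n | t < ‖f n‖₊}.indicator (fun n => ENNReal.ofReal (w n)) n =
      ∑ n ∈ range N with (t : ℝ) < ‖f n‖, ENNReal.ofReal (w n) :=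
    sum_indicator_eq_sum_filter _ (fun _ n => ENNReal.ofReal (w n)) (fun _ => {n | t < ‖f n‖₊}) id
  rw [← mul_sum, hfilter, ← ENNReal.ofReal_coe_nnreal,
    ← ENNReal.ofReal_sum_of_nonneg fun n _ => (hw n).le, ← ENNReal.ofReal_mul t.coe_nonneg]
  exact ENNReal.ofReal_le_ofReal (h (range N) (NNReal.coe_pos.2 ht))

end WeightMeasure

section InfiniteMatrix

variable {𝕜 E F : Type*} [RCLike 𝕜] [NormedAddCommGroup E] [NormedSpace 𝕜 E]
  [NormedAddCommGroup F] [NormedSpace 𝕜 F] {K : ℕ → ℕ → E →L[𝕜] F} {p B : ℝ} {w : ℕ → ℝ}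
  {f : ℕ → E}

/-- The action of the full matrix `K` on a sequence `f`; the value at `n` is the junk value `0` if
the series diverges. -/
noncomputable def matTsum (K : ℕ → ℕ → E →L[𝕜] F) (f : ℕ → E) (n : ℕ) : F := ∑' m, K n m (f m)

theorem exists_linearMap_eq_matTsum {V : Submodule 𝕜 (ℕ → E)} {V' : Submodule 𝕜 (ℕ → F)}
    (hsum : ∀ f ∈ V, ∀ n, Summable fun m => K n m (f m)) (hmem : ∀ f ∈ V, matTsum K f ∈ V') :
    ∃ L : V →ₗ[𝕜] V', ∀ f : V, (L f : ℕ → F) = matTsum K f := by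
  refine ⟨{ toFun := fun f => ⟨matTsum K f, hmem f f.2⟩, map_add' := ?_, map_smul' := ?_ },
    fun f => rfl⟩
  · intro f g
    ext n
    simp only [matTsum, Submodule.coe_add, Pi.add_apply, map_add]
    exact (hsum f f.2 n).tsum_add (hsum g g.2 n)
  · intro c f
    ext n
    simp only [matTsum, Submodule.coe_smul, Pi.smul_apply, map_smul, RingHom.id_apply]
    exact (hsum f f.2 n).tsum_const_smul c

theorem tendsto_matApply {n : ℕ} (h : Summable fun m => K n m (f m)) :
    Filter.Tendsto (fun S => matApply K S f n) Filter.atTop (nhds (matTsum K f n)) :=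
  h.hasSum

theorem summable_of_forall_sum_lt [CompleteSpace F] {c : ℕ → ℝ} (hc : Summable c) {v : ℕ → F}
    (h : ∀ ε > 0, ∃ η > 0, ∀ s : Finset ℕ, ∑ m ∈ s, c m < η → ‖∑ m ∈ s, v m‖ < ε) :
    Summable v := by
  rw [summable_iff_vanishing_norm] at hc ⊢
  intro ε hε
  obtain ⟨η, hη, hsmall⟩ := h ε hε
  obtain ⟨s, hs⟩ := hc η hη
  exact ⟨s, fun t ht => hsmall t ((le_abs_self _).trans_lt (hs t ht))⟩

namespace StrongType

theorem summable [CompleteSpace F] (h : StrongType K p w B) (hp : 0 < p) (hw : ∀ n, 0 < w n)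
    (hB : 0 ≤ B) (hf : Summable fun m => ‖f m‖ ^ p * w m) (n : ℕ) :
    Summable fun m => K n m (f m) := by
  have hwn := hw n
  refine summable_of_forall_sum_lt hf fun ε hε =>
    ⟨ε ^ p * w n / (B + 1), by positivity, fun s hs => ?_⟩
  have hnorm : ‖∑ m ∈ s, K n m (f m)‖ ^ p * w n ≤ B * ∑ m ∈ s, ‖f m‖ ^ p * w m := by
    simpa [matApply] using h s {n} f
  have hsum : 0 ≤ ∑ m ∈ s, ‖f m‖ ^ p * w m :=
    sum_nonneg fun m _ => mul_nonneg (by positivity) (hw m).le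
  rw [lt_div_iff₀ (by positivity)] at hs
  exact (Real.rpow_lt_rpow_iff (norm_nonneg _) hε.le hp).1
    (lt_of_mul_lt_mul_right (by linarith) hwn.le)

theorem sum_matTsum_le [CompleteSpace F] (h : StrongType K p w B) (hp : 0 < p)
    (hw : ∀ n, 0 < w n) (hB : 0 ≤ B) (hf : Summable fun m => ‖f m‖ ^ p * w m) (W : Finset ℕ) :
    ∑ n ∈ W, ‖matTsum K f n‖ ^ p * w n ≤ B * ∑' m, ‖f m‖ ^ p * w m := by
  have hlim (n : ℕ) := (tendsto_matApply (h.summable hp hw hB hf n)).norm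
  refine le_of_tendsto (tendsto_finsetSum W fun n _ =>
    ((hlim n).rpow_const (Or.inr hp.le)).mul_const (w n)) (.of_forall fun S => (h S W f).trans ?_)
  exact mul_le_mul_of_nonneg_left
    (hf.sum_le_tsum S fun m _ => mul_nonneg (by positivity) (hw m).le) hB

theorem eLpNorm_matTsum_le [CompleteSpace F] (h : StrongType K p w B) (hp : 0 < p)
    (hw : ∀ n, 0 < w n) (hB : 0 ≤ B) (hf : Summable fun m => ‖f m‖ ^ p * w m) :
    eLpNorm (matTsum K f) (ENNReal.ofReal p) (weightMeasure w) ≤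
      (B.toNNReal ^ (1 / p) : ℝ≥0) * eLpNorm f (ENNReal.ofReal p) (weightMeasure w) := by
  rw [eLpNorm_weightMeasure hp, eLpNorm_weightMeasure hp, ENNReal.coe_rpow_of_nonneg _
    (by positivity), ← ENNReal.mul_rpow_of_nonneg _ _ (by positivity)]
  refine ENNReal.rpow_le_rpow (ENNReal.tsum_le_of_sum_range_le fun N => ?_) (by positivity)
  rw [← ENNReal.ofReal_tsum_of_nonneg (fun m => mul_nonneg (by positivity) (hw m).le) hf,
    ← ENNReal.ofReal_sum_of_nonneg fun n _ => mul_nonneg (by positivity) (hw n).le]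
  exact (ENNReal.ofReal_le_ofReal (h.sum_matTsum_le hp hw hB hf _)).trans_eq (ENNReal.ofReal_mul hB)

theorem exists_linearMap [CompleteSpace F] (h : StrongType K p w B) (hp : 0 < p)
    (hw : ∀ n, 0 < w n) (hB : 0 ≤ B) :
    ∃ L : weightedLp 𝕜 E (ENNReal.ofReal p) w →ₗ[𝕜] weightedLp 𝕜 F (ENNReal.ofReal p) w,
      (∀ f, (L f : ℕ → F) = matTsum K f) ∧
      ∃ C : ℝ≥0, ∀ f : weightedLp 𝕜 E (ENNReal.ofReal p) w,
        eLpNorm (L f : ℕ → F) (ENNReal.ofReal p) (weightMeasure w) ≤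
          C * eLpNorm (f : ℕ → E) (ENNReal.ofReal p) (weightMeasure w) := by
  have hsum (f) (hf : f ∈ weightedLp 𝕜 E (ENNReal.ofReal p) w) :=
    (memLp_weightMeasure_iff hp hw).1 hf
  obtain ⟨L, hL⟩ := exists_linearMap_eq_matTsum (V' := weightedLp 𝕜 F (ENNReal.ofReal p) w)
    (fun f hf n => h.summable hp hw hB (hsum f hf) n)
    fun f hf => (memLp_weightMeasure_iff hp hw).2 <| summable_of_sum_le
      (fun n => mul_nonneg (by positivity) (hw n).le) (h.sum_matTsum_le hp hw hB (hsum f hf))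
  refine ⟨L, hL, B.toNNReal ^ (1 / p), fun f => ?_⟩
  rw [hL]
  exact h.eLpNorm_matTsum_le hp hw hB (hsum f f.2)

end StrongType

namespace WeakType

theorem summable [CompleteSpace F] (h : WeakType K w B) (hw : ∀ n, 0 < w n) (hB : 0 ≤ B)
    (hf : Summable fun m => ‖f m‖ * w m) (n : ℕ) : Summable fun m => K n m (f m) := by
  have hwn := hw n
  refine summable_of_forall_sum_lt hf fun ε hε =>
    ⟨ε / 2 * w n / (B + 1), by positivity, fun s hs => ?_⟩
  by_contra! hle
  have hlt : ε / 2 < ‖matApply K s f n‖ := (half_lt_self hε).trans_le hle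
  have hweak := h s {n} f (half_pos hε)
  rw [filter_singleton, if_pos hlt, sum_singleton] at hweak
  have hsum : 0 ≤ ∑ m ∈ s, ‖f m‖ * w m :=
    sum_nonneg fun m _ => mul_nonneg (norm_nonneg _) (hw m).le
  rw [lt_div_iff₀ (by positivity)] at hs
  linarith

theorem sum_matTsum_le [CompleteSpace F] (h : WeakType K w B) (hw : ∀ n, 0 < w n) (hB : 0 ≤ B)
    (hf : Summable fun m => ‖f m‖ * w m) (W : Finset ℕ) ⦃t : ℝ⦄ (ht : 0 < t) :
    t * ∑ n ∈ W with t < ‖matTsum K f n‖, w n ≤ B * ∑' m, ‖f m‖ * w m := by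
  set V := W.filter fun n => t < ‖matTsum K f n‖
  have hlim (n : ℕ) := (tendsto_matApply (h.summable hw hB hf n)).norm
  obtain ⟨S, hSV⟩ : ∃ S, ∀ n ∈ V, t < ‖matApply K S f n‖ :=
    Filter.Eventually.exists (f := Filter.atTop) <| (Filter.eventually_all_finset V).2 fun n hn =>
      (hlim n).eventually_const_lt (mem_filter.1 hn).2
  have hweak := h S V f ht
  rw [filter_true_of_mem hSV] at hweak
  exact hweak.trans (mul_le_mul_of_nonneg_left (hf.sum_le_tsum S fun m _ =>
    mul_nonneg (norm_nonneg _) (hw m).le) hB)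

theorem weakL1Norm_matTsum_le [CompleteSpace F] (h : WeakType K w B) (hw : ∀ n, 0 < w n)
    (hB : 0 ≤ B) (hf : Summable fun m => ‖f m‖ * w m) :
    weakL1Norm w (matTsum K f) ≤ B.toNNReal * eLpNorm f 1 (weightMeasure w) := by
  rw [eLpNorm_one_weightMeasure,
    ← ENNReal.ofReal_tsum_of_nonneg (fun m => mul_nonneg (norm_nonneg _) (hw m).le) hf]
  exact (weakL1Norm_le_ofReal hw (h.sum_matTsum_le hw hB hf)).trans_eq (ENNReal.ofReal_mul hB)

theorem exists_linearMap [CompleteSpace F] (h : WeakType K w B) (hw : ∀ n, 0 < w n)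
    (hB : 0 ≤ B) :
    ∃ L : weightedLp 𝕜 E 1 w →ₗ[𝕜] weightedWeakL1 𝕜 F w,
      (∀ f, (L f : ℕ → F) = matTsum K f) ∧
      ∃ C : ℝ≥0, ∀ f : weightedLp 𝕜 E 1 w,
        weakL1Norm w (L f : ℕ → F) ≤ C * eLpNorm (f : ℕ → E) 1 (weightMeasure w) := by
  have hsum (f) (hf : f ∈ weightedLp 𝕜 E 1 w) := (memLp_one_weightMeasure_iff hw).1 hf
  have hbound (f) (hf : f ∈ weightedLp 𝕜 E 1 w) :=
    h.weakL1Norm_matTsum_le hw hB (hsum f hf)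
  obtain ⟨L, hL⟩ := exists_linearMap_eq_matTsum (V' := weightedWeakL1 𝕜 F w)
    (fun f hf n => h.summable hw hB (hsum f hf) n)
    fun f hf => (hbound f hf).trans_lt (ENNReal.mul_lt_top ENNReal.coe_lt_top hf.2)
  refine ⟨L, hL, B.toNNReal, fun f => ?_⟩
  rw [hL]
  exact hbound f f.2

end WeakType

end InfiniteMatrix

section MatrixOfOperator

variable {𝕜 E F : Type*} [RCLike 𝕜] [NormedAddCommGroup E] [NormedSpace 𝕜 E]
  [NormedAddCommGroup F] [NormedSpace 𝕜 F] {K K' : ℕ → ℕ → E →L[𝕜] F} {r : ℝ≥0∞}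
  [Fact (1 ≤ r)]

/-- The matrix of an operator `T` on `ℓ^r`: its `m`-th column is `T` on the `m`-th coordinate. -/
noncomputable def matrixOf (T : lp (fun _ : ℕ => E) r →L[𝕜] lp (fun _ : ℕ => F) r) (n m : ℕ) :
    E →L[𝕜] F :=
  (lp.evalCLM 𝕜 (fun _ : ℕ => F) r n).comp
    (T.comp (lp.singleContinuousLinearMap 𝕜 (fun _ : ℕ => E) r m))

variable (T : lp (fun _ : ℕ => E) r →L[𝕜] lp (fun _ : ℕ => F) r)

theorem matrixOf_apply (n m : ℕ) (v : E) : matrixOf T n m v = T (lp.single r m v) n := rfl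

theorem matTsum_matrixOf (hr : r < ∞) (f : lp (fun _ : ℕ => E) r) : matTsum (matrixOf T) f = T f :=
  funext fun n =>
    (((lp.evalCLM 𝕜 (fun _ : ℕ => F) r n).comp T).hasSum (lp.hasSum_single hr.ne f)).tsum_eq

theorem matApply_matrixOf (S : Finset ℕ) (f : ℕ → E) (n : ℕ) :
    matApply (matrixOf T) S f n = T (∑ m ∈ S, lp.single r m (f m)) n :=
  (map_sum ((lp.evalCLM 𝕜 (fun _ : ℕ => F) r n).comp T) (fun m => lp.single r m (f m)) S).symm

theorem strongType_matrixOf (hr : r < ∞) :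
    StrongType (matrixOf T) r.toReal 1 (‖T‖ ^ r.toReal) := by
  intro S W f
  have hr₀ : 0 < r.toReal := ENNReal.toReal_pos (zero_lt_one.trans_le Fact.out).ne' hr.ne
  simp only [matApply_matrixOf, Pi.one_apply, mul_one]
  rw [← lp.norm_sum_single (E := fun _ : ℕ => E) hr₀ f S,
    ← Real.mul_rpow (norm_nonneg _) (norm_nonneg _)]
  exact (lp.sum_rpow_le_norm_rpow hr₀ _ W).trans
    (Real.rpow_le_rpow (norm_nonneg _) (T.le_opNorm _) hr₀.le)

theorem matrixOf_eq (hTK : ∀ f : lp (fun _ : ℕ => E) r, (∃ k : ℕ, ∀ n > k, f n = 0) →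
      ∀ n : ℕ, f n = 0 → T f n = ∑' m : ℕ, K n m (f m)) {n m : ℕ} (hnm : n ≠ m) :
    matrixOf T n m = K n m := by
  ext v
  have hzero (k : ℕ) (hk : k ≠ m) : (lp.single r m v : lp (fun _ : ℕ => E) r) k = 0 :=
    lp.single_apply_ne (E := fun _ : ℕ => E) r m v hk
  rw [matrixOf_apply, hTK _ ⟨m, fun k hk => hzero k hk.ne'⟩ n (hzero n hnm), tsum_eq_single m,
    lp.single_apply_self (E := fun _ : ℕ => E)]
  exact fun k hk => by rw [hzero k hk, map_zero]

theorem isLocalStandardKernel_congr (hK : IsLocalStandardKernel K)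
    (h : ∀ n m, n ≠ m → K' n m = K n m) : IsLocalStandardKernel K' := by
  obtain ⟨C, hC, hsize, hreg, hreg'⟩ := hK
  have hne {n m l : ℕ} (hlt : |(n : ℝ) - m| > 2 * |(n : ℝ) - l|) : n ≠ m ∧ l ≠ m := by
    have := abs_nonneg ((n : ℝ) - l)
    refine ⟨?_, ?_⟩ <;> rintro rfl
    · rw [sub_self, abs_zero] at hlt
      linarith
    · linarith
  refine ⟨C, hC, fun n m hnm => ?_, fun n m l hlt => ?_, fun n m l hlt => ?_⟩
  · rw [h n m hnm]
    exact hsize n m hnm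
  · rw [h n m (hne hlt).1, h l m (hne hlt).2]
    exact hreg n m l hlt
  · rw [h m n (hne hlt).1.symm, h m l (hne hlt).2.symm]
    exact hreg' n m l hlt

end MatrixOfOperator

end LocalCZ

theorem theorem2p1_general {𝕜 B₁ B₂ : Type*} [RCLike 𝕜]
    [NormedAddCommGroup B₁] [NormedSpace 𝕜 B₁]
    [NormedAddCommGroup B₂] [NormedSpace 𝕜 B₂] [CompleteSpace B₂]
    (r : ℝ≥0∞) [Fact (1 ≤ r)] (hr_top : r < ∞)
    (T : lp (fun _ : ℕ => B₁) r →L[𝕜] lp (fun _ : ℕ => B₂) r)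
    (K : ℕ → ℕ → B₁ →L[𝕜] B₂) (hK : IsLocalStandardKernel K)
    (hTK : ∀ f : lp (fun _ : ℕ => B₁) r, (∃ k : ℕ, ∀ n > k, f n = 0) →
      ∀ n : ℕ, f n = 0 → T f n = ∑' m : ℕ, K n m (f m)) :
    (∀ p : ℝ, 1 < p → ∀ w : ℕ → ℝ, IsMuckenhouptAp p w →
      ∃ S : weightedLp 𝕜 B₁ (ENNReal.ofReal p) w →ₗ[𝕜] weightedLp 𝕜 B₂ (ENNReal.ofReal p) w,
        (∀ (f : lp (fun _ : ℕ => B₁) r)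
          (hf : (f : ℕ → B₁) ∈ weightedLp 𝕜 B₁ (ENNReal.ofReal p) w),
          (S ⟨f, hf⟩ : ℕ → B₂) = T f) ∧
        ∃ C : ℝ≥0, ∀ f : weightedLp 𝕜 B₁ (ENNReal.ofReal p) w,
          eLpNorm (S f : ℕ → B₂) (ENNReal.ofReal p) (weightMeasure w) ≤
            C * eLpNorm (f : ℕ → B₁) (ENNReal.ofReal p) (weightMeasure w)) ∧
    (∀ w : ℕ → ℝ, IsMuckenhouptA1 w →
      ∃ S : weightedLp 𝕜 B₁ 1 w →ₗ[𝕜] weightedWeakL1 𝕜 B₂ w,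
        (∀ (f : lp (fun _ : ℕ => B₁) r) (hf : (f : ℕ → B₁) ∈ weightedLp 𝕜 B₁ 1 w),
          (S ⟨f, hf⟩ : ℕ → B₂) = T f) ∧
        ∃ C : ℝ≥0, ∀ f : weightedLp 𝕜 B₁ 1 w,
          weakL1Norm w (S f : ℕ → B₂) ≤ C * eLpNorm (f : ℕ → B₁) 1 (weightMeasure w)) := by
  have hr₁ : 1 ≤ r.toReal := by
    simpa using ENNReal.toReal_mono hr_top.ne (Fact.out : 1 ≤ r)
  have hB : 0 ≤ ‖T‖ ^ r.toReal := by positivity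
  have hM := LocalCZ.strongType_matrixOf T hr_top
  have hKM := LocalCZ.isLocalStandardKernel_congr hK fun n m hnm => LocalCZ.matrixOf_eq T hTK hnm
  refine ⟨fun p hp w hw => ?_, fun w hw => ?_⟩
  · obtain ⟨B, hB, hstrong⟩ := hM.exists_strongType_of_isMuckenhouptAp hKM hp hw hr₁ hB
    obtain ⟨S, hST, hS⟩ := hstrong.exists_linearMap (zero_lt_one.trans hp) hw.1 hB
    exact ⟨S, fun f hf => (hST ⟨f, hf⟩).trans (LocalCZ.matTsum_matrixOf T hr_top f), hS⟩
  · obtain ⟨B, hB, hweak⟩ := hM.exists_weakType_of_isMuckenhouptA1 hKM hw hr₁ hB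
    obtain ⟨S, hST, hS⟩ := hweak.exists_linearMap hw.1 hB
    exact ⟨S, fun f hf => (hST ⟨f, hf⟩).trans (LocalCZ.matTsum_matrixOf T hr_top f), hS⟩

theorem theorem2p1 {𝕜 B₁ B₂ : Type*} [RCLike 𝕜]
    [NormedAddCommGroup B₁] [NormedSpace 𝕜 B₁] [CompleteSpace B₁]
    [NormedAddCommGroup B₂] [NormedSpace 𝕜 B₂] [CompleteSpace B₂]
    (r : ℝ≥0∞) [Fact (1 ≤ r)] (hr : 1 < r) (hr_top : r < ∞)
    (T : lp (fun _ : ℕ => B₁) r →L[𝕜] lp (fun _ : ℕ => B₂) r)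
    (K : ℕ → ℕ → B₁ →L[𝕜] B₂) (hK : IsLocalStandardKernel K)
    (hTK : ∀ f : lp (fun _ : ℕ => B₁) r, (∃ k : ℕ, ∀ n > k, f n = 0) →
      ∀ n : ℕ, f n = 0 → T f n = ∑' m : ℕ, K n m (f m)) :
    (∀ p : ℝ, 1 < p → ∀ w : ℕ → ℝ, IsMuckenhouptAp p w →
      ∃ S : weightedLp 𝕜 B₁ (ENNReal.ofReal p) w →ₗ[𝕜] weightedLp 𝕜 B₂ (ENNReal.ofReal p) w,
        (∀ (f : lp (fun _ : ℕ => B₁) r)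
          (hf : (f : ℕ → B₁) ∈ weightedLp 𝕜 B₁ (ENNReal.ofReal p) w),
          (S ⟨f, hf⟩ : ℕ → B₂) = T f) ∧
        ∃ C : ℝ≥0, ∀ f : weightedLp 𝕜 B₁ (ENNReal.ofReal p) w,
          eLpNorm (S f : ℕ → B₂) (ENNReal.ofReal p) (weightMeasure w) ≤
            C * eLpNorm (f : ℕ → B₁) (ENNReal.ofReal p) (weightMeasure w)) ∧
    (∀ w : ℕ → ℝ, IsMuckenhouptA1 w →
      ∃ S : weightedLp 𝕜 B₁ 1 w →ₗ[𝕜] weightedWeakL1 𝕜 B₂ w,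
        (∀ (f : lp (fun _ : ℕ => B₁) r) (hf : (f : ℕ → B₁) ∈ weightedLp 𝕜 B₁ 1 w),
          (S ⟨f, hf⟩ : ℕ → B₂) = T f) ∧
        ∃ C : ℝ≥0, ∀ f : weightedLp 𝕜 B₁ 1 w,
          weakL1Norm w (S f : ℕ → B₂) ≤ C * eLpNorm (f : ℕ → B₁) 1 (weightMeasure w)) :=
  theorem2p1_general r hr_top T K hK hTK
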